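/- **Theorem (Compatibility of regular turbulent solutions with classical solutions).** *Setting.* Let $d\in\{2,3\}$, $T>0$, $I=(0,T)$, and let $\Omega\subset\mathbb R^d$ be a bounded Lipschitz domain with surface measure $dS$ and (a.e. defined) outer unit normal $\mathbf n$. Let $\mu>0$, $\lambda+\frac2d\mu>0$ and $\mathbb S(\nabla\mathbf u)=\mu(\nabla\mathbf u+\nabla\mathbf u^T)+\lambda\,\mathrm{div}\,\mathbf u\,\mathbb I$. Let $0<\underline b<\overline b$, $\mathcal O=\{(R,Z):\underline bR<Z<\overline bR\}$, $P\in C^1(\overline{\mathcal O})\cap C^2(\mathcal O)$ with $P(0,0)=0$, and $H(R,Z)=R\int_1^R s^{-2}P(s,sZ/R)\,ds$ for $R>0$, $H(0,Z)=0$. Let $\mathbf u_B\in C^1(\mathbb R^d;\mathbb R^d)$, let $R_B,Z_B$ be continuous, $\Gamma^{in}=\{x\in\partial\Omega:\mathbf u_B\cdot\mathbf n<0\}$, $\Gamma^{out}=\partial\Omega\setminus\Gamma^{in}$, and let $R_0,Z_0,\mathbf u_0$ be initial data. *Dissipative turbulent solutions.* $(R,Z,\mathbf u)$ is one, with Reynolds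 defect $\mathfrak R$ and energy defect $\mathfrak E$, if for some $\gamma>1$: * $R,Z\in C_{weak}([0,T];L^\gamma(\Omega))$, with boundary traces in $L^\gamma(I;L^\gamma(\partial\Omega;|\mathbf u_B\cdot\mathbf n|dS))$; $R,Z\ge0$; $(R,Z)\in\overline{\mathcal O}$ a.e., also on $\partial\Omega$ with respect to $|\mathbf u_B\cdot\mathbf n|dS$, and $(R_B,Z_B)\in\overline{\mathcal O}$ a.e. on $\Gamma^{in}$; $\mathbf u-\mathbf u_B\in L^2(I;W^{1,2}_0(\Omega;\mathbb R^d))$; $(R+Z)\mathbf u\in C_{weak}([0,T];L^{2\gamma/(\gamma+1)}(\Omega;\mathbb R^d))$; $(R+Z)|\mathbf u|^2$, $P(R,Z)$, $H(R,Z)\in L^1(I\times\Omega)$; $H(R,Z)\in L^1(I;L^1(\partial\Omega;|\mathbf u_B\cdot\mathbf n|dS))$; the initial energy density $\frac12(R_0+Z_0)|\mathbf u_0-\mathbf u_B|^2+H(R_0,Z_0)$ is integrable; * for $(r,r_B,r_0)=(R,R_B,R_0)$ and $(Z,Z_B,Z_0)$, all $\tau\in[0,T]$ and $\varphi\in C^1([0,T]\times\overline\Omega)$,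 $$\Big[\int_\Omega r\varphi\,dx\Big]_0^\tau+\int_0^\tau\!\!\int_{\Gamma^{out}}\varphi r\,\mathbf u_B\cdot\mathbf n\,dS\,dt+\int_0^\tau\!\!\int_{\Gamma^{in}}\varphi r_B\,\mathbf u_B\cdot\mathbf n\,dS\,dt=\int_0^\tau\!\!\int_\Omega(r\partial_t\varphi+r\mathbf u\cdot\nabla\varphi)\,dx\,dt,\qquad r(0)=r_0;$$ * $\mathfrak R\in L^\infty_{weak-*}(I;\mathcal M(\overline\Omega;\mathbb R^{d\times d}_{sym}))$ is positive semidefinite, $(R+Z)\mathbf u(0)=(R_0+Z_0)\mathbf u_0$, and for all $\tau\in[0,T]$ and $\boldsymbol\varphi\in C^1([0,T]\times\overline\Omega;\mathbb R^d)$ with $\boldsymbol\varphi|_{\partial\Omega}=0$, $$\Big[\int_\Omega(R+Z)\mathbf u\cdot\boldsymbol\varphi\,dx\Big]_0^\tau=\int_0^\tau\!\!\int_\Omega\big[(R+Z)\mathbf u\cdot\partial_t\boldsymbol\varphi+(R+Z)\mathbf u\otimes\mathbf u:\nabla\boldsymbol\varphi+P(R,Z)\mathrm{div}\boldsymbol\varphi-\mathbb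 S(\nabla\mathbf u):\nabla\boldsymbol\varphi\big]dx\,dt+\int_0^\tau\!\!\int_{\overline\Omega}\nabla\boldsymbol\varphi:d\mathfrak R(t)\,dt;$$ * $\mathfrak E\in L^\infty_{weak-*}(I;\mathcal M^+(\overline\Omega))$ and for a.a. $\tau\in I$ $$\begin{aligned}&\Big[\int_\Omega\big(\tfrac12(R+Z)|\mathbf u-\mathbf u_B|^2+H(R,Z)\big)dx\Big]_0^\tau+\int_0^\tau\!\!\int_\Omega\mathbb S(\nabla\mathbf u):\nabla\mathbf u\,dx\,dt+\int_0^\tau\!\!\int_{\Gamma^{out}}H(R,Z)\mathbf u_B\cdot\mathbf n\,dS\,dt\\&+\int_0^\tau\!\!\int_{\Gamma^{in}}H(R_B,Z_B)\mathbf u_B\cdot\mathbf n\,dS\,dt+\int_{\overline\Omega}d\mathfrak E(\tau)\le-\int_0^\tau\!\!\int_\Omega[(R+Z)\mathbf u\otimes\mathbf u+P(R,Z)\mathbb I]:\nabla\mathbf u_B\,dx\,dt\\&+\int_0^\tau\!\!\int_\Omega(R+Z)\mathbf u\cdot\nabla\mathbf u_B\cdot\mathbf u_B\,dx\,dt+\int_0^\tau\!\!\int_\Omega\mathbb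 S(\nabla\mathbf u):\nabla\mathbf u_B\,dx\,dt-\int_0^\tau\!\!\int_{\overline\Omega}\nabla\mathbf u_B:d\mathfrak R(t)\,dt,\end{aligned}$$ where the value of the first bracket at time $0$ is computed from $R_0,Z_0,\mathbf u_0$; * $\underline d\,\mathfrak E\le\mathrm{Tr}\,\mathfrak R\le\overline d\,\mathfrak E$ for some constants $0<\underline d\le\overline d$ and a.a. times. *Statement.* Let $(R,Z,\mathbf u)$ be a dissipative turbulent solution with defects $\mathfrak R,\mathfrak E$ such that $\mathbf u\in C^1([0,T]\times\overline\Omega;\mathbb R^d)$, $R,Z\in C^1([0,T]\times\overline\Omega)$ and $\inf_{I\times\Omega}Z>0$. Then $\mathfrak E=\mathfrak R=0$ (for a.a. times) and $(R,Z,\mathbf u)$ is a classical solution: 1. $\partial_tR+\mathrm{div}(R\mathbf u)=0$ and $\partial_tZ+\mathrm{div}(Z\mathbf u)=0$ at every point of $I\times\Omega$; 2. $\partial_t((R+Z)\mathbf u)+\mathrm{div}((R+Z)\mathbf u\otimes\mathbf u)+\nabla P(R,Z)=\mathrm{div}\,\mathbb S(\nabla\mathbf u)$ in $I\times\Omega$;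 3. $\partial_t\big(\frac12(R+Z)|\mathbf u|^2+H(R,Z)\big)+\mathrm{div}\big[\big(\frac12(R+Z)|\mathbf u|^2+H(R,Z)+P(R,Z)\big)\mathbf u\big]=\mathrm{div}(\mathbb S\mathbf u)-\mathbb S:\nabla\mathbf u$ in $I\times\Omega$, with $\mathbb S=\mathbb S(\nabla\mathbf u)$; 4. $\mathbf u=\mathbf u_B$ on $[0,T]\times\partial\Omega$, and for $dS$-a.a. $x\in\Gamma^{in}$, $R(t,x)=R_B(x)$ and $Z(t,x)=Z_B(x)$ for all $t\in[0,T]$; 5. $R(0)=R_0$, $Z(0)=Z_0$, $(R+Z)\mathbf u(0)=(R_0+Z_0)\mathbf u_0$ a.e. in $\Omega$. In 2 and 3 the left-hand sides and $\mathbb S:\nabla\mathbf u$ are continuous functions; since $\mathbb S(\nabla\mathbf u)$ is only continuous, $\mathrm{div}\,\mathbb S$ and $\mathrm{div}(\mathbb S\mathbf u)$ are taken in $\mathcal D'(\Omega)$ at every time $t\in I$, and 2 and 3 hold moreover pointwise at every $(t,x)\in I\times\Omega$ at which $\mathbb S(\nabla\mathbf u)(t,\cdot)$ is differentiable (in particular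 where $\mathbf u(t,\cdot)$ is twice differentiable). -/

import Mathlib

open MeasureTheory Set Filter Topology
open scoped ENNReal NNReal ContDiff

namespace Bifluid

noncomputable section

/-- The Euclidean space `ℝ^d`. -/
abbrev Vec (d : ℕ) : Type := EuclideanSpace ℝ (Fin d)

/-- `d × d` tensors, as linear maps; the matrix entry `(i, j)` of `A` is `(A e_j)_i`. -/
abbrev Tensor (d : ℕ) : Type := Vec d →L[ℝ] Vec d

section Tensors

variable {d : ℕ}

/-- The `j`-th vector of the canonical basis. -/
def basisVec (j : Fin d) : Vec d := EuclideanSpace.single j 1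

/-- Matrix entries; for a velocity gradient, `entry (fderiv ℝ u x) i j = ∂_j u_i (x)`. -/
def entry (A : Tensor d) (i j : Fin d) : ℝ := A (basisVec j) i

/-- The contraction `A : B`. -/
def contract (A B : Tensor d) : ℝ := ∑ i, ∑ j, entry A i j * entry B i j

def tensorTrace (A : Tensor d) : ℝ := ∑ i, entry A i i

/-- `u ⊗ u`, with entries `u_i u_j`. -/
def tensorSq (u : Vec d) : Tensor d := (innerSL ℝ u).smulRight u

/-- The Newtonian viscous stress `μ (A + Aᵀ) + λ (tr A) 𝕀` of a velocity gradient `A`. -/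
def stress (mu lam : ℝ) (A : Tensor d) : Tensor d :=
  mu • (A + ContinuousLinearMap.adjoint A) + (lam * tensorTrace A) • ContinuousLinearMap.id ℝ (Vec d)

/-- Divergence of a vector field. -/
def divergence (v : Vec d → Vec d) (x : Vec d) : ℝ := tensorTrace (fderiv ℝ v x)

/-- Divergence of a tensor field, `(div S)_i = ∑ j, ∂_j S_ij`. -/
def tensorDiv (S : Vec d → Tensor d) (x : Vec d) : Vec d :=
  ∑ j, (fderiv ℝ S x (basisVec j)) (basisVec j)

/-- Time derivative of a function of `(t, x)`. -/
def timeDeriv {F : Type*} [NormedAddCommGroup F] [NormedSpace ℝ F]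
    (φ : ℝ × Vec d → F) (p : ℝ × Vec d) : F := fderiv ℝ φ p (1, 0)

/-- Spatial derivative of a function of `(t, x)`. -/
def spaceDeriv {F : Type*} [NormedAddCommGroup F] [NormedSpace ℝ F]
    (φ : ℝ × Vec d → F) (p : ℝ × Vec d) : Vec d →L[ℝ] F :=
  (fderiv ℝ φ p).comp (ContinuousLinearMap.inr ℝ ℝ (Vec d))

end Tensors

section Domain

variable {d : ℕ}

/-- A bounded Lipschitz domain: a bounded, open, connected, nonempty set which near each of its
boundary points `x` is, in a suitable direction `e`, the set of points strictly below the graph of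
a Lipschitz function `a` defined on the hyperplane orthogonal to `e`. -/
structure IsBoundedLipschitzDomain (Ω : Set (Vec d)) : Prop where
  isOpen : IsOpen Ω
  isConnected : IsConnected Ω
  isBounded : Bornology.IsBounded Ω
  graph : ∀ x ∈ frontier Ω, ∃ (e : Vec d) (a : (ℝ ∙ e)ᗮ → ℝ) (K : ℝ≥0) (r h : ℝ),
    ‖e‖ = 1 ∧ LipschitzWith K a ∧ 0 < r ∧ 0 < h ∧
    ∀ y : (ℝ ∙ e)ᗮ, ‖y‖ < r → |a y| < h ∧
      ∀ s : ℝ, |s| < h → (x + (y : Vec d) + s • e ∈ Ω ↔ s < a y)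

/-- `ν` is the outer unit normal to `Ω` at the boundary point `x`: for each opening `ε`, the
points near `x` in the cone around `-ν` are in `Ω` and those in the cone around `ν` are not. -/
def IsOuterNormal (Ω : Set (Vec d)) (x ν : Vec d) : Prop :=
  ‖ν‖ = 1 ∧ ∀ ε > (0 : ℝ), ∀ᶠ y in 𝓝 x,
    (inner ℝ (y - x) ν < -(ε * ‖y - x‖) → y ∈ Ω) ∧
    (ε * ‖y - x‖ < inner ℝ (y - x) ν → y ∉ Ω)

open Classical in
/-- The outer unit normal field of `Ω` (it is unique where it exists, and it exists almost
everywhere on a Lipschitz boundary; the value elsewhere is `0`). -/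
def outerNormal (Ω : Set (Vec d)) (x : Vec d) : Vec d :=
  if h : ∃ ν, IsOuterNormal Ω x ν then h.choose else 0

/-- The surface measure `dS` on `∂Ω`: the `(d-1)`-dimensional Hausdorff measure, normalized so that
it is Lebesgue measure on hyperplanes. -/
def surfaceMeasure (Ω : Set (Vec d)) : Measure (Vec d) :=
  (Measure.euclideanHausdorffMeasure (d - 1)).restrict (frontier Ω)

end Domain

section FunctionSpaces

variable {d : ℕ}

/-- `C_weak([0,T]; L^p(Ω; F))`, for `1 < p < ∞`: each `f t`, `t ∈ [0,T]`, is in `L^p`, the norms are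
bounded, and `t ↦ ∫ f(t)·η` is continuous on `[0,T]` for each `η` in the dual space `L^q`. -/
structure CWeak {F : Type*} [NormedAddCommGroup F] [InnerProductSpace ℝ F]
    (T : ℝ) (Ω : Set (Vec d)) (p : ℝ) (f : ℝ → Vec d → F) : Prop where
  measurable : AEStronglyMeasurable (fun z : ℝ × Vec d => f z.1 z.2)
    (volume.restrict (Ioo 0 T ×ˢ Ω))
  memLp : ∀ t ∈ Icc 0 T, MemLp (f t) (ENNReal.ofReal p) (volume.restrict Ω)
  bounded : ∃ C : ℝ≥0, ∀ t ∈ Icc 0 T,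
    eLpNorm (f t) (ENNReal.ofReal p) (volume.restrict Ω) ≤ C
  continuous : ∀ q : ℝ, p.HolderConjugate q → ∀ η : Vec d → F,
    MemLp η (ENNReal.ofReal q) (volume.restrict Ω) →
      ContinuousOn (fun t => ∫ x in Ω, inner ℝ (f t x) (η x)) (Icc 0 T)

/-- `v ∈ W^{1,2}_0(Ω; ℝ^d)` with weak gradient `G`: the pair `(v, G)` is in the `L²`-closure of
`(ψ, ∇ψ)`, `ψ ∈ C_c^∞(Ω; ℝ^d)`. -/
def MemW012 (Ω : Set (Vec d)) (v : Vec d → Vec d) (G : Vec d → Tensor d) : Prop :=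
  MemLp v 2 (volume.restrict Ω) ∧ MemLp G 2 (volume.restrict Ω) ∧
  ∀ ε : ℝ≥0∞, 0 < ε → ∃ ψ : Vec d → Vec d,
    ContDiff ℝ ∞ ψ ∧ HasCompactSupport ψ ∧ tsupport ψ ⊆ Ω ∧
    eLpNorm (v - ψ) 2 (volume.restrict Ω) < ε ∧
    eLpNorm (G - fderiv ℝ ψ) 2 (volume.restrict Ω) < ε

/-- `f ∈ C¹([0,T] × closure Ω)`: `f` is on that set the restriction of a `C¹` function on `ℝ × ℝ^d`.
On bounded Lipschitz domains this is the same as `f` and its first derivatives in the interior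
being continuous up to the boundary. -/
def IsC1UpToBoundary {F : Type*} [NormedAddCommGroup F] [NormedSpace ℝ F]
    (T : ℝ) (Ω : Set (Vec d)) (f : ℝ → Vec d → F) : Prop :=
  ∃ g : ℝ × Vec d → F, ContDiff ℝ 1 g ∧ ∀ t ∈ Icc 0 T, ∀ x ∈ closure Ω, g (t, x) = f t x

/-- `ν ∈ L^∞_{weak-*}(0,T; 𝓜(K))` for a compact `K`: weak-* measurable with essentially bounded
total variation norm (whose measurability is automatic, `C(K)` being separable). -/
def LInftyMeasure (T : ℝ) (K : Set (Vec d)) (ν : ℝ → SignedMeasure K) : Prop :=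
  (∀ f : C(K, ℝ), AEStronglyMeasurable (fun t => ∫ᵛ x, f x ∂•(ν t)) (volume.restrict (Ioo 0 T))) ∧
  ∃ C : ℝ≥0, ∀ᵐ t ∂(volume.restrict (Ioo 0 T)), (ν t).totalVariation univ ≤ C

/-- The integral `∫_K A : dM` of a tensor field against a tensor valued measure. -/
def tensorPairing {K : Set (Vec d)} (A : Vec d → Tensor d)
    (M : Fin d → Fin d → SignedMeasure K) : ℝ :=
  ∑ i, ∑ j, ∫ᵛ x, entry (A x) i j ∂•(M i j)

end FunctionSpaces

/-- The open cone `𝓞 = {(R, Z) | b₁ R < Z < b₂ R}`. -/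
def stateCone (b₁ b₂ : ℝ) : Set (ℝ × ℝ) := {q | b₁ * q.1 < q.2 ∧ q.2 < b₂ * q.1}

/-- The Helmholtz function `H(R,Z) = R ∫_1^R P(s, s Z/R) / s² ds` for `R > 0`, `H(0,Z) = 0`. -/
def helmholtz (P : ℝ × ℝ → ℝ) (R Z : ℝ) : ℝ :=
  if 0 < R then R * ∫ s in (1 : ℝ)..R, P (s, s * (Z / R)) / s ^ 2 else 0

/-- The data of the initial-boundary value problem. -/
structure ProblemData (d : ℕ) where
  /-- final time -/
  T : ℝ
  /-- space domain -/
  Ω : Set (Vec d)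
  /-- shear viscosity -/
  mu : ℝ
  /-- second viscosity -/
  lam : ℝ
  /-- lower slope of the cone of states -/
  b₁ : ℝ
  /-- upper slope of the cone of states -/
  b₂ : ℝ
  /-- pressure -/
  P : ℝ × ℝ → ℝ
  /-- boundary velocity -/
  uB : Vec d → Vec d
  /-- boundary value of `R` -/
  RB : Vec d → ℝ
  /-- boundary value of `Z` -/
  ZB : Vec d → ℝ
  /-- initial value of `R` -/
  R₀ : Vec d → ℝ
  /-- initial value of `Z` -/
  Z₀ : Vec d → ℝ
  /-- initial velocity -/
  u₀ : Vec d → Vec d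

namespace ProblemData

variable {d : ℕ} (D : ProblemData d)

/-- The cone of admissible states. -/
def O : Set (ℝ × ℝ) := stateCone D.b₁ D.b₂

/-- The Helmholtz function of the pressure. -/
def H (R Z : ℝ) : ℝ := helmholtz D.P R Z

/-- The viscous stress. -/
def S (A : Tensor d) : Tensor d := stress D.mu D.lam A

/-- `u_B · n` on the boundary. -/
def normalFlux (x : Vec d) : ℝ := inner ℝ (D.uB x) (outerNormal D.Ω x)

/-- The inflow boundary. -/
def inflow : Set (Vec d) := {x ∈ frontier D.Ω | D.normalFlux x < 0}

/-- The outflow boundary. -/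
def outflow : Set (Vec d) := frontier D.Ω \ D.inflow

/-- The surface measure on `∂Ω`. -/
def dS : Measure (Vec d) := surfaceMeasure D.Ω

/-- The measure `dt ⊗ |u_B · n| dS` on `(0,T) × ∂Ω`. -/
def fluxMeasure : Measure (ℝ × Vec d) :=
  (volume.restrict (Ioo 0 D.T)).prod
    (D.dS.withDensity fun x => ENNReal.ofReal |D.normalFlux x|)

/-- Lebesgue measure on `(0,T)`. -/
def timeMeasure : Measure ℝ := volume.restrict (Ioo 0 D.T)

/-- Lebesgue measure on `Ω`. -/
def dx : Measure (Vec d) := volume.restrict D.Ω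

/-- Lebesgue measure on `(0,T) × Ω`. -/
def cylinderMeasure : Measure (ℝ × Vec d) := volume.restrict (Ioo 0 D.T ×ˢ D.Ω)

/-- The assumptions on the data: space dimension two or three, a bounded Lipschitz domain, viscosities
with `μ > 0` and `λ + (2/d) μ > 0`, a pressure in `C¹(closure 𝓞) ∩ C²(𝓞)` with `P(0,0) = 0`, a
continuously differentiable boundary velocity and continuous boundary densities. -/
structure Admissible : Prop where
  dim : d = 2 ∨ d = 3
  T_pos : 0 < D.T
  domain : IsBoundedLipschitzDomain D.Ω
  mu_pos : 0 < D.mu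
  lam_cond : 0 < D.lam + 2 / (d : ℝ) * D.mu
  b₁_pos : 0 < D.b₁
  b₁_lt_b₂ : D.b₁ < D.b₂
  P_C1 : ContDiffOn ℝ 1 D.P (closure D.O)
  P_C2 : ContDiffOn ℝ 2 D.P D.O
  P_zero : D.P (0, 0) = 0
  uB_C1 : ContDiff ℝ 1 D.uB
  RB_cont : Continuous D.RB
  ZB_cont : Continuous D.ZB

/-- The weak formulation of the continuity equation for a density `r` with boundary value `rB`. -/
def WeakContinuity (r : ℝ → Vec d → ℝ) (rB : Vec d → ℝ) (u : ℝ → Vec d → Vec d) : Prop :=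
  ∀ φ : ℝ × Vec d → ℝ, ContDiff ℝ 1 φ → ∀ τ ∈ Icc 0 D.T,
    ((∫ x, r τ x * φ (τ, x) ∂D.dx) - ∫ x, r 0 x * φ (0, x) ∂D.dx)
      + (∫ t in (0 : ℝ)..τ, ∫ x in D.outflow, φ (t, x) * r t x * D.normalFlux x ∂D.dS)
      + (∫ t in (0 : ℝ)..τ, ∫ x in D.inflow, φ (t, x) * rB x * D.normalFlux x ∂D.dS)
    = ∫ t in (0 : ℝ)..τ, ∫ x,
        (r t x * timeDeriv φ (t, x) + r t x * spaceDeriv φ (t, x) (u t x)) ∂D.dx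

/-- The weak formulation of the momentum equation with Reynolds defect `M`. Here `m` is the weakly
continuous representative of `(R + Z) u` and `Du` is the weak gradient of `u`. -/
def WeakMomentum (R Z : ℝ → Vec d → ℝ) (u : ℝ → Vec d → Vec d) (Du : ℝ → Vec d → Tensor d)
    (m : ℝ → Vec d → Vec d) (M : ℝ → Fin d → Fin d → SignedMeasure (closure D.Ω)) : Prop :=
  ∀ φ : ℝ × Vec d → Vec d, ContDiff ℝ 1 φ →
    (∀ t ∈ Icc 0 D.T, ∀ x ∈ frontier D.Ω, φ (t, x) = 0) → ∀ τ ∈ Icc 0 D.T,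
    (∫ x, inner ℝ (m τ x) (φ (τ, x)) ∂D.dx) - (∫ x, inner ℝ (m 0 x) (φ (0, x)) ∂D.dx)
    = (∫ t in (0 : ℝ)..τ, ∫ x,
        ((R t x + Z t x) * inner ℝ (u t x) (timeDeriv φ (t, x))
          + contract ((R t x + Z t x) • tensorSq (u t x)) (spaceDeriv φ (t, x))
          + D.P (R t x, Z t x) * tensorTrace (spaceDeriv φ (t, x))
          - contract (D.S (Du t x)) (spaceDeriv φ (t, x))) ∂D.dx)
      + ∫ t in (0 : ℝ)..τ, tensorPairing (fun x => spaceDeriv φ (t, x)) (M t)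

/-- The energy density `½ (R + Z) |u - u_B|² + H(R, Z)` at the point `x`. -/
def relEnergy (R Z : ℝ) (u : Vec d) (x : Vec d) : ℝ :=
  1 / 2 * (R + Z) * ‖u - D.uB x‖ ^ 2 + D.H R Z

/-- The energy inequality with energy defect `E` and Reynolds defect `M`. -/
def EnergyInequality (R Z : ℝ → Vec d → ℝ) (u : ℝ → Vec d → Vec d) (Du : ℝ → Vec d → Tensor d)
    (M : ℝ → Fin d → Fin d → SignedMeasure (closure D.Ω))
    (E : ℝ → SignedMeasure (closure D.Ω)) : Prop :=
  ∀ᵐ τ ∂D.timeMeasure,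
    ((∫ x, D.relEnergy (R τ x) (Z τ x) (u τ x) x ∂D.dx)
        - ∫ x, D.relEnergy (D.R₀ x) (D.Z₀ x) (D.u₀ x) x ∂D.dx)
      + (∫ t in (0 : ℝ)..τ, ∫ x, contract (D.S (Du t x)) (Du t x) ∂D.dx)
      + (∫ t in (0 : ℝ)..τ, ∫ x in D.outflow, D.H (R t x) (Z t x) * D.normalFlux x ∂D.dS)
      + (∫ _t in (0 : ℝ)..τ, ∫ x in D.inflow, D.H (D.RB x) (D.ZB x) * D.normalFlux x ∂D.dS)
      + E τ univ
    ≤ - (∫ t in (0 : ℝ)..τ, ∫ x,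
          contract ((R t x + Z t x) • tensorSq (u t x)
            + D.P (R t x, Z t x) • ContinuousLinearMap.id ℝ (Vec d)) (fderiv ℝ D.uB x) ∂D.dx)
      + (∫ t in (0 : ℝ)..τ, ∫ x,
          (R t x + Z t x) * inner ℝ (fderiv ℝ D.uB x (u t x)) (D.uB x) ∂D.dx)
      + (∫ t in (0 : ℝ)..τ, ∫ x, contract (D.S (Du t x)) (fderiv ℝ D.uB x) ∂D.dx)
      - ∫ t in (0 : ℝ)..τ, tensorPairing (fun x => fderiv ℝ D.uB x) (M t)

/-- `(R, Z, u)` is a dissipative turbulent solution, with integrability exponent `γ`, weak velocity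
gradient `Du`, weakly continuous momentum `m`, Reynolds defect `M` and energy defect `E`.
The values of `R`, `Z` on `∂Ω` are their boundary traces. -/
structure IsDissipativeTurbulentSolution (γ : ℝ) (R Z : ℝ → Vec d → ℝ) (u : ℝ → Vec d → Vec d)
    (Du : ℝ → Vec d → Tensor d) (m : ℝ → Vec d → Vec d)
    (M : ℝ → Fin d → Fin d → SignedMeasure (closure D.Ω))
    (E : ℝ → SignedMeasure (closure D.Ω)) : Prop where
  one_lt_γ : 1 < γ
  -- the regularity class of the densities and their traces; the pair takes values in the
  -- closed cone, where the pressure is defined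
  R_weak : CWeak D.T D.Ω γ R
  Z_weak : CWeak D.T D.Ω γ Z
  nonneg : ∀ t ∈ Icc 0 D.T, ∀ᵐ x ∂D.dx, 0 ≤ R t x ∧ 0 ≤ Z t x
  state : ∀ t ∈ Icc 0 D.T, ∀ᵐ x ∂D.dx, (R t x, Z t x) ∈ closure D.O
  R_trace : MemLp (fun z : ℝ × Vec d => R z.1 z.2) (ENNReal.ofReal γ) D.fluxMeasure
  Z_trace : MemLp (fun z : ℝ × Vec d => Z z.1 z.2) (ENNReal.ofReal γ) D.fluxMeasure
  state_trace : ∀ᵐ z ∂D.fluxMeasure, (R z.1 z.2, Z z.1 z.2) ∈ closure D.O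
  state_inflow : ∀ᵐ x ∂(D.dS.restrict D.inflow), (D.RB x, D.ZB x) ∈ closure D.O
  -- `u - u_B` is in `L²(0,T; W^{1,2}_0)`
  vel_L2 : MemLp (fun z : ℝ × Vec d => u z.1 z.2 - D.uB z.2) 2 D.cylinderMeasure
  grad_L2 : MemLp (fun z : ℝ × Vec d => Du z.1 z.2 - fderiv ℝ D.uB z.2) 2 D.cylinderMeasure
  vel_W012 : ∀ᵐ t ∂D.timeMeasure,
    MemW012 D.Ω (fun x => u t x - D.uB x) (fun x => Du t x - fderiv ℝ D.uB x)
  -- the momentum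
  m_weak : CWeak D.T D.Ω (2 * γ / (γ + 1)) m
  m_eq : ∀ᵐ z ∂D.cylinderMeasure, m z.1 z.2 = (R z.1 z.2 + Z z.1 z.2) • u z.1 z.2
  -- integrability of the convective term, of the pressure and of the Helmholtz function
  conv_int : Integrable (fun z : ℝ × Vec d => (R z.1 z.2 + Z z.1 z.2) * ‖u z.1 z.2‖ ^ 2)
    D.cylinderMeasure
  P_int : Integrable (fun z : ℝ × Vec d => D.P (R z.1 z.2, Z z.1 z.2)) D.cylinderMeasure
  H_int : Integrable (fun z : ℝ × Vec d => D.H (R z.1 z.2) (Z z.1 z.2)) D.cylinderMeasure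
  H_trace_int : Integrable (fun z : ℝ × Vec d => D.H (R z.1 z.2) (Z z.1 z.2)) D.fluxMeasure
  energy₀_int : Integrable (fun x => D.relEnergy (D.R₀ x) (D.Z₀ x) (D.u₀ x) x) D.dx
  -- the continuity equations and their initial conditions
  continuity_R : D.WeakContinuity R D.RB u
  continuity_Z : D.WeakContinuity Z D.ZB u
  init_R : R 0 =ᵐ[D.dx] D.R₀
  init_Z : Z 0 =ᵐ[D.dx] D.Z₀
  -- the Reynolds defect: a bounded family of positive semidefinite symmetric tensor measures
  M_LInfty : ∀ i j, LInftyMeasure D.T (closure D.Ω) fun t => M t i j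
  M_symm : ∀ᵐ t ∂D.timeMeasure, ∀ i j, M t i j = M t j i
  M_psd : ∀ᵐ t ∂D.timeMeasure, ∀ ξ : Fin d → ℝ, 0 ≤ ∑ i, ∑ j, (ξ i * ξ j) • M t i j
  -- the momentum equation and its initial condition
  momentum : D.WeakMomentum R Z u Du m M
  init_m : m 0 =ᵐ[D.dx] fun x => (D.R₀ x + D.Z₀ x) • D.u₀ x
  -- the energy defect, the energy inequality and the compatibility of the defects
  E_LInfty : LInftyMeasure D.T (closure D.Ω) E
  E_nonneg : ∀ᵐ t ∂D.timeMeasure, 0 ≤ E t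
  energy : D.EnergyInequality R Z u Du M E
  compatibility : ∃ c₁ c₂ : ℝ, 0 < c₁ ∧ c₁ ≤ c₂ ∧
    ∀ᵐ t ∂D.timeMeasure, c₁ • E t ≤ ∑ i, M t i i ∧ ∑ i, M t i i ≤ c₂ • E t

/-- `∂_t ((R+Z) u) + div ((R+Z) u ⊗ u) + ∇ P(R,Z)` -/
def momentumLHS (R Z : ℝ → Vec d → ℝ) (u : ℝ → Vec d → Vec d) (t : ℝ) (x : Vec d) : Vec d :=
  deriv (fun s => (R s x + Z s x) • u s x) t
    + tensorDiv (fun y => (R t y + Z t y) • tensorSq (u t y)) x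
    + gradient (fun y => D.P (R t y, Z t y)) x

/-- The total energy density `½ (R+Z) |u|² + H(R,Z)`. -/
def totalEnergy (R Z : ℝ) (u : Vec d) : ℝ := 1 / 2 * (R + Z) * ‖u‖ ^ 2 + D.H R Z

/-- `∂_t (½ (R+Z) |u|² + H(R,Z)) + div ((½ (R+Z) |u|² + H(R,Z) + P(R,Z)) u)` -/
def energyLHS (R Z : ℝ → Vec d → ℝ) (u : ℝ → Vec d → Vec d) (t : ℝ) (x : Vec d) : ℝ :=
  deriv (fun s => D.totalEnergy (R s x) (Z s x) (u s x)) t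
    + divergence (fun y =>
        (D.totalEnergy (R t y) (Z t y) (u t y) + D.P (R t y, Z t y)) • u t y) x

/-- The viscous stress of a differentiable velocity field. -/
def viscousStress (u : ℝ → Vec d → Vec d) (t : ℝ) (x : Vec d) : Tensor d :=
  D.S (fderiv ℝ (u t) x)

/-- `(R, Z, u)`, of class `C¹` up to the boundary, satisfies the system in the classical sense.
As the stress is merely continuous for such `u`, its divergence is the distributional one (which is
then a continuous function, equal to the left-hand side of the momentum equation, at all times);
it is moreover the pointwise one at each point where the stress is differentiable in space,
so at each point where `u` is twice differentiable in space. -/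
structure IsClassicalSolution (R Z : ℝ → Vec d → ℝ) (u : ℝ → Vec d → Vec d) : Prop where
  mass_R : ∀ t ∈ Ioo 0 D.T, ∀ x ∈ D.Ω,
    deriv (fun s => R s x) t + divergence (fun y => R t y • u t y) x = 0
  mass_Z : ∀ t ∈ Ioo 0 D.T, ∀ x ∈ D.Ω,
    deriv (fun s => Z s x) t + divergence (fun y => Z t y • u t y) x = 0
  momentum : ∀ t ∈ Ioo 0 D.T, ∀ ψ : Vec d → Vec d,
    ContDiff ℝ ∞ ψ → HasCompactSupport ψ → tsupport ψ ⊆ D.Ω →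
      ∫ x, inner ℝ (D.momentumLHS R Z u t x) (ψ x) ∂D.dx
        = - ∫ x, contract (D.viscousStress u t x) (fderiv ℝ ψ x) ∂D.dx
  momentum_pointwise : ∀ t ∈ Ioo 0 D.T, ∀ x ∈ D.Ω, DifferentiableAt ℝ (D.viscousStress u t) x →
    D.momentumLHS R Z u t x = tensorDiv (D.viscousStress u t) x
  energy : ∀ t ∈ Ioo 0 D.T, ∀ ψ : Vec d → ℝ,
    ContDiff ℝ ∞ ψ → HasCompactSupport ψ → tsupport ψ ⊆ D.Ω →
      ∫ x, (D.energyLHS R Z u t x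
          + contract (D.viscousStress u t x) (fderiv ℝ (u t) x)) * ψ x ∂D.dx
        = - ∫ x, fderiv ℝ ψ x (D.viscousStress u t x (u t x)) ∂D.dx
  energy_pointwise : ∀ t ∈ Ioo 0 D.T, ∀ x ∈ D.Ω, DifferentiableAt ℝ (D.viscousStress u t) x →
    D.energyLHS R Z u t x
      = divergence (fun y => D.viscousStress u t y (u t y)) x
        - contract (D.viscousStress u t x) (fderiv ℝ (u t) x)
  boundary_u : ∀ t ∈ Icc 0 D.T, ∀ x ∈ frontier D.Ω, u t x = D.uB x
  boundary_RZ : ∀ᵐ x ∂(D.dS.restrict D.inflow), ∀ t ∈ Icc 0 D.T, R t x = D.RB x ∧ Z t x = D.ZB x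
  initial : ∀ᵐ x ∂D.dx, R 0 x = D.R₀ x ∧ Z 0 x = D.Z₀ x ∧
    (R 0 x + Z 0 x) • u 0 x = (D.R₀ x + D.Z₀ x) • D.u₀ x

end ProblemData

end

end Bifluid

/-! The proof is a weak-strong argument in which the solution is its own strong competitor. A
turbulent solution that is `C¹` up to the boundary satisfies an exact energy identity, except for
the work of the Reynolds defect. Comparing this identity with the postulated energy inequality
leaves only defects.

The velocity differs from `u_B` by a `W^{1,2}_0` function, so it equals `u_B` on the whole boundary
(`MemW012.of_contDiff`), and `u - u_B` is an admissible test field for the momentum equation. The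
continuity equations hold pointwise up to the boundary, and on the inflow part the densities attain
`R_B`, `Z_B` (`WeakContinuity.ae_eq_inflow`). For the internal energy, write `H = R q`. Since `Z/R`
is transported by the flow and `q` has `R`-derivative `P/R²` at fixed `Z/R`, one gets `R (∂ₜq +
u·∇q) = -P div u` (`transport_q`). This avoids differentiating `H` in both variables. Because the
pressure is only `C¹` up to the faces of the cone, it is first extended by reflection
(`exists_contDiff_pressure_helmholtz`).

Testing the continuity equations with `½|u_B|² - ½|u|²`, which vanishes on the boundary, and the one
for `R` also with `q`, turns the momentum balance into the energy balance
(`energy_balance_pointwise`, `energy_balance`). Hence the mass of `𝔈(τ)` is at most `-∫₀^τ ∫ ∇u : dℜ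
dt` (`energy_defect_le`, with `∇u` split into `∇(u - u_B)` and `∇u_B`). Positivity of `ℜ` and the
bound on its trace control this by a constant times the time integral of the mass of `𝔈`
(`abs_tensorPairing_le`). Grönwall's inequality then gives `𝔈 = 0`, and so `ℜ = 0`.

Without defects, every term of the momentum equation other than `div 𝕊` is a continuous function,
and the equation holds in the sense of distributions at each time (`integral_force`). A blow-up
shows that a continuous distributional divergence is the pointwise one wherever the field is
differentiable (`eq_divergence_of_distributional`). The energy equation is the momentum equation
tested with `ψ u`.

The boundary statements rest on a divergence theorem for Lipschitz domains with Hausdorff surface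
measure and normals defined by cones. It comes from the area formula for Lipschitz graphs
(`euclideanHausdorffMeasure_comap_graphMap`) and integration below a graph
(`IsGraphChart.integral_fderiv`). -/

namespace Bifluid

open Module

/-! ### Hausdorff measure of nearly linear images -/

section AreaFormula

/-- Comparing distances compares Hausdorff measures of images. -/
theorem euclideanHausdorffMeasure_image_le_of_dist_le {X Y Y' : Type*} [Nonempty X] [MetricSpace Y]
    [MeasurableSpace Y] [BorelSpace Y] [MetricSpace Y'] [MeasurableSpace Y'] [BorelSpace Y']
    {F : X → Y} {G : X → Y'} {B : Set X} {K : ℝ≥0} (n : ℕ)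
    (h : ∀ x ∈ B, ∀ y ∈ B, dist (F x) (F y) ≤ K * dist (G x) (G y)) :
    μHE[n] (F '' B) ≤ (K : ℝ≥0∞) ^ n * μHE[n] (G '' B) := by
  -- The distance hypothesis makes `F` constant on the fibres of `G`, so `F` factors through `G` on
  -- `B`. The factor is `K`-Lipschitz on `G '' B`.
  have hinv : ∀ x ∈ B, F (Function.invFunOn G B (G x)) = F x := fun x hx => by
    have hm := Function.invFunOn_mem (f := G) (s := B) (b := G x) ⟨x, hx, rfl⟩
    have he := Function.invFunOn_eq (f := G) (s := B) (b := G x) ⟨x, hx, rfl⟩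
    have := h _ hm x hx
    rw [he, dist_self, mul_zero] at this
    exact dist_le_zero.1 this
  have hL : LipschitzOnWith K (F ∘ Function.invFunOn G B) (G '' B) := by
    refine LipschitzOnWith.of_dist_le_mul ?_
    rintro _ ⟨x, hx, rfl⟩ _ ⟨y, hy, rfl⟩
    simpa only [Function.comp_apply, hinv x hx, hinv y hy] using h x hx y hy
  have himg : (F ∘ Function.invFunOn G B) '' (G '' B) = F '' B := by
    rw [image_image]
    exact image_congr fun x hx => hinv x hx
  have := hL.hausdorffMeasure_image_le (d := n) (by positivity)
  rw [himg, ENNReal.rpow_natCast] at this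
  simp only [Measure.euclideanHausdorffMeasure_def, Measure.smul_apply, ENNReal.smul_def,
    smul_eq_mul]
  calc _ ≤ _ := mul_le_mul_right this _
    _ = _ := by ring

variable {V W : Type*} [NormedAddCommGroup V] [InnerProductSpace ℝ V] [FiniteDimensional ℝ V]
  [MeasurableSpace V] [BorelSpace V] [NormedAddCommGroup W] [InnerProductSpace ℝ W]
  [FiniteDimensional ℝ W] [MeasurableSpace W] [BorelSpace W]

/-- As `L` does not contract, the error `δ ‖x - y‖` is at most `δ ‖L x - L y‖`. Distances under `F`
and under `L` therefore agree up to factors between `1 - δ` and `1 + δ`, and the measure of the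
linear image is known exactly. -/
theorem euclideanHausdorffMeasure_image_approximatesLinearOn {F : V → W} {L : V →L[ℝ] W}
    {B : Set V} {δ : ℝ≥0} (hδ : δ < 1) (hL : ∀ v, ‖v‖ ≤ ‖L v‖) (hF : ApproximatesLinearOn F L B δ) :
    μHE[finrank ℝ V] (F '' B) ≤ (1 + δ : ℝ≥0∞) ^ finrank ℝ V *
        (ENNReal.ofReal L.toLinearMap.normDet * volume B) ∧
      (1 - δ : ℝ≥0∞) ^ finrank ℝ V * (ENNReal.ofReal L.toLinearMap.normDet * volume B)
        ≤ μHE[finrank ℝ V] (F '' B) := by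
  rw [← LinearMap.euclideanHausdorffMeasure_image_eq_normDet_mul_volume]
  have key : ∀ x ∈ B, ∀ y ∈ B, ‖F x - F y - (L x - L y)‖ ≤ δ * ‖L x - L y‖ := fun x hx y hy => by
    rw [← map_sub]
    exact (hF x hx y hy).trans (mul_le_mul_of_nonneg_left (hL _) δ.2)
  constructor
  · have := euclideanHausdorffMeasure_image_le_of_dist_le (F := F) (G := L) (B := B) (K := 1 + δ)
      (finrank ℝ V) fun x hx y hy => by
        rw [dist_eq_norm, dist_eq_norm]
        have h1 := key x hx y hy
        have h2 := norm_add_le (F x - F y - (L x - L y)) (L x - L y)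
        rw [sub_add_cancel] at h2
        push_cast
        linarith
    simpa using this
  · have hδ' : (δ : ℝ) < 1 := by exact_mod_cast hδ
    have hpos : 0 < 1 - δ := tsub_pos_of_lt hδ
    have := euclideanHausdorffMeasure_image_le_of_dist_le (F := L) (G := F) (B := B)
      (K := (1 - δ)⁻¹) (finrank ℝ V) fun x hx y hy => by
        rw [dist_eq_norm, dist_eq_norm, NNReal.coe_inv, NNReal.coe_sub hδ.le, NNReal.coe_one,
          ← div_eq_inv_mul, le_div_iff₀ (by linarith)]
        have h1 := key x hx y hy
        have h2 := norm_sub_le (F x - F y) (F x - F y - (L x - L y))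
        rw [sub_sub_cancel] at h2
        nlinarith
    have h3 : ((1 - δ : ℝ≥0∞)) ^ finrank ℝ V * ((((1 - δ)⁻¹ : ℝ≥0) : ℝ≥0∞)) ^ finrank ℝ V = 1 := by
      rw [← mul_pow, ← ENNReal.coe_one, ← ENNReal.coe_sub, ← ENNReal.coe_mul,
        mul_inv_cancel₀ hpos.ne', ENNReal.coe_one, one_pow]
    calc _ ≤ _ := mul_le_mul_right this _
      _ = _ := by rw [← mul_assoc, h3, one_mul]; 

/-- The area factor of a graph. -/
noncomputable def graphJacobian (g : V →L[ℝ] ℝ) : ℝ := √(1 + ‖g‖ ^ 2)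

omit [FiniteDimensional ℝ V] [MeasurableSpace V] [BorelSpace V] in
theorem graphJacobian_pos (g : V →L[ℝ] ℝ) : 0 < graphJacobian g :=
  Real.sqrt_pos.2 (by positivity)

theorem continuous_graphJacobian : Continuous (graphJacobian (V := V)) := by
  unfold graphJacobian; fun_prop

theorem one_le_graphJacobian (g : V →L[ℝ] ℝ) : 1 ≤ graphJacobian g :=
  Real.one_le_sqrt.2 (by nlinarith [norm_nonneg g])

/-- The function `t ↦ √(1 + t²)` is 1-Lipschitz. As the area factor is at least 1, an additive error
in the slope becomes a multiplicative error in the area factor. -/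
theorem graphJacobian_le_add (f g : V →L[ℝ] ℝ) :
    graphJacobian f ≤ graphJacobian g + ‖f - g‖ := by
  have h1 : ‖f‖ ≤ ‖g‖ + ‖f - g‖ := by simpa using norm_add_le g (f - g)
  have h2 : ‖g‖ ≤ graphJacobian g := by
    rw [graphJacobian]; exact Real.le_sqrt_of_sq_le (by linarith)
  have h3 : graphJacobian g ^ 2 = 1 + ‖g‖ ^ 2 := Real.sq_sqrt (by positivity)
  refine Real.sqrt_le_iff.2 ⟨by positivity [graphJacobian_pos g], ?_⟩
  nlinarith [norm_nonneg g, norm_nonneg f, norm_nonneg (f - g)]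

end AreaFormula
end Bifluid

namespace Bifluid

open Module

/-! ### Parametrized graphs over a hyperplane -/

section Graph

variable {W : Type*} [NormedAddCommGroup W] [InnerProductSpace ℝ W]

/-- The linear parametrization of the graph of a linear form `g` over the hyperplane `eᗮ`. -/
noncomputable def graphLin (e : W) (g : (ℝ ∙ e)ᗮ →L[ℝ] ℝ) : (ℝ ∙ e)ᗮ →L[ℝ] W :=
  (ℝ ∙ e)ᗮ.subtypeL + g.smulRight e

/-- The parametrization of the graph of `a` over the hyperplane `x + eᗮ`. -/
noncomputable def graphMap (x e : W) (a : (ℝ ∙ e)ᗮ → ℝ) (y : (ℝ ∙ e)ᗮ) : W := x + (y : W) + a y • e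

theorem inner_coe_orthogonal {e : W} (y : (ℝ ∙ e)ᗮ) : inner ℝ (y : W) e = 0 := by
  rw [real_inner_comm]
  exact Submodule.mem_orthogonal_singleton_iff_inner_right.1 y.2

theorem norm_coe_add_smul_sq {e : W} (he : ‖e‖ = 1) (y : (ℝ ∙ e)ᗮ) (s : ℝ) :
    ‖(y : W) + s • e‖ ^ 2 = ‖y‖ ^ 2 + s ^ 2 := by
  rw [norm_add_sq_real, real_inner_smul_right, inner_coe_orthogonal, norm_smul, he]
  simp

theorem norm_le_norm_graphLin {e : W} (he : ‖e‖ = 1) (g : (ℝ ∙ e)ᗮ →L[ℝ] ℝ) (v : (ℝ ∙ e)ᗮ) :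
    ‖v‖ ≤ ‖graphLin e g v‖ := by
  have := norm_coe_add_smul_sq he v (g v)
  refine le_of_sq_le_sq ?_ (norm_nonneg _)
  change _ ≤ ‖(v : W) + g v • e‖ ^ 2
  nlinarith [sq_nonneg (g v)]

theorem graphMap_sub {e : W} (x : W) (a : (ℝ ∙ e)ᗮ → ℝ) (y z : (ℝ ∙ e)ᗮ) :
    graphMap x e a y - graphMap x e a z = ((y - z : (ℝ ∙ e)ᗮ) : W) + (a y - a z) • e := by
  simp only [graphMap, Submodule.coe_sub, sub_smul]; abel

theorem norm_le_norm_graphMap_sub {e : W} (he : ‖e‖ = 1) (x : W) (a : (ℝ ∙ e)ᗮ → ℝ)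
    (y z : (ℝ ∙ e)ᗮ) : ‖y - z‖ ≤ ‖graphMap x e a y - graphMap x e a z‖ := by
  rw [graphMap_sub]
  have := norm_coe_add_smul_sq he (y - z) (a y - a z)
  refine le_of_sq_le_sq ?_ (norm_nonneg _)
  nlinarith [sq_nonneg (a y - a z)]

theorem lipschitzWith_graphMap {e : W} (he : ‖e‖ = 1) (x : W) {a : (ℝ ∙ e)ᗮ → ℝ} {K : ℝ≥0}
    (ha : LipschitzWith K a) : LipschitzWith (1 + K) (graphMap x e a) := by
  refine LipschitzWith.of_dist_le_mul fun y z => ?_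
  rw [dist_eq_norm, graphMap_sub, dist_eq_norm]
  refine (norm_add_le _ _).trans ?_
  rw [norm_smul, he, mul_one]
  have := ha.dist_le_mul y z
  rw [dist_eq_norm, dist_eq_norm] at this
  have h2 : ‖((y - z : (ℝ ∙ e)ᗮ) : W)‖ = ‖y - z‖ := rfl
  push_cast at h2 ⊢
  rw [h2]
  linarith

theorem approximatesLinearOn_graphMap {e : W} (he : ‖e‖ = 1) (x : W) {a : (ℝ ∙ e)ᗮ → ℝ}
    {g : (ℝ ∙ e)ᗮ →L[ℝ] ℝ} {B : Set (ℝ ∙ e)ᗮ} {δ : ℝ≥0} (h : ApproximatesLinearOn a g B δ) :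
    ApproximatesLinearOn (graphMap x e a) (graphLin e g) B δ := by
  intro y hy z hz
  have h1 : graphMap x e a y - graphMap x e a z - graphLin e g (y - z)
      = (a y - a z - g (y - z)) • e := by
    rw [graphMap_sub]
    change _ - (((y - z : (ℝ ∙ e)ᗮ) : W) + g (y - z) • e) = _
    rw [sub_smul (a y - a z)]; abel
  rw [h1, norm_smul, he, mul_one]
  exact h y hy z hz

variable [FiniteDimensional ℝ W]

/-- The Gram operator of the parametrization is the transvection `v ↦ v + g v • G`, where `G` is the
Riesz vector of `g`. Its determinant is `1 + g G = 1 + ‖g‖²`. -/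
theorem normDet_graphLin {e : W} (he : ‖e‖ = 1) (g : (ℝ ∙ e)ᗮ →L[ℝ] ℝ) :
    (graphLin e g).toLinearMap.normDet = graphJacobian g := by
  have h0 : 0 ≤ (graphLin e g).toLinearMap.normDet := LinearMap.normDet_nonneg _
  rw [graphJacobian, ← Real.sqrt_sq h0]
  congr 1
  set G : (ℝ ∙ e)ᗮ := (InnerProductSpace.toDual ℝ _).symm g with hG
  have hGi : ∀ v, inner ℝ G v = g v := fun v => by
    rw [hG, InnerProductSpace.toDual_symm_apply]
  have hn : ‖g‖ = ‖G‖ := by rw [hG, LinearIsometryEquiv.norm_map]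
  have hsq := ContinuousLinearMap.normDet_sq (graphLin e g)
  have hcomp : (ContinuousLinearMap.adjoint (graphLin e g) ∘L graphLin e g).toLinearMap
      = LinearMap.transvection g.toLinearMap G := by
    ext v : 1
    refine ext_inner_right ℝ fun w => ?_
    change inner ℝ (ContinuousLinearMap.adjoint (graphLin e g) (graphLin e g v)) w =
      inner ℝ (v + g v • G) w
    rw [ContinuousLinearMap.adjoint_inner_left, inner_add_left, real_inner_smul_left, hGi]
    change inner ℝ ((v : W) + g v • e) ((w : W) + g w • e) = _
    rw [inner_add_left, inner_add_right, inner_add_right, real_inner_smul_left,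
      real_inner_smul_right, real_inner_smul_left, real_inner_smul_right, inner_coe_orthogonal,
      real_inner_comm (w : W) e, inner_coe_orthogonal, real_inner_self_eq_norm_sq, he]
    simp
  have : (graphLin e g).toLinearMap.normDet ^ 2 = 1 + ‖g‖ ^ 2 := by
    have h3 : LinearMap.det (ContinuousLinearMap.adjoint (graphLin e g) ∘L graphLin e g).toLinearMap
        = 1 + ‖g‖ ^ 2 := by
      rw [hcomp, LinearMap.transvection.det, hn, ← real_inner_self_eq_norm_sq, hGi]; rfl
    rw [← h3]
    exact hsq
  exact this

end Graph

/-- The cover is made disjoint and the inequalities are summed. What the cover misses need only be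
null for the smaller measure. -/
theorem measure_le_of_countable_cover {α : Type*} [MeasurableSpace α] {μ ν : Measure α}
    {P : ℕ → Set α} (hP : ∀ i, MeasurableSet (P i)) (hcov : μ (⋃ i, P i)ᶜ = 0)
    (h : ∀ i, ∀ B ⊆ P i, MeasurableSet B → μ B ≤ ν B) : μ ≤ ν := by
  refine Measure.le_iff.2 fun s hs => ?_
  have hd : ∀ i, MeasurableSet (disjointed P i) := MeasurableSet.disjointed hP
  calc μ s ≤ μ (s ∩ ⋃ i, P i) + μ (⋃ i, P i)ᶜ := by
        refine (measure_mono ?_).trans (measure_union_le _ _)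
        intro x hx
        by_cases h : x ∈ ⋃ i, P i
        exacts [Or.inl ⟨hx, h⟩, Or.inr h]
    _ = μ (⋃ i, s ∩ disjointed P i) := by rw [hcov, add_zero, ← inter_iUnion, iUnion_disjointed]
    _ ≤ ∑' i, μ (s ∩ disjointed P i) := measure_iUnion_le _
    _ ≤ ∑' i, ν (s ∩ disjointed P i) := ENNReal.tsum_le_tsum fun i =>
        h i _ (inter_subset_right.trans (disjointed_subset P i)) (hs.inter (hd i))
    _ = ν (⋃ i, s ∩ disjointed P i) := (measure_iUnion
        ((disjoint_disjointed P).mono fun i j hij => hij.mono inter_subset_right inter_subset_right)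
        fun i => hs.inter (hd i)).symm
    _ ≤ ν s := measure_mono (iUnion_subset fun i => inter_subset_left)

/-- A Lipschitz function can be linearized up to a given error, derivatives included, on each
set of a countable cover of its set of differentiability. -/
theorem exists_cover_approximatesLinearOn {V : Type*} [NormedAddCommGroup V] [NormedSpace ℝ V]
    [FiniteDimensional ℝ V] [MeasurableSpace V] [BorelSpace V] (a : V → ℝ) {δ : ℝ≥0} (hδ : 0 < δ) :
    ∃ P : ℕ → Set V, (∀ i, MeasurableSet (P i)) ∧ {y | DifferentiableAt ℝ a y} ⊆ ⋃ i, P i ∧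
      ∀ i, ∃ A : V →L[ℝ] ℝ, ApproximatesLinearOn a A (P i) δ ∧
        ∀ z ∈ P i, ‖fderiv ℝ a z - A‖ ≤ δ := by
  -- On `S k` the derivative lies within `δ / 2` of a fixed form. The linear maps of the partition
  -- are themselves derivatives at points of `S k`, hence within `δ` of every derivative there.
  let S : ℕ → Set V := fun k => {y | DifferentiableAt ℝ a y} ∩
    fderiv ℝ a ⁻¹' Metric.closedBall (TopologicalSpace.denseSeq (V →L[ℝ] ℝ) k) (δ / 2)
  have hS : ∀ k, MeasurableSet (S k) := fun k =>
    (measurableSet_of_differentiableAt ℝ a).inter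
      ((measurable_fderiv ℝ a) Metric.isClosed_closedBall.measurableSet)
  choose t A _ htm hcov happ hA using fun k =>
    exists_partition_approximatesLinearOn_of_hasFDerivWithinAt a (S k) (fderiv ℝ a)
      (fun y hy => hy.1.hasFDerivAt.hasFDerivWithinAt) (fun _ => δ) (fun _ => hδ.ne')
  refine ⟨fun m => S m.unpair.1 ∩ t m.unpair.1 m.unpair.2, fun i => (hS _).inter (htm _ _),
    fun y hy => ?_, fun i => ⟨A i.unpair.1 i.unpair.2, happ _ _, fun z hz => ?_⟩⟩
  · obtain ⟨k, hk⟩ := (TopologicalSpace.denseRange_denseSeq (V →L[ℝ] ℝ)).exists_dist_lt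
      (fderiv ℝ a y) (half_pos (NNReal.coe_pos.2 hδ))
    have hyS : y ∈ S k := ⟨hy, Metric.mem_closedBall.2 hk.le⟩
    obtain ⟨n, hn⟩ := mem_iUnion.1 (hcov k hyS)
    exact mem_iUnion.2 ⟨Nat.pair k n, by simpa using ⟨hyS, hn⟩⟩
  · obtain ⟨y, hy, hyA⟩ := hA i.unpair.1 ⟨z, hz.1⟩ i.unpair.2
    rw [hyA, ← dist_eq_norm]
    have h1 := Metric.mem_closedBall.1 hy.2
    have h2 := Metric.mem_closedBall.1 hz.1.2
    linarith [dist_triangle_right (fderiv ℝ a z) (fderiv ℝ a y)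
      (TopologicalSpace.denseSeq (V →L[ℝ] ℝ) i.unpair.1)]

/-! ### The area formula for Lipschitz graphs -/

section Area

variable {W : Type*} [NormedAddCommGroup W] [InnerProductSpace ℝ W] [FiniteDimensional ℝ W]
  [MeasurableSpace W] [BorelSpace W]

theorem graphMap_injective {e : W} (he : ‖e‖ = 1) (x : W) (a : (ℝ ∙ e)ᗮ → ℝ) :
    Function.Injective (graphMap x e a) := fun y z h => by
  have := norm_le_norm_graphMap_sub he x a y z
  rw [h, sub_self, norm_zero] at this
  exact sub_eq_zero.1 (norm_le_zero_iff.1 this)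

theorem measurableEmbedding_graphMap {e : W} (he : ‖e‖ = 1) (x : W) {a : (ℝ ∙ e)ᗮ → ℝ}
    (ha : Continuous a) : MeasurableEmbedding (graphMap x e a) :=
  Continuous.measurableEmbedding (by unfold graphMap; fun_prop) (graphMap_injective he x a)

/-- The area formula for Lipschitz graphs. -/
theorem euclideanHausdorffMeasure_comap_graphMap {e : W} (he : ‖e‖ = 1) (x : W)
    {a : (ℝ ∙ e)ᗮ → ℝ} {K : ℝ≥0} (ha : LipschitzWith K a) :
    (μHE[finrank ℝ (ℝ ∙ e)ᗮ] : Measure W).comap (graphMap x e a)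
      = volume.withDensity fun y => ENNReal.ofReal (graphJacobian (fderiv ℝ a y)) := by
  set F := graphMap x e a
  set n := finrank ℝ (ℝ ∙ e)ᗮ
  have hF : MeasurableEmbedding F := measurableEmbedding_graphMap he x ha.continuous
  set ν : Measure (ℝ ∙ e)ᗮ := (μHE[n] : Measure W).comap F
  set J : (ℝ ∙ e)ᗮ → ℝ≥0∞ := fun y => ENNReal.ofReal (graphJacobian (fderiv ℝ a y))
  have hν : ∀ B, ν B = μHE[n] (F '' B) := fun B => hF.comap_apply _ B
  have hnull : volume {y | DifferentiableAt ℝ a y}ᶜ = 0 := ha.ae_differentiableAt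
  -- By Rademacher the exceptional set is Lebesgue null, and a Lipschitz image of a null set is null
  -- for the Hausdorff measure.
  have hνnull : ν {y | DifferentiableAt ℝ a y}ᶜ = 0 := by
    have h1 := euclideanHausdorffMeasure_image_le_of_dist_le (F := F) (G := id)
      (B := {y | DifferentiableAt ℝ a y}ᶜ) (K := 1 + K) n
      fun y _ z _ => (lipschitzWith_graphMap he x ha).dist_le_mul y z
    rw [image_id, InnerProductSpace.euclideanHausdorffMeasure_eq_volume, hnull, mul_zero] at h1
    rw [hν]
    exact le_antisymm h1 bot_le
  -- On each piece the power of `1 ± δ` comes from replacing the graph map by a linear one, and the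
  -- extra factor `1 + δ` from freezing the area factor. All these factors tend to 1 as `δ → 0`.
  have key : ∀ δ : ℝ≥0, 0 < δ → δ < 1 →
      ν ≤ ((1 + δ : ℝ≥0∞) ^ n * (1 + δ)) • volume.withDensity J ∧
      (1 - δ : ℝ≥0∞) ^ n • volume.withDensity J ≤ (1 + δ : ℝ≥0∞) • ν := by
    intro δ hδ0 hδ1
    obtain ⟨P, hPm, hcov, hP⟩ := exists_cover_approximatesLinearOn a hδ0
    have hJA : ∀ (f g : (ℝ ∙ e)ᗮ →L[ℝ] ℝ), ‖f - g‖ ≤ δ →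
        ENNReal.ofReal (graphJacobian f) ≤ (1 + δ) * ENNReal.ofReal (graphJacobian g) := by
      intro f g hfg
      have : (1 + δ : ℝ≥0∞) = ENNReal.ofReal (1 + δ) := by
        rw [ENNReal.ofReal_add zero_le_one δ.coe_nonneg]; simp
      rw [this, ← ENNReal.ofReal_mul (by positivity)]
      refine ENNReal.ofReal_le_ofReal ?_
      nlinarith [graphJacobian_le_add f g, one_le_graphJacobian g, δ.2]
    have hcov' : (⋃ i, P i)ᶜ ⊆ {y | DifferentiableAt ℝ a y}ᶜ := compl_subset_compl.2 hcov
    constructor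
    · refine measure_le_of_countable_cover hPm (measure_mono_null hcov' hνnull) fun i B hB hBm => ?_
      obtain ⟨A, hA, hA'⟩ := hP i
      rw [Measure.smul_apply, withDensity_apply _ hBm, smul_eq_mul, hν]
      refine (euclideanHausdorffMeasure_image_approximatesLinearOn hδ1 (norm_le_norm_graphLin he A)
        (approximatesLinearOn_graphMap he x (hA.mono_set hB))).1.trans ?_
      rw [normDet_graphLin he, mul_assoc]
      refine mul_le_mul_right ?_ _
      rw [← setLIntegral_const, ← lintegral_const_mul' _ _ (by finiteness)]
      refine setLIntegral_mono' hBm fun z hz => hJA _ _ ?_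
      exact (norm_sub_rev _ _).trans_le (hA' z (hB hz))
    · have hac : (volume.withDensity J) {y | DifferentiableAt ℝ a y}ᶜ = 0 :=
        withDensity_absolutelyContinuous _ _ hnull
      refine measure_le_of_countable_cover hPm ?_ fun i B hB hBm => ?_
      · rw [Measure.smul_apply, measure_mono_null hcov' hac, smul_zero]
      obtain ⟨A, hA, hA'⟩ := hP i
      rw [Measure.smul_apply, Measure.smul_apply, withDensity_apply _ hBm, smul_eq_mul,
        smul_eq_mul, hν]
      refine le_trans ?_ (mul_le_mul_right
        (euclideanHausdorffMeasure_image_approximatesLinearOn hδ1 (norm_le_norm_graphLin he A)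
        (approximatesLinearOn_graphMap he x (hA.mono_set hB))).2 _)
      rw [normDet_graphLin he, mul_left_comm (1 + δ : ℝ≥0∞)]
      refine mul_le_mul_right ?_ _
      rw [← setLIntegral_const, ← lintegral_const_mul' _ _ (by finiteness)]
      exact setLIntegral_mono' hBm fun z hz => hJA _ _ (hA' z (hB hz))
  have hev : ∀ᶠ δ : ℝ≥0 in 𝓝[>] 0, 0 < δ ∧ δ < 1 :=
    Ioo_mem_nhdsGT (zero_lt_one' ℝ≥0)
  have hc : Tendsto (fun δ : ℝ≥0 => (δ : ℝ≥0∞)) (𝓝[>] 0) (𝓝 0) :=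
    (ENNReal.continuous_coe.tendsto' 0 0 rfl).mono_left nhdsWithin_le_nhds
  have h1 : Tendsto (fun δ : ℝ≥0 => (1 + δ : ℝ≥0∞)) (𝓝[>] 0) (𝓝 1) := by
    simpa using tendsto_const_nhds.add hc
  have h2 : Tendsto (fun δ : ℝ≥0 => (1 - δ : ℝ≥0∞)) (𝓝[>] 0) (𝓝 1) := by
    simpa using ENNReal.Tendsto.sub tendsto_const_nhds hc (Or.inl ENNReal.one_ne_top)
  refine Measure.ext fun s _ => le_antisymm ?_ ?_
  · have h3 : Tendsto (fun δ : ℝ≥0 => (1 + δ : ℝ≥0∞) ^ n * (1 + δ) * volume.withDensity J s)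
        (𝓝[>] 0) (𝓝 (volume.withDensity J s)) := by
      have := ENNReal.Tendsto.mul_const (b := volume.withDensity J s)
        (ENNReal.Tendsto.mul (ENNReal.Tendsto.pow (n := n) h1) (by simp) h1 (by simp)) (by simp)
      simpa using this
    refine ge_of_tendsto h3 (hev.mono fun δ hδ => ?_)
    exact (key δ hδ.1 hδ.2).1 s
  · have h3 : Tendsto (fun δ : ℝ≥0 => (1 - δ : ℝ≥0∞) ^ n * volume.withDensity J s)
        (𝓝[>] 0) (𝓝 (volume.withDensity J s)) := by
      have := ENNReal.Tendsto.mul_const (b := volume.withDensity J s)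
        (ENNReal.Tendsto.pow (n := n) h2) (by simp)
      simpa using this
    have h4 : Tendsto (fun δ : ℝ≥0 => (1 + δ : ℝ≥0∞) * ν s) (𝓝[>] 0) (𝓝 (ν s)) := by
      have := ENNReal.Tendsto.mul_const (b := ν s) h1 (by simp)
      simpa using this
    exact le_of_tendsto_of_tendsto h3 h4 (hev.mono fun δ hδ => (key δ hδ.1 hδ.2).2 s)

end Area
end Bifluid

namespace Bifluid

open Module

/-! ### Primitives depending on a parameter, and `C¹` cutoffs -/

section ParametricPrimitive

variable {E : Type*} [NormedAddCommGroup E] [NormedSpace ℝ E] [FiniteDimensional ℝ E]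

theorem hasFDerivAt_parametric_intervalIntegral {k : E × ℝ → ℝ} (hk : ContDiff ℝ 1 k) (c b : ℝ)
    (q : E) : HasFDerivAt (fun y => ∫ s in c..b, k (y, s))
      (∫ s in c..b, (fderiv ℝ k (q, s)).comp (ContinuousLinearMap.inl ℝ E ℝ)) q := by
  have hk' : Continuous fun p : E × ℝ =>
      (fderiv ℝ k p).comp (ContinuousLinearMap.inl ℝ E ℝ) :=
    (hk.continuous_fderiv one_ne_zero).clm_comp continuous_const
  obtain ⟨C, hC⟩ := ((isCompact_closedBall q 1).prod (isCompact_uIcc (a := c) (b := b))).exists_bound_of_continuousOn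
    hk'.continuousOn
  refine intervalIntegral.hasFDerivAt_integral_of_dominated_of_fderiv_le (μ := volume)
    (F := fun y s => k (y, s)) (F' := fun y s => (fderiv ℝ k (y, s)).comp (ContinuousLinearMap.inl ℝ E ℝ))
    (s := Metric.closedBall q 1) (bound := fun _ => C)
    (Metric.closedBall_mem_nhds q one_pos) ?_ ?_ ?_ ?_ ?_ ?_
  · exact Eventually.of_forall fun y =>
      (hk.continuous.comp (by fun_prop : Continuous fun s : ℝ => (y, s))).aestronglyMeasurable
  · exact (hk.continuous.comp (by fun_prop : Continuous fun s : ℝ => (q, s))).intervalIntegrable _ _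
  · exact (hk'.comp (by fun_prop : Continuous fun s : ℝ => (q, s))).aestronglyMeasurable
  · exact Eventually.of_forall fun s hs y hy => hC (y, s) ⟨hy, uIoc_subset_uIcc hs⟩
  · exact intervalIntegrable_const
  · refine Eventually.of_forall fun s _ y _ => ?_
    have h2 : HasFDerivAt (fun y : E => (y, s)) (ContinuousLinearMap.inl ℝ E ℝ) y :=
      hasFDerivAt_prodMk_left y s
    exact ((hk.differentiable one_ne_zero (y, s)).hasFDerivAt).comp y h2

/-- The integral is split at the value `p.2` of the upper limit. The part with fixed limits is
differentiated under the integral sign. The rest runs over a short interval and equals its length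
times `k p` up to `o(‖q - p‖)`, by continuity of `k`. -/
theorem hasFDerivAt_parametric_primitive {k : E × ℝ → ℝ} (hk : ContDiff ℝ 1 k) (c : ℝ)
    (p : E × ℝ) : HasFDerivAt (fun p : E × ℝ => ∫ s in c..p.2, k (p.1, s))
      ((∫ s in c..p.2, (fderiv ℝ k (p.1, s)).comp (ContinuousLinearMap.inl ℝ E ℝ)).comp
        (ContinuousLinearMap.fst ℝ E ℝ) + k p • ContinuousLinearMap.snd ℝ E ℝ) p := by
  have hint : ∀ (y : E) (a b : ℝ), IntervalIntegrable (fun s => k (y, s)) volume a b := fun y a b =>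
    (hk.continuous.comp (by fun_prop : Continuous fun s : ℝ => (y, s))).intervalIntegrable _ _
  have h1 : HasFDerivAt (fun q : E × ℝ => ∫ s in c..p.2, k (q.1, s)) _ p :=
    (hasFDerivAt_parametric_intervalIntegral hk c p.2 p.1).comp p hasFDerivAt_fst
  have h2 : HasFDerivAt (fun q : E × ℝ => ∫ s in p.2..q.2, k (q.1, s))
      (k p • ContinuousLinearMap.snd ℝ E ℝ) p := by
    rw [hasFDerivAt_iff_isLittleO, Asymptotics.isLittleO_iff]
    intro ε hε
    obtain ⟨δ, hδ, hball⟩ := Metric.continuousAt_iff.1 (hk.continuous.continuousAt (x := p)) ε hε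
    filter_upwards [Metric.ball_mem_nhds p hδ] with q hq
    have h3 : ∀ s ∈ uIoc p.2 q.2, ‖k (q.1, s) - k p‖ ≤ ε := fun s hs => by
      rw [← dist_eq_norm]
      refine (hball ?_).le
      have hq' := Metric.mem_ball.1 hq
      rw [Prod.dist_eq, max_lt_iff] at hq' ⊢
      refine ⟨hq'.1, lt_of_le_of_lt ?_ hq'.2⟩
      simpa [Real.dist_eq] using abs_sub_left_of_mem_uIcc (uIoc_subset_uIcc hs)
    have h4 := intervalIntegral.norm_integral_le_of_norm_le_const h3
    rw [intervalIntegral.integral_sub (hint _ _ _) (by simp), intervalIntegral.integral_const] at h4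
    have h5 : |q.2 - p.2| ≤ ‖q - p‖ := norm_snd_le (q - p)
    calc _ = ‖(∫ s in p.2..q.2, k (q.1, s)) - (q.2 - p.2) • k p‖ := by
          simp [mul_comm]
      _ ≤ ε * |q.2 - p.2| := h4
      _ ≤ _ := by gcongr
  refine (h1.add h2).congr_of_eventuallyEq (Eventually.of_forall fun q => ?_)
  exact (intervalIntegral.integral_add_adjacent_intervals (hint _ _ _) (hint _ _ _)).symm

theorem contDiff_parametric_primitive {k : E × ℝ → ℝ} (hk : ContDiff ℝ 1 k) (c : ℝ) :
    ContDiff ℝ 1 fun p : E × ℝ => ∫ s in c..p.2, k (p.1, s) := by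
  rw [contDiff_one_iff_fderiv]
  refine ⟨fun p => (hasFDerivAt_parametric_primitive hk c p).differentiableAt, ?_⟩
  have hk' : Continuous fun p : E × ℝ =>
      (fderiv ℝ k p).comp (ContinuousLinearMap.inl ℝ E ℝ) :=
    (hk.continuous_fderiv one_ne_zero).clm_comp continuous_const
  have : (fderiv ℝ fun p : E × ℝ => ∫ s in c..p.2, k (p.1, s)) = _ :=
    funext fun p => (hasFDerivAt_parametric_primitive hk c p).fderiv
  rw [this]
  refine Continuous.add (Continuous.clm_comp ?_ continuous_const)
    (hk.continuous.smul continuous_const)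
  exact intervalIntegral.continuous_parametric_primitive_of_continuous
    (f := fun y s => (fderiv ℝ k (y, s)).comp (ContinuousLinearMap.inl ℝ E ℝ)) hk'

/-- A `C¹` function on a neighbourhood of a compact set coincides near that set with a function which is
`C¹` everywhere. -/
theorem exists_contDiff_eqOn_of_isCompact {U K : Set E} (hU : IsOpen U) (hK : IsCompact K)
    (hKU : K ⊆ U) {f : E → ℝ} (hf : ContDiffOn ℝ 1 f U) :
    ∃ g : E → ℝ, ContDiff ℝ 1 g ∧ ∀ x ∈ K, g =ᶠ[𝓝 x] f := by
  obtain ⟨K', hK', hKK', hK'U⟩ := exists_compact_between hK hU hKU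
  obtain ⟨χ, h0, h1, -⟩ := exists_contMDiffMap_zero_one_nhds_of_isClosed (modelWithCornersSelf ℝ E)
    (n := 1) (s := (interior K')ᶜ) (t := K) isOpen_interior.isClosed_compl hK.isClosed
    (disjoint_compl_left_iff_subset.2 hKK')
  have hχ : ContDiff ℝ 1 χ := χ.contMDiff.contDiff
  refine ⟨fun x => χ x * f x, contDiff_iff_contDiffAt.2 fun x => ?_, fun x hx => ?_⟩
  · by_cases hx : x ∈ U
    · exact hχ.contDiffAt.mul (hf.contDiffAt (hU.mem_nhds hx))
    · have hx' : x ∈ (interior K')ᶜ := fun h => hx (hK'U (interior_subset h))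
      have : (fun x => χ x * f x) =ᶠ[𝓝 x] fun _ => 0 := by
        filter_upwards [h0.filter_mono (nhds_le_nhdsSet hx')] with y hy
        rw [hy, zero_mul]
      exact contDiffAt_const.congr_of_eventuallyEq this
  · filter_upwards [h1.filter_mono (nhds_le_nhdsSet hx)] with y hy
    rw [hy, one_mul]

end ParametricPrimitive

end Bifluid

namespace Bifluid

open Module

/-! ### Coordinates along a hyperplane and its normal -/

section GraphCoordinates

variable {W : Type*} [NormedAddCommGroup W] [InnerProductSpace ℝ W] [FiniteDimensional ℝ W]
  [MeasurableSpace W] [BorelSpace W]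

/-- Coordinates `(y, s) ↦ x + y + s e` along a hyperplane and its normal. -/
def normalCoords (x e : W) (p : (ℝ ∙ e)ᗮ × ℝ) : W := x + (p.1 : W) + p.2 • e

theorem normalCoords_injective {e : W} (he : ‖e‖ = 1) (x : W) :
    Function.Injective (normalCoords x e) := fun p q h => by
  have h1 : ((p.1 - q.1 : (ℝ ∙ e)ᗮ) : W) + (p.2 - q.2) • e = 0 := by
    have : (x + (p.1 : W) + p.2 • e) - (x + (q.1 : W) + q.2 • e) = 0 := sub_eq_zero.2 h
    rw [← this, Submodule.coe_sub, sub_smul]; abel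
  have h2 := norm_coe_add_smul_sq he (p.1 - q.1) (p.2 - q.2)
  rw [h1, norm_zero] at h2
  have h3 : ‖p.1 - q.1‖ = 0 := by nlinarith [norm_nonneg (p.1 - q.1), sq_nonneg (p.2 - q.2)]
  have h4 : p.2 - q.2 = 0 := by nlinarith [norm_nonneg (p.1 - q.1), sq_nonneg (p.2 - q.2)]
  exact Prod.ext (sub_eq_zero.1 (norm_eq_zero.1 h3)) (sub_eq_zero.1 h4)

theorem contDiff_normalCoords (x e : W) : ContDiff ℝ ∞ (normalCoords x e) := by
  have h : normalCoords x e = fun p : (ℝ ∙ e)ᗮ × ℝ =>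
    x + (ℝ ∙ e)ᗮ.subtypeL p.1 + p.2 • e := rfl
  rw [h]; fun_prop

theorem hasFDerivAt_normalCoords (x e : W) (p : (ℝ ∙ e)ᗮ × ℝ) :
    HasFDerivAt (normalCoords x e) ((ℝ ∙ e)ᗮ.subtypeL.comp (ContinuousLinearMap.fst ℝ _ ℝ) +
      (ContinuousLinearMap.snd ℝ (ℝ ∙ e)ᗮ ℝ).smulRight e) p := by
  have h1 : HasFDerivAt (fun p : (ℝ ∙ e)ᗮ × ℝ => x + (ℝ ∙ e)ᗮ.subtypeL p.1)
    ((ℝ ∙ e)ᗮ.subtypeL.comp (ContinuousLinearMap.fst ℝ _ ℝ)) p :=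
    (((ℝ ∙ e)ᗮ.subtypeL.hasFDerivAt).comp p hasFDerivAt_fst).const_add x
  exact h1.add (hasFDerivAt_snd.smul_const e)

theorem measurePreserving_normalCoords {e : W} (he : ‖e‖ = 1) (x : W) :
    MeasurePreserving (normalCoords x e) volume volume := by
  have h1 := ((ℝ ∙ e).measurePreserving_measurableEquivProd x).symm
  rw [InnerProductSpace.euclideanHausdorffMeasure_eq_volume] at h1
  have h2 : MeasurePreserving (Prod.map (LinearIsometryEquiv.toSpanUnitSingleton e he) id :
      ℝ × (ℝ ∙ e)ᗮ → (ℝ ∙ e) × (ℝ ∙ e)ᗮ) volume volume :=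
    (LinearIsometryEquiv.measurePreserving _).prod (MeasurePreserving.id volume)
  have h3 : MeasurePreserving (Prod.swap : (ℝ ∙ e)ᗮ × ℝ → ℝ × (ℝ ∙ e)ᗮ) volume volume :=
    Measure.measurePreserving_swap
  have h4 : normalCoords x e = ((ℝ ∙ e).measurableEquivProd x).symm ∘
      (Prod.map (LinearIsometryEquiv.toSpanUnitSingleton e he) id ∘ Prod.swap) := by
    funext p
    simp only [Function.comp_apply, Submodule.measurableEquivProd_symm_apply]
    change _ = p.2 • e + (p.1 : W) + x
    simp only [normalCoords]
    abel
  rw [h4]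
  exact h1.comp (h2.comp h3)

theorem measurableEmbedding_normalCoords {e : W} (he : ‖e‖ = 1) (x : W) :
    MeasurableEmbedding (normalCoords x e) :=
  (contDiff_normalCoords x e).continuous.measurableEmbedding (normalCoords_injective he x)

theorem integral_normalCoords {e : W} (he : ‖e‖ = 1) (x : W) {f : W → ℝ} (hf : Integrable f) :
    ∫ z, f z = ∫ y : (ℝ ∙ e)ᗮ, ∫ s : ℝ, f (normalCoords x e (y, s)) := by
  rw [← (measurePreserving_normalCoords he x).integral_comp
    (measurableEmbedding_normalCoords he x), Measure.volume_eq_prod, integral_prod]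
  exact ((measurePreserving_normalCoords he x).integrable_comp_emb
    (measurableEmbedding_normalCoords he x)).2 hf

/-- The part of space described by normal coordinates of size less than `r` and `h`. -/
def coordCylinder (x e : W) (r h : ℝ) : Set W :=
  normalCoords x e '' (Metric.ball 0 r ×ˢ Ioo (-h) h)

theorem normalCoords_mem_coordCylinder {e : W} (he : ‖e‖ = 1) (x : W) (r h : ℝ)
    (y : (ℝ ∙ e)ᗮ) (s : ℝ) :
    normalCoords x e (y, s) ∈ coordCylinder x e r h ↔ ‖y‖ < r ∧ |s| < h := by
  rw [coordCylinder, (normalCoords_injective he x).mem_set_image, mem_prod, mem_ball_zero_iff,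
    mem_Ioo, abs_lt]

/-- The normal coordinates of a point. -/
theorem exists_normalCoords_eq (x : W) {e : W} (he : ‖e‖ = 1) (z : W) :
    ∃ p, normalCoords x e p = z ∧ ‖p.1‖ ≤ ‖z - x‖ ∧ |p.2| ≤ ‖z - x‖ := by
  have hz : (inner ℝ e (z - x)) • e + ((ℝ ∙ e)ᗮ.orthogonalProjectionOnto (z - x) : W) = z - x := by
    have h1 := (ℝ ∙ e).starProjection_add_starProjection_orthogonal (z - x)
    rw [Submodule.starProjection_unit_singleton ℝ he] at h1
    exact h1
  refine ⟨((ℝ ∙ e)ᗮ.orthogonalProjectionOnto (z - x), inner ℝ e (z - x)), ?_, ?_, ?_⟩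
  · have : z = x + (z - x) := by abel
    conv_rhs => rw [this, ← hz]
    simp only [normalCoords]; abel
  · exact Submodule.norm_orthogonalProjectionOnto_apply_le _ _
  · simpa [he] using abs_real_inner_le_norm e (z - x)

/-- Normal coordinates are global coordinates. -/
theorem exists_homeomorph_normalCoords {e : W} (he : ‖e‖ = 1) (x : W) :
    ∃ Ψ : (ℝ ∙ e)ᗮ × ℝ ≃ₜ W, ⇑Ψ = normalCoords x e := by
  let T : W → (ℝ ∙ e)ᗮ × ℝ := fun z =>
    ((ℝ ∙ e)ᗮ.orthogonalProjectionOnto (z - x), inner ℝ e (z - x))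
  have hT : Continuous T := by fun_prop
  have hT1 : ∀ p, T (normalCoords x e p) = p := fun p => by
    have h0 : normalCoords x e p - x = (p.1 : W) + p.2 • e := by simp only [normalCoords]; abel
    refine Prod.ext ?_ ?_
    · simp only [T, h0, map_add, map_smul]
      rw [Submodule.orthogonalProjectionOnto_mem_subspace_eq_self,
        Submodule.orthogonalProjectionOnto_orthogonal_apply_eq_zero
          (Submodule.mem_span_singleton_self e), smul_zero, add_zero]
    · simp only [T, h0]
      rw [inner_add_right, real_inner_smul_right, real_inner_comm, inner_coe_orthogonal,
        real_inner_self_eq_norm_sq, he]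
      simp
  refine ⟨⟨⟨normalCoords x e, T, hT1, fun z => ?_⟩, (contDiff_normalCoords x e).continuous, hT⟩, rfl⟩
  obtain ⟨p, rfl, -⟩ := exists_normalCoords_eq x he z
  rw [hT1]

theorem isOpen_coordCylinder {e : W} (he : ‖e‖ = 1) (x : W) (r h : ℝ) :
    IsOpen (coordCylinder x e r h) := by
  obtain ⟨Ψ, hΨ⟩ := exists_homeomorph_normalCoords he x
  rw [coordCylinder, ← hΨ]
  exact Ψ.isOpenMap _ (Metric.isOpen_ball.prod isOpen_Ioo)

end GraphCoordinates

end Bifluid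

namespace Bifluid

open Module

/-! ### The divergence theorem in graph coordinates -/

section GraphGreen

variable {W : Type*} [NormedAddCommGroup W] [InnerProductSpace ℝ W] 

/-- Near `x` the set `Ω` lies below the graph of the Lipschitz function `a` in the direction `e`. -/
structure IsGraphChart (Ω : Set W) (x e : W) (a : (ℝ ∙ e)ᗮ → ℝ) (K : ℝ≥0) (r h : ℝ) : Prop where
  norm_e : ‖e‖ = 1
  lip : LipschitzWith K a
  r_pos : 0 < r
  h_pos : 0 < h
  height_lt : ∀ y, ‖y‖ < r → |a y| < h
  mem_iff : ∀ y s, ‖y‖ < r → |s| < h → (normalCoords x e (y, s) ∈ Ω ↔ s < a y)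

variable [FiniteDimensional ℝ W] [MeasurableSpace W] [BorelSpace W]

/-- This is integration by parts against the constant function 1. Rademacher's theorem identifies
line derivatives with `fderiv` almost everywhere. -/
theorem integral_fderiv_eq_zero_of_lipschitz {V : Type*} [NormedAddCommGroup V] [NormedSpace ℝ V]
    [FiniteDimensional ℝ V] [MeasurableSpace V] [BorelSpace V] (μ : Measure V) [μ.IsAddHaarMeasure]
    {Φ : V → ℝ} {C : ℝ≥0} (hΦ : LipschitzWith C Φ) (hc : HasCompactSupport Φ) (k : V) :
    Integrable (fun y => fderiv ℝ Φ y k) μ ∧ ∫ y, fderiv ℝ Φ y k ∂μ = 0 := by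
  have hae : ∀ k, (fun y => lineDeriv ℝ Φ y k) =ᵐ[μ] fun y => fderiv ℝ Φ y k := fun k => by
    filter_upwards [hΦ.ae_differentiableAt (μ := μ)] with y hy using hy.lineDeriv_eq_fderiv
  constructor
  · have hsupp : Function.support (fun y => fderiv ℝ Φ y k) ⊆ tsupport Φ := fun y hy =>
      support_fderiv_subset ℝ fun h0 => hy (by simp [h0])
    rw [← integrableOn_iff_integrable_of_support_subset hsupp]
    refine Measure.integrableOn_of_bounded (M := C * ‖k‖) hc.measure_ne_top
      (measurable_fderiv_apply_const ℝ Φ k).aestronglyMeasurable (Eventually.of_forall fun y => ?_)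
    exact ((fderiv ℝ Φ y).le_opNorm k).trans
      (mul_le_mul_of_nonneg_right (norm_fderiv_le_of_lipschitz ℝ hΦ) (norm_nonneg _))
  · have h1 := LipschitzWith.integral_lineDeriv_mul_eq (μ := μ) (f := fun _ : V => (1 : ℝ)) (C := 0)
      (LipschitzWith.const 1) hΦ hc (-k)
    have h2 : ∀ y, lineDeriv ℝ (fun _ : V => (1 : ℝ)) y (-k) = 0 := fun y => by simp [lineDeriv]
    simp only [neg_neg, mul_one, h2, zero_mul, integral_zero] at h1
    rw [← integral_congr_ae (hae k), ← h1]

/-- The derivative of the primitive is bounded. Its horizontal part integrates something of size at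
most `C₁`, with only a length `2 h` contributing because of the support, and its vertical part is
`g` itself, bounded by `C₂`. -/
theorem lipschitzWith_parametric_primitive {V : Type*} [NormedAddCommGroup V] [NormedSpace ℝ V]
    [FiniteDimensional ℝ V] {g : V × ℝ → ℝ} (hg : ContDiff ℝ 1 g) {r h : ℝ} (hh : 0 < h)
    (hg0 : ∀ p : V × ℝ, ¬ (‖p.1‖ < r ∧ |p.2| < h) → g p = 0)
    (hgd0 : ∀ p : V × ℝ, ¬ (‖p.1‖ < r ∧ |p.2| < h) → fderiv ℝ g p = 0) :
    ∃ C : ℝ≥0, LipschitzWith C fun p : V × ℝ => ∫ s in (-h)..p.2, g (p.1, s) := by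
  have hK := (isCompact_closedBall (0 : V) r).prod (isCompact_Icc (a := -h) (b := h))
  have hKmem : ∀ p : V × ℝ, p ∉ Metric.closedBall (0 : V) r ×ˢ Icc (-h) h →
      ¬ (‖p.1‖ < r ∧ |p.2| < h) := fun p hp hp' =>
    hp ⟨mem_closedBall_zero_iff.2 hp'.1.le, (abs_lt.1 hp'.2).1.le, (abs_lt.1 hp'.2).2.le⟩
  obtain ⟨C₁, hC₁⟩ := (HasCompactSupport.intro hK fun p hp =>
    hgd0 p (hKmem p hp)).exists_bound_of_continuous (hg.continuous_fderiv one_ne_zero)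
  obtain ⟨C₂, hC₂⟩ := (HasCompactSupport.intro hK fun p hp =>
    hg0 p (hKmem p hp)).exists_bound_of_continuous hg.continuous
  have hC₁0 : 0 ≤ C₁ := (norm_nonneg _).trans (hC₁ 0)
  have hC₂0 : 0 ≤ C₂ := (norm_nonneg _).trans (hC₂ 0)
  have hGd := hasFDerivAt_parametric_primitive hg (-h)
  refine ⟨(2 * h * C₁ + C₂).toNNReal, lipschitzWith_of_nnnorm_fderiv_le (𝕜 := ℝ)
    (fun p => (hGd p).differentiableAt) fun p => ?_⟩
  rw [(hGd p).fderiv, ← NNReal.coe_le_coe, coe_nnnorm, Real.coe_toNNReal _ (by positivity)]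
  have hsnd : ‖g p • ContinuousLinearMap.snd ℝ V ℝ‖ ≤ C₂ := by
    rw [norm_smul]
    exact (mul_le_mul (hC₂ p) (ContinuousLinearMap.norm_snd_le _ _ _) (norm_nonneg _) hC₂0).trans
      (mul_one _).le
  refine (norm_add_le _ _).trans (add_le_add ?_ hsnd)
  refine (ContinuousLinearMap.opNorm_comp_le _ _).trans ?_
  refine (mul_le_of_le_one_right (norm_nonneg _) (ContinuousLinearMap.norm_fst_le _ _ _)).trans ?_
  have hind : Integrable ((Ioo (-h) h).indicator fun _ : ℝ => C₁) :=
    (integrable_indicator_iff measurableSet_Ioo).2 (by simp)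
  rw [intervalIntegral.norm_integral_eq_norm_integral_uIoc]
  refine (norm_integral_le_of_norm_le (g := (Ioo (-h) h).indicator fun _ : ℝ => C₁)
    hind.integrableOn (Eventually.of_forall fun s => ?_)).trans ?_
  · by_cases hs : s ∈ Ioo (-h) h
    · rw [indicator_of_mem hs]
      refine (ContinuousLinearMap.opNorm_comp_le _ _).trans ?_
      exact (mul_le_of_le_one_right (norm_nonneg _)
        (ContinuousLinearMap.norm_inl_le_one ℝ _ _)).trans (hC₁ _)
    · rw [indicator_of_notMem hs, hgd0 _ fun h' => hs (abs_lt.1 h'.2)]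
      simp
  · refine (setIntegral_le_integral hind (Eventually.of_forall fun s =>
      indicator_nonneg (fun _ _ => hC₁0) s)).trans ?_
    rw [integral_indicator measurableSet_Ioo, setIntegral_const]
    simp only [measureReal_def, Real.volume_Ioo, smul_eq_mul]
    rw [ENNReal.toReal_ofReal (by linarith)]
    linarith

/-- The tangential derivatives of a function supported near a graph. -/
theorem integral_primitive_below_graph {V : Type*} [NormedAddCommGroup V] [NormedSpace ℝ V]
    [FiniteDimensional ℝ V] [MeasurableSpace V] [BorelSpace V] (μ : Measure V) [μ.IsAddHaarMeasure]
    {g : V × ℝ → ℝ} (hg : ContDiff ℝ 1 g) {r h : ℝ} (hh : 0 < h)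
    (hg0 : ∀ p : V × ℝ, ¬ (‖p.1‖ < r ∧ |p.2| < h) → g p = 0)
    (hgd0 : ∀ p : V × ℝ, ¬ (‖p.1‖ < r ∧ |p.2| < h) → fderiv ℝ g p = 0)
    {a : V → ℝ} {K : ℝ≥0} (ha : LipschitzWith K a) (k : V) :
    Integrable (fun y => (∫ s in (-h)..(a y), fderiv ℝ g (y, s) (k, 0))
      + g (y, a y) * fderiv ℝ a y k) μ ∧
    ∫ y, ((∫ s in (-h)..(a y), fderiv ℝ g (y, s) (k, 0)) + g (y, a y) * fderiv ℝ a y k) ∂μ = 0 := by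
  obtain ⟨C, hC⟩ := lipschitzWith_parametric_primitive hg hh hg0 hgd0
  -- `Φ` is Lipschitz with compact support, so its derivative has integral zero. Where `a` is
  -- differentiable, the chain rule shows that this derivative is the integrand in question.
  let Φ : V → ℝ := fun y => ∫ s in (-h)..(a y), g (y, s)
  have hΦlip : LipschitzWith _ Φ := hC.comp (LipschitzWith.id.prodMk ha)
  have hΦ0 : HasCompactSupport Φ :=
    HasCompactSupport.intro (isCompact_closedBall (0 : V) r) fun y hy => by
      have hy' : ¬ ‖y‖ < r := fun h' => hy (mem_closedBall_zero_iff.2 h'.le)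
      have : ∀ s, g (y, s) = 0 := fun s => hg0 _ fun h' => hy' h'.1
      simp [Φ, this]
  obtain ⟨hint, hzero⟩ := integral_fderiv_eq_zero_of_lipschitz μ hΦlip hΦ0 k
  have hΦd : (fun y => fderiv ℝ Φ y k) =ᵐ[μ] fun y =>
      (∫ s in (-h)..(a y), fderiv ℝ g (y, s) (k, 0)) + g (y, a y) * fderiv ℝ a y k := by
    filter_upwards [ha.ae_differentiableAt (μ := μ)] with y hy
    have h0 : HasFDerivAt (fun y => (y, a y)) _ y := (hasFDerivAt_id y).prodMk hy.hasFDerivAt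
    have h1 := HasFDerivAt.comp y (hasFDerivAt_parametric_primitive hg (-h) (y, a y)) h0
    rw [show fderiv ℝ Φ y = _ from h1.fderiv]
    change (∫ s in (-h)..(a y), (fderiv ℝ g (y, s)).comp (ContinuousLinearMap.inl ℝ _ ℝ)) k
      + g (y, a y) * fderiv ℝ a y k = _
    rw [ContinuousLinearMap.intervalIntegral_apply]
    · rfl
    · exact (((hg.continuous_fderiv one_ne_zero).comp
        (by fun_prop : Continuous fun s : ℝ => (y, s))).clm_comp
        continuous_const).intervalIntegrable _ _
  exact ⟨hint.congr hΦd, (integral_congr_ae hΦd).symm.trans hzero⟩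

/-- The divergence theorem for functions supported near a piece of a Lipschitz boundary, written
in the coordinates of the graph. -/
theorem IsGraphChart.integral_fderiv {Ω : Set W} (hΩ : MeasurableSet Ω) {x e : W}
    {a : (ℝ ∙ e)ᗮ → ℝ} {K : ℝ≥0} {r h : ℝ} (hc : IsGraphChart Ω x e a K r h) {f : W → ℝ}
    (hf : ContDiff ℝ 1 f) (hfc : HasCompactSupport f) (hfs : tsupport f ⊆ coordCylinder x e r h)
    (w : W) :
    Integrable (fun y => f (graphMap x e a y) *
      (inner ℝ e w - fderiv ℝ a y ((ℝ ∙ e)ᗮ.orthogonalProjectionOnto w))) ∧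
    ∫ z in Ω, fderiv ℝ f z w = ∫ y, f (graphMap x e a y) *
      (inner ℝ e w - fderiv ℝ a y ((ℝ ∙ e)ᗮ.orthogonalProjectionOnto w)) := by
  classical
  have he := hc.norm_e
  obtain ⟨k, hk⟩ : ∃ k, k = (ℝ ∙ e)ᗮ.orthogonalProjectionOnto w := ⟨_, rfl⟩
  obtain ⟨c, hcc⟩ : ∃ c : ℝ, c = inner ℝ e w := ⟨_, rfl⟩
  rw [← hk, ← hcc]
  have hw : (k : W) + c • e = w := by
    have h1 := (ℝ ∙ e).starProjection_add_starProjection_orthogonal w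
    rw [Submodule.starProjection_unit_singleton ℝ he] at h1
    rw [add_comm, hk, hcc]; exact h1
  let g : (ℝ ∙ e)ᗮ × ℝ → ℝ := f ∘ normalCoords x e
  have hgC : ContDiff ℝ 1 g := hf.comp ((contDiff_normalCoords x e).of_le (by simp))
  have hgd : ∀ p k' c', fderiv ℝ g p (k', c') = fderiv ℝ f (normalCoords x e p) (k' + c' • e) :=
    fun p k' c' => by
      rw [((hf.differentiable one_ne_zero _).hasFDerivAt.comp p
        (hasFDerivAt_normalCoords x e p)).fderiv]
      rfl
  have hz0 : ∀ p : (ℝ ∙ e)ᗮ × ℝ, ¬ (‖p.1‖ < r ∧ |p.2| < h) → normalCoords x e p ∉ tsupport f :=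
    fun p hp hm => hp ((normalCoords_mem_coordCylinder he x r h p.1 p.2).1 (hfs hm))
  have hg0 : ∀ p : (ℝ ∙ e)ᗮ × ℝ, ¬ (‖p.1‖ < r ∧ |p.2| < h) → g p = 0 := fun p hp =>
    image_eq_zero_of_notMem_tsupport (f := f) (hz0 p hp)
  have hfd0 : ∀ p : (ℝ ∙ e)ᗮ × ℝ, ¬ (‖p.1‖ < r ∧ |p.2| < h) →
      fderiv ℝ f (normalCoords x e p) = 0 := fun p hp =>
    by_contra fun h0 => hz0 p hp (support_fderiv_subset ℝ h0)
  have hgd0 : ∀ p : (ℝ ∙ e)ᗮ × ℝ, ¬ (‖p.1‖ < r ∧ |p.2| < h) → fderiv ℝ g p = 0 := fun p hp => by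
    refine ContinuousLinearMap.ext fun v => ?_
    rw [show v = (v.1, v.2) from rfl, hgd, hfd0 p hp]
    rfl
  have hgdcont : Continuous (fderiv ℝ g) := hgC.continuous_fderiv one_ne_zero
  obtain ⟨hint, hzero⟩ := integral_primitive_below_graph volume hgC hc.h_pos hg0 hgd0 hc.lip k
  -- The derivative along `e` integrates to the value on the graph, because `g` vanishes at height
  -- `-h`. The tangential part is left as it stands: by `hzero`, its integral over `y` cancels once
  -- `g (y, a y)` times the slope of `a` is added.
  have hslice : ∀ y, ∫ s, Ω.indicator (fun z => fderiv ℝ f z w) (normalCoords x e (y, s))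
      = (∫ s in (-h)..(a y), fderiv ℝ g (y, s) (k, 0)) + c * g (y, a y) := by
    intro y
    by_cases hy : ‖y‖ < r
    · have hlt := abs_lt.1 (hc.height_lt y hy)
      have h1 : ∀ s, Ω.indicator (fun z => fderiv ℝ f z w) (normalCoords x e (y, s))
          = (Ioo (-h) (a y)).indicator (fun s => fderiv ℝ g (y, s) (k, c)) s := fun s => by
        by_cases hs : |s| < h
        · by_cases hsa : s < a y
          · rw [indicator_of_mem ((hc.mem_iff y s hy hs).2 hsa),
              indicator_of_mem (show s ∈ Ioo (-h) (a y) from ⟨(abs_lt.1 hs).1, hsa⟩), hgd, hw]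
          · rw [indicator_of_notMem fun h' => hsa ((hc.mem_iff y s hy hs).1 h'),
              indicator_of_notMem fun h' => hsa h'.2]
        · rw [indicator_apply, hfd0 _ fun h' => hs h'.2, indicator_apply,
            hgd0 _ fun h' => hs h'.2]
          simp
      have h2 : ∀ s, fderiv ℝ g (y, s) (k, c) =
          fderiv ℝ g (y, s) (k, 0) + c * fderiv ℝ g (y, s) (0, 1) := fun s => by
        have : ((k, c) : (ℝ ∙ e)ᗮ × ℝ) = (k, 0) + c • (0, 1) := by simp
        rw [this, map_add, map_smul, smul_eq_mul]
      have hi : ∀ v, IntervalIntegrable (fun s => fderiv ℝ g (y, s) v) volume (-h) (a y) := fun v =>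
        ((hgdcont.comp (by fun_prop : Continuous fun s : ℝ => (y, s))).clm_apply
          continuous_const).intervalIntegrable _ _
      rw [integral_congr_ae (Eventually.of_forall h1), integral_indicator measurableSet_Ioo,
        ← integral_Ioc_eq_integral_Ioo, ← intervalIntegral.integral_of_le hlt.1.le,
        intervalIntegral.integral_congr fun s _ => h2 s,
        intervalIntegral.integral_add (hi _) ((hi _).const_mul _),
        intervalIntegral.integral_const_mul]
      have h3 : ∫ s in (-h)..(a y), fderiv ℝ g (y, s) (0, 1) = g (y, a y) - g (y, -h) :=
        intervalIntegral.integral_eq_sub_of_hasDerivAt (f := fun s => g (y, s)) (fun s _ => by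
          have h4 : HasDerivAt (fun s : ℝ => (y, s)) ((0 : (ℝ ∙ e)ᗮ), (1 : ℝ)) s :=
            (hasDerivAt_const s y).prodMk (hasDerivAt_id s)
          exact (hgC.differentiable one_ne_zero (y, s)).hasFDerivAt.comp_hasDerivAt s h4) (hi _)
      rw [h3, hg0 (y, -h) (by simp [abs_of_pos hc.h_pos]), sub_zero]
    · have h1 : ∀ s, Ω.indicator (fun z => fderiv ℝ f z w) (normalCoords x e (y, s)) = 0 :=
        fun s => by rw [indicator_apply, hfd0 _ fun h' => hy h'.1]; simp
      have h2 : ∀ s, fderiv ℝ g (y, s) (k, 0) = 0 := fun s => by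
        rw [hgd0 _ fun h' => hy h'.1]; rfl
      simp [h1, h2, hg0 (y, a y) fun h' => hy h'.1]
  have hfi : Integrable fun z => fderiv ℝ f z w :=
    ((hf.continuous_fderiv one_ne_zero).clm_apply continuous_const).integrable_of_hasCompactSupport
      (hfc.fderiv_apply ℝ w)
  have hindi : Integrable (Ω.indicator fun z => fderiv ℝ f z w) := hfi.indicator hΩ
  have hslice_int : Integrable fun y => ∫ s, Ω.indicator (fun z => fderiv ℝ f z w)
      (normalCoords x e (y, s)) :=
    Integrable.integral_prod_left (((measurePreserving_normalCoords he x).integrable_comp_emb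
      (measurableEmbedding_normalCoords he x)).2 hindi)
  have heq : (fun y => f (graphMap x e a y) * (c - fderiv ℝ a y k)) = fun y =>
      (∫ s, Ω.indicator (fun z => fderiv ℝ f z w) (normalCoords x e (y, s))) -
      ((∫ s in (-h)..(a y), fderiv ℝ g (y, s) (k, 0)) + g (y, a y) * fderiv ℝ a y k) := by
    funext y
    rw [hslice]
    change g (y, a y) * _ = _
    ring
  rw [heq]
  refine ⟨hslice_int.sub hint, ?_⟩
  rw [integral_sub hslice_int hint, hzero, sub_zero,
    ← integral_indicator hΩ, integral_normalCoords he x hindi]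

end GraphGreen

end Bifluid

namespace Bifluid

open Module

/-! ### Uniqueness of the outer normal -/

section OuterNormal

variable {d : ℕ} {Ω : Set (Vec d)}

/-- For distinct normals and `v = ν' - ν`, the points `x + t v` with small `t > 0` would lie in the
inner cone of `ν` and in the outer cone of `ν'`. The opening `‖v‖ / 4` is small enough since `|⟨v,
ν⟩| = |⟨v, ν'⟩| = ‖v‖² / 2`. -/
theorem IsOuterNormal.eq {x ν ν' : Vec d} (h : IsOuterNormal Ω x ν) (h' : IsOuterNormal Ω x ν') :
    ν = ν' := by
  by_contra hne
  have hv : 0 < ‖ν' - ν‖ := norm_pos_iff.2 (sub_ne_zero.2 (Ne.symm hne))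
  have hsq : ‖ν' - ν‖ ^ 2 = 2 * (1 - inner ℝ ν' ν) := by
    rw [norm_sub_sq_real, h.1, h'.1]; ring
  set v := ν' - ν
  have hc : 0 < 1 - inner ℝ ν' ν := by nlinarith
  have h1 : inner ℝ v ν = -(1 - inner ℝ ν' ν) := by
    rw [inner_sub_left, real_inner_self_eq_norm_sq, h.1]; ring
  have h2 : inner ℝ v ν' = 1 - inner ℝ ν' ν := by
    rw [inner_sub_left, real_inner_self_eq_norm_sq, h'.1, real_inner_comm]; ring
  have hε : 0 < ‖v‖ / 4 := by positivity
  have hlim : Tendsto (fun t : ℝ => x + t • v) (𝓝[>] 0) (𝓝 x) := by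
    have : Continuous fun t : ℝ => x + t • v := by fun_prop
    simpa using (this.tendsto 0).mono_left nhdsWithin_le_nhds
  obtain ⟨t, ht1, ht2, ht⟩ := ((hlim.eventually (h.2 _ hε)).and
    ((hlim.eventually (h'.2 _ hε)).and self_mem_nhdsWithin)).exists
  have ht0 : (0 : ℝ) < t := ht
  rw [add_sub_cancel_left, real_inner_smul_left, norm_smul, Real.norm_of_nonneg ht0.le] at ht1 ht2
  refine ht2.2 ?_ (ht1.1 ?_)
  · rw [h2]; nlinarith [mul_pos ht0 hc]
  · rw [h1]; nlinarith [mul_pos ht0 hc]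

theorem IsOuterNormal.outerNormal_eq {x ν : Vec d} (h : IsOuterNormal Ω x ν) :
    outerNormal Ω x = ν := by
  rw [outerNormal, dif_pos ⟨ν, h⟩]
  exact (Exists.choose_spec (⟨ν, h⟩ : ∃ ν, IsOuterNormal Ω x ν)).eq h

end OuterNormal

/-! ### Frontier, surface measure and normal in a chart -/

section Charts

variable {d : ℕ} {Ω : Set (Vec d)} {x e : Vec d} {a : (ℝ ∙ e)ᗮ → ℝ} {K : ℝ≥0} {r h : ℝ}

theorem IsBoundedLipschitzDomain.exists_chart (hΩ : IsBoundedLipschitzDomain Ω) {x : Vec d}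
    (hx : x ∈ frontier Ω) : ∃ (e : Vec d) (a : (ℝ ∙ e)ᗮ → ℝ) (K : ℝ≥0) (r h : ℝ),
      IsGraphChart Ω x e a K r h := by
  obtain ⟨e, a, K, r, h, he, ha, hr, hh, H⟩ := hΩ.graph x hx
  exact ⟨e, a, K, r, h, he, ha, hr, hh, fun y hy => (H y hy).1, fun y s hy hs => (H y hy).2 s hs⟩

theorem IsGraphChart.mem_cylinder (hc : IsGraphChart Ω x e a K r h) : x ∈ coordCylinder x e r h := by
  have := (normalCoords_mem_coordCylinder hc.norm_e x r h 0 0).2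
    ⟨by simpa using hc.r_pos, by simpa using hc.h_pos⟩
  simpa [normalCoords] using this

theorem IsGraphChart.graphMap_mem_cylinder_iff (hc : IsGraphChart Ω x e a K r h) (y : (ℝ ∙ e)ᗮ) :
    graphMap x e a y ∈ coordCylinder x e r h ↔ ‖y‖ < r := by
  rw [show graphMap x e a y = normalCoords x e (y, a y) from rfl,
    normalCoords_mem_coordCylinder hc.norm_e]
  exact ⟨fun h => h.1, fun h => ⟨h, hc.height_lt y h⟩⟩

/-- For open `Ω` the frontier is the closure minus `Ω`. A point strictly above the graph has a
neighbourhood that misses `Ω`, and a point on the graph is a limit of points straight below it. -/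
theorem IsGraphChart.mem_frontier_iff (hΩ : IsOpen Ω) (hc : IsGraphChart Ω x e a K r h)
    {y : (ℝ ∙ e)ᗮ} {s : ℝ} (hy : ‖y‖ < r) (hs : |s| < h) :
    normalCoords x e (y, s) ∈ frontier Ω ↔ s = a y := by
  rw [hΩ.frontier_eq, Set.mem_sdiff, hc.mem_iff y s hy hs, not_lt]
  constructor
  · rintro ⟨h1, h2⟩
    refine le_antisymm (le_of_not_gt fun h3 => ?_) h2
    obtain ⟨Ψ, hΨ⟩ := exists_homeomorph_normalCoords hc.norm_e x
    have hopen : IsOpen (normalCoords x e ''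
        ({p | ‖p.1‖ < r} ∩ {p | |p.2| < h} ∩ {p | a p.1 < p.2})) := by
      rw [← hΨ]
      refine Ψ.isOpenMap _ (((isOpen_lt (by fun_prop) (by fun_prop)).inter
        (isOpen_lt (by fun_prop) (by fun_prop))).inter (isOpen_lt ?_ (by fun_prop)))
      exact hc.lip.continuous.comp continuous_fst
    obtain ⟨z, ⟨p, hp, rfl⟩, hz⟩ := mem_closure_iff.1 h1 _ hopen ⟨(y, s), ⟨⟨hy, hs⟩, h3⟩, rfl⟩
    exact lt_asymm hp.2 ((hc.mem_iff p.1 p.2 hp.1.1 hp.1.2).1 hz)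
  · rintro rfl
    refine ⟨mem_closure_of_tendsto (f := fun s => normalCoords x e (y, s)) (b := 𝓝[<] (a y)) ?_ ?_,
      le_rfl⟩
    · exact (((contDiff_normalCoords x e).continuous.comp
        (by fun_prop : Continuous fun s : ℝ => (y, s))).tendsto (a y)).mono_left nhdsWithin_le_nhds
    · have : ∀ᶠ s in 𝓝[<] (a y), |s| < h := nhdsWithin_le_nhds
        ((isOpen_lt continuous_abs continuous_const).mem_nhds hs)
      filter_upwards [this, self_mem_nhdsWithin] with s h1 h2
      exact (hc.mem_iff y s hy h1).2 h2

theorem IsGraphChart.frontier_inter_cylinder (hΩ : IsOpen Ω) (hc : IsGraphChart Ω x e a K r h) :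
    frontier Ω ∩ coordCylinder x e r h = graphMap x e a '' Metric.ball 0 r := by
  ext z
  constructor
  · rintro ⟨h1, ⟨p, hp, rfl⟩⟩
    have hp1 := mem_ball_zero_iff.1 hp.1
    have hp2 := abs_lt.2 hp.2
    have : p.2 = a p.1 := (hc.mem_frontier_iff hΩ hp1 hp2).1 h1
    exact ⟨p.1, hp.1, by rw [normalCoords, this]; rfl⟩
  · rintro ⟨y, hy, rfl⟩
    have hy' := mem_ball_zero_iff.1 hy
    exact ⟨(hc.mem_frontier_iff hΩ hy' (hc.height_lt y hy')).2 rfl,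
      (hc.graphMap_mem_cylinder_iff y).2 hy'⟩

/-- The surface measure in a chart. -/
theorem IsGraphChart.surfaceMeasure_restrict (hΩ : IsOpen Ω) (hc : IsGraphChart Ω x e a K r h) :
    (surfaceMeasure Ω).restrict (coordCylinder x e r h) =
      ((volume.withDensity fun y => ENNReal.ofReal (graphJacobian (fderiv ℝ a y))).restrict
        (Metric.ball 0 r)).map (graphMap x e a) := by
  have hF := measurableEmbedding_graphMap hc.norm_e x hc.lip.continuous
  have hn : finrank ℝ (ℝ ∙ e)ᗮ = d - 1 := by
    have h1 := (ℝ ∙ e).finrank_add_finrank_orthogonal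
    have h0 : e ≠ 0 := fun h => by simpa [h] using hc.norm_e
    rw [finrank_span_singleton h0, finrank_euclideanSpace_fin] at h1
    omega
  have harea := euclideanHausdorffMeasure_comap_graphMap hc.norm_e x hc.lip
  rw [hn] at harea
  have hcm : MeasurableSet (coordCylinder x e r h) := (isOpen_coordCylinder hc.norm_e x r h).measurableSet
  ext t ht
  rw [Measure.restrict_apply ht, surfaceMeasure, Measure.restrict_apply (ht.inter hcm),
    Measure.map_apply hF.measurable ht, Measure.restrict_apply (hF.measurable ht), ← harea,
    hF.comap_apply]
  congr 1
  rw [image_preimage_inter, ← hc.frontier_inter_cylinder hΩ]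
  ext z; simp only [mem_inter_iff]; tauto

theorem sub_graphMap {e : Vec d} (a : (ℝ ∙ e)ᗮ → ℝ) (p : (ℝ ∙ e)ᗮ × ℝ) (y : (ℝ ∙ e)ᗮ) :
    normalCoords x e p - graphMap x e a y = ((p.1 - y : (ℝ ∙ e)ᗮ) : Vec d) + (p.2 - a y) • e := by
  simp only [graphMap, normalCoords, Submodule.coe_sub, sub_smul]; abel

/-- The upward unit normal to the graph of a function with derivative `g`. -/
noncomputable def graphNormal {e : Vec d} (g : (ℝ ∙ e)ᗮ →L[ℝ] ℝ) : Vec d :=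
  (graphJacobian g)⁻¹ • (e - (((InnerProductSpace.toDual ℝ (ℝ ∙ e)ᗮ).symm g : (ℝ ∙ e)ᗮ) : Vec d))

/-- The right-hand side is the weight produced by `IsGraphChart.integral_fderiv`. The area factor on
the left is the density of the surface measure, so the two combine into a flux. -/
theorem inner_graphNormal {e : Vec d} (g : (ℝ ∙ e)ᗮ →L[ℝ] ℝ) (w : Vec d) :
    graphJacobian g * inner ℝ (graphNormal g) w =
      inner ℝ e w - g ((ℝ ∙ e)ᗮ.orthogonalProjectionOnto w) := by
  rw [graphNormal, real_inner_smul_left, ← mul_assoc, mul_inv_cancel₀ (graphJacobian_pos g).ne',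
    one_mul, inner_sub_left]
  congr 1
  rw [← InnerProductSpace.toDual_symm_apply (𝕜 := ℝ) (y := g),
    Submodule.inner_orthogonalProjectionOnto_eq_of_mem_left]

theorem norm_graphNormal {e : Vec d} (he : ‖e‖ = 1) (g : (ℝ ∙ e)ᗮ →L[ℝ] ℝ) :
    ‖graphNormal g‖ = 1 := by
  have hJ := graphJacobian_pos g
  set G := (InnerProductSpace.toDual ℝ (ℝ ∙ e)ᗮ).symm g with hG
  have hn : ‖G‖ = ‖g‖ := by rw [hG, LinearIsometryEquiv.norm_map]
  have h1 : ‖e - (G : Vec d)‖ = graphJacobian g := by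
    rw [graphJacobian, ← Real.sqrt_sq (norm_nonneg (e - (G : Vec d)))]
    congr 1
    have := norm_coe_add_smul_sq he (-G) 1
    rw [norm_neg, hn, one_smul, Submodule.coe_neg] at this
    rw [show e - (G : Vec d) = -(G : Vec d) + e by abel, this]
    ring
  rw [graphNormal, norm_smul, norm_inv, Real.norm_of_nonneg hJ.le, h1, inv_mul_cancel₀ hJ.ne']

/-- The inner product with the candidate normal, times the area factor, is the height above the
tangent plane at `y`. The function `a` stays within `ε ‖p.1 - y‖` of that plane, and the area factor
is at least 1, so the cone conditions decide the side of the graph. -/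
theorem IsGraphChart.isOuterNormal (hc : IsGraphChart Ω x e a K r h) {y : (ℝ ∙ e)ᗮ}
    (hy : ‖y‖ < r) (hd : DifferentiableAt ℝ a y) :
    IsOuterNormal Ω (graphMap x e a y) (graphNormal (fderiv ℝ a y)) := by
  refine ⟨norm_graphNormal hc.norm_e _, fun ε hε => ?_⟩
  have hJ := one_le_graphJacobian (fderiv ℝ a y)
  obtain ⟨Ψ, hΨ⟩ := exists_homeomorph_normalCoords hc.norm_e x
  have hnh : 𝓝 (graphMap x e a y) = map (normalCoords x e) (𝓝 (y, a y)) := by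
    rw [← hΨ, Ψ.map_nhds_eq, hΨ]; rfl
  rw [hnh, eventually_map]
  have h1 : ∀ᶠ p : (ℝ ∙ e)ᗮ × ℝ in 𝓝 (y, a y), ‖p.1‖ < r ∧ |p.2| < h :=
    ((continuous_fst.norm.tendsto (y, a y)).eventually_lt_const hy).and
      ((continuous_snd.abs.tendsto (y, a y)).eventually_lt_const (hc.height_lt y hy))
  have h2 : ∀ᶠ p : (ℝ ∙ e)ᗮ × ℝ in 𝓝 (y, a y),
      ‖a p.1 - a y - fderiv ℝ a y (p.1 - y)‖ ≤ ε * ‖p.1 - y‖ :=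
    (continuous_fst.tendsto (y, a y)).eventually
      ((hasFDerivAt_iff_isLittleO.1 hd.hasFDerivAt).def hε)
  filter_upwards [h1, h2] with p hp1 hp2
  have hn1 : ‖p.1 - y‖ ≤ ‖normalCoords x e p - graphMap x e a y‖ := by
    rw [sub_graphMap]
    have := norm_coe_add_smul_sq hc.norm_e (p.1 - y) (p.2 - a y)
    refine le_of_sq_le_sq ?_ (norm_nonneg _)
    nlinarith [sq_nonneg (p.2 - a y)]
  have hin : graphJacobian (fderiv ℝ a y) *
      inner ℝ (normalCoords x e p - graphMap x e a y) (graphNormal (fderiv ℝ a y)) =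
      p.2 - a y - fderiv ℝ a y (p.1 - y) := by
    rw [real_inner_comm, inner_graphNormal, sub_graphMap]
    congr 1
    · rw [inner_add_right, real_inner_comm, inner_coe_orthogonal, real_inner_smul_right,
        real_inner_self_eq_norm_sq, hc.norm_e]; ring
    · rw [map_add, map_smul, Submodule.orthogonalProjectionOnto_mem_subspace_eq_self,
        Submodule.orthogonalProjectionOnto_orthogonal_apply_eq_zero
          (Submodule.mem_span_singleton_self e), smul_zero, add_zero]
  set I := inner ℝ (normalCoords x e p - graphMap x e a y) (graphNormal (fderiv ℝ a y))
  set N := ‖normalCoords x e p - graphMap x e a y‖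
  rw [Real.norm_eq_abs, abs_le] at hp2
  have hN : 0 ≤ N := norm_nonneg _
  have hεN : ε * ‖p.1 - y‖ ≤ ε * N := mul_le_mul_of_nonneg_left hn1 hε.le
  rw [show p = (p.1, p.2) from rfl, hc.mem_iff p.1 p.2 hp1.1 hp1.2]
  constructor
  · intro hI
    have : graphJacobian (fderiv ℝ a y) * I < - (ε * N) := by
      nlinarith [mul_nonneg hε.le hN]
    linarith [hp2.1]
  · intro hI
    have : ε * N < graphJacobian (fderiv ℝ a y) * I := by
      nlinarith [mul_nonneg hε.le hN]
    linarith [hp2.2]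

end Charts

end Bifluid

namespace Bifluid

open Module

/-! ### Global properties of the surface measure -/

section Surface

variable {d : ℕ} {Ω : Set (Vec d)} {x e : Vec d} {a : (ℝ ∙ e)ᗮ → ℝ} {K : ℝ≥0} {r h : ℝ}

theorem measurable_graphJacobian_fderiv (a : (ℝ ∙ e)ᗮ → ℝ) :
    Measurable fun y => graphJacobian (fderiv ℝ a y) :=
  continuous_graphJacobian.measurable.comp (measurable_fderiv ℝ a)

theorem IsGraphChart.setIntegral_surfaceMeasure (hΩ : IsOpen Ω) (hc : IsGraphChart Ω x e a K r h)
    (F : Vec d → ℝ) : ∫ z in coordCylinder x e r h, F z ∂surfaceMeasure Ω =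
      ∫ y in Metric.ball 0 r, graphJacobian (fderiv ℝ a y) * F (graphMap x e a y) := by
  rw [hc.surfaceMeasure_restrict hΩ,
    (measurableEmbedding_graphMap hc.norm_e x hc.lip.continuous).integral_map,
    setIntegral_withDensity_eq_setIntegral_toReal_smul
      (measurable_graphJacobian_fderiv a).ennreal_ofReal (Eventually.of_forall fun y => by simp) _
      measurableSet_ball]
  refine integral_congr_ae (Eventually.of_forall fun y => ?_)
  simp only [ENNReal.toReal_ofReal (graphJacobian_pos _).le, smul_eq_mul]

theorem IsGraphChart.ae_outerNormal (hc : IsGraphChart Ω x e a K r h) :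
    ∀ᵐ y, ‖y‖ < r → outerNormal Ω (graphMap x e a y) = graphNormal (fderiv ℝ a y) := by
  filter_upwards [hc.lip.ae_differentiableAt (μ := volume)] with y hy hyr
  exact (hc.isOuterNormal hyr hy).outerNormal_eq

/-- The divergence theorem near a boundary point. -/
theorem IsGraphChart.integral_fderiv_eq_surface (hΩ : IsOpen Ω) (hc : IsGraphChart Ω x e a K r h)
    {f : Vec d → ℝ} (hf : ContDiff ℝ 1 f) (hfc : HasCompactSupport f)
    (hfs : tsupport f ⊆ coordCylinder x e r h) (w : Vec d) :
    ∫ z in Ω, fderiv ℝ f z w = ∫ z, f z * inner ℝ (outerNormal Ω z) w ∂surfaceMeasure Ω := by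
  have h0 : ∀ z, z ∉ coordCylinder x e r h → f z = 0 := fun z hz =>
    image_eq_zero_of_notMem_tsupport fun h' => hz (hfs h')
  rw [(hc.integral_fderiv hΩ.measurableSet hf hfc hfs w).2,
    ← setIntegral_eq_integral_of_forall_compl_eq_zero (s := coordCylinder x e r h)
      fun z hz => by rw [h0 z hz, zero_mul], hc.setIntegral_surfaceMeasure hΩ,
    ← setIntegral_eq_integral_of_forall_compl_eq_zero (s := Metric.ball 0 r)
      fun y hy => by
        rw [h0 _ fun h' => hy (mem_ball_zero_iff.2 ((hc.graphMap_mem_cylinder_iff y).1 h')),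
          zero_mul]]
  refine setIntegral_congr_ae measurableSet_ball ?_
  filter_upwards [hc.ae_outerNormal] with y hy hyr
  rw [hy (mem_ball_zero_iff.1 hyr), mul_left_comm, inner_graphNormal]

theorem IsGraphChart.surfaceMeasure_lt_top (hΩ : IsOpen Ω) (hc : IsGraphChart Ω x e a K r h) :
    surfaceMeasure Ω (coordCylinder x e r h) < ⊤ := by
  have hF := measurableEmbedding_graphMap hc.norm_e x hc.lip.continuous
  rw [← Measure.restrict_apply_univ, hc.surfaceMeasure_restrict hΩ, hF.map_apply, preimage_univ,
    Measure.restrict_apply_univ, withDensity_apply _ measurableSet_ball]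
  refine setLIntegral_lt_top_of_le_nnreal measure_ball_lt_top.ne
    ⟨(√(1 + K ^ 2)).toNNReal, fun y _ => ENNReal.ofReal_le_ofReal ?_⟩
  refine Real.sqrt_le_sqrt (by gcongr; exact norm_fderiv_le_of_lipschitz ℝ hc.lip)

theorem measurable_graphNormal_fderiv (a : (ℝ ∙ e)ᗮ → ℝ) :
    Measurable fun y => graphNormal (fderiv ℝ a y) := by
  have : Continuous (graphNormal (e := e)) := by
    unfold graphNormal
    refine (continuous_graphJacobian.inv₀ fun g => (graphJacobian_pos g).ne').smul
      (continuous_const.sub (continuous_subtype_val.comp (LinearIsometryEquiv.continuous _)))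
  exact this.measurable.comp (measurable_fderiv ℝ a)

theorem IsGraphChart.aestronglyMeasurable_outerNormal (hΩ : IsOpen Ω)
    (hc : IsGraphChart Ω x e a K r h) : AEStronglyMeasurable (outerNormal Ω)
      ((surfaceMeasure Ω).restrict (coordCylinder x e r h)) := by
  have hF := measurableEmbedding_graphMap hc.norm_e x hc.lip.continuous
  rw [hc.surfaceMeasure_restrict hΩ, hF.aestronglyMeasurable_map_iff]
  refine ⟨_, (measurable_graphNormal_fderiv a).stronglyMeasurable, ?_⟩
  rw [Filter.EventuallyEq, ae_restrict_iff' measurableSet_ball]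
  refine (withDensity_absolutelyContinuous _ _).ae_le ?_
  filter_upwards [hc.ae_outerNormal] with y hy hyr using hy (mem_ball_zero_iff.1 hyr)

theorem IsGraphChart.ae_norm_outerNormal (hΩ : IsOpen Ω)
    (hc : IsGraphChart Ω x e a K r h) :
    ∀ᵐ z ∂((surfaceMeasure Ω).restrict (coordCylinder x e r h)), ‖outerNormal Ω z‖ = 1 := by
  have hF := measurableEmbedding_graphMap hc.norm_e x hc.lip.continuous
  rw [hc.surfaceMeasure_restrict hΩ, hF.ae_map_iff, ae_restrict_iff' measurableSet_ball]
  refine (withDensity_absolutelyContinuous _ _).ae_le ?_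
  filter_upwards [hc.ae_outerNormal] with y hy hyr
  rw [hy (mem_ball_zero_iff.1 hyr), norm_graphNormal hc.norm_e]

/-- The chart pulls `U` back to a nonempty open set, and the area factor is positive. This later
upgrades almost everywhere vanishing on the boundary to vanishing everywhere, for continuous
functions. -/
theorem IsGraphChart.surfaceMeasure_pos (hΩ : IsOpen Ω) (hc : IsGraphChart Ω x e a K r h)
    (hx : x ∈ frontier Ω) {U : Set (Vec d)} (hU : IsOpen U) (hxU : x ∈ U) :
    0 < surfaceMeasure Ω U := by
  have hF := measurableEmbedding_graphMap hc.norm_e x hc.lip.continuous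
  have ha0 : graphMap x e a 0 = x := by
    have h1 : normalCoords x e ((0 : (ℝ ∙ e)ᗮ), (0 : ℝ)) = x := by simp [normalCoords]
    have h2 := (hc.mem_frontier_iff hΩ (y := 0) (s := 0) (by simpa using hc.r_pos)
      (by simpa using hc.h_pos)).1 (by rw [h1]; exact hx)
    simp [graphMap, ← h2]
  refine lt_of_lt_of_le ?_ (Measure.restrict_apply_le (s := coordCylinder x e r h) _)
  rw [hc.surfaceMeasure_restrict hΩ, hF.map_apply, pos_iff_ne_zero, Ne,
    Measure.restrict_apply (hF.measurable hU.measurableSet)]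
  intro h0
  rw [withDensity_apply_eq_zero (measurable_graphJacobian_fderiv a).ennreal_ofReal] at h0
  have hopen : IsOpen (graphMap x e a ⁻¹' U ∩ Metric.ball 0 r) :=
    (hU.preimage (lipschitzWith_graphMap hc.norm_e x hc.lip).continuous).inter Metric.isOpen_ball
  have hne : (graphMap x e a ⁻¹' U ∩ Metric.ball 0 r).Nonempty :=
    ⟨0, by rwa [mem_preimage, ha0], by simpa using hc.r_pos⟩
  refine (hopen.measure_pos volume hne).ne' ?_
  · refine measure_mono_null ?_ h0
    exact fun y hy => ⟨by simp [graphJacobian_pos], hy⟩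

theorem surfaceMeasure_compl_frontier : surfaceMeasure Ω (frontier Ω)ᶜ = 0 := by
  rw [surfaceMeasure, Measure.restrict_apply isClosed_frontier.measurableSet.compl]
  simp

/-- A finite cover of the boundary by charts. -/
theorem IsBoundedLipschitzDomain.exists_finite_cover (hΩ : IsBoundedLipschitzDomain Ω) :
    ∃ 𝓤 : Set (Set (Vec d)), 𝓤.Finite ∧ (∀ U ∈ 𝓤, ∃ (x e : Vec d) (a : (ℝ ∙ e)ᗮ → ℝ) (K : ℝ≥0)
      (r h : ℝ), IsGraphChart Ω x e a K r h ∧ U = coordCylinder x e r h) ∧ frontier Ω ⊆ ⋃₀ 𝓤 := by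
  have hK : IsCompact (frontier Ω) :=
    Metric.isCompact_of_isClosed_isBounded isClosed_frontier
      (hΩ.isBounded.closure.subset frontier_subset_closure)
  choose e a K r h hc using fun x : frontier Ω => hΩ.exists_chart x.2
  obtain ⟨t, ht⟩ := hK.elim_finite_subcover
    (fun x : frontier Ω => coordCylinder x.1 (e x) (r x) (h x))
    (fun x => isOpen_coordCylinder (hc x).norm_e _ _ _)
    fun x hx => mem_iUnion.2 ⟨⟨x, hx⟩, (hc ⟨x, hx⟩).mem_cylinder⟩
  refine ⟨(fun x : frontier Ω => coordCylinder x.1 (e x) (r x) (h x)) '' t,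
    t.finite_toSet.image _, ?_, ?_⟩
  · rintro _ ⟨x, -, rfl⟩
    exact ⟨_, _, _, _, _, _, hc x, rfl⟩
  · rw [sUnion_image]
    simpa using ht

theorem IsBoundedLipschitzDomain.isFiniteMeasure_surfaceMeasure (hΩ : IsBoundedLipschitzDomain Ω) :
    IsFiniteMeasure (surfaceMeasure Ω) := by
  obtain ⟨𝓤, hfin, hU, hcov⟩ := hΩ.exists_finite_cover
  refine ⟨?_⟩
  have h1 : surfaceMeasure Ω univ ≤ surfaceMeasure Ω (frontier Ω) := by
    rw [← union_compl_self (frontier Ω)]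
    exact (measure_union_le _ _).trans (by rw [surfaceMeasure_compl_frontier, add_zero])
  rw [sUnion_eq_biUnion] at hcov
  refine lt_of_le_of_lt (h1.trans (measure_mono hcov)) (measure_biUnion_lt_top hfin fun U hUm => ?_)
  obtain ⟨x, e, a, K, r, h, hc, rfl⟩ := hU U hUm
  exact hc.surfaceMeasure_lt_top hΩ.isOpen

theorem IsBoundedLipschitzDomain.aestronglyMeasurable_outerNormal
    (hΩ : IsBoundedLipschitzDomain Ω) :
    AEStronglyMeasurable (outerNormal Ω) (surfaceMeasure Ω) := by
  obtain ⟨𝓤, hfin, hU, hcov⟩ := hΩ.exists_finite_cover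
  have : Countable 𝓤 := hfin.countable.to_subtype
  have h1 : (surfaceMeasure Ω).restrict (⋃ U : 𝓤, U.1) = surfaceMeasure Ω := by
    refine Measure.restrict_eq_self_of_ae_mem ?_
    rw [← sUnion_eq_iUnion]
    exact measure_mono_null (compl_subset_compl.2 hcov) surfaceMeasure_compl_frontier
  rw [← h1, aestronglyMeasurable_iUnion_iff]
  rintro ⟨U, hUm⟩
  obtain ⟨x, e, a, K, r, h, hc, rfl⟩ := hU U hUm
  exact hc.aestronglyMeasurable_outerNormal hΩ.isOpen

/-- A function on the boundary whose integrals against test functions supported near any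
boundary point vanish is zero almost everywhere. -/
theorem ae_surface_of_forall_nhds {p : Vec d → Prop} (h : ∀ x ∈ frontier Ω, ∃ U ∈ 𝓝 x, ∀ᵐ z ∂surfaceMeasure Ω, z ∈ U → p z) :
    ∀ᵐ z ∂surfaceMeasure Ω, p z := by
  have h1 : surfaceMeasure Ω ({z | ¬ p z} ∩ frontier Ω) = 0 := by
    refine measure_null_of_locally_null _ fun x hx => ?_
    obtain ⟨U, hU, hp⟩ := h x hx.2
    refine ⟨U ∩ ({z | ¬ p z} ∩ frontier Ω), inter_mem (mem_nhdsWithin_of_mem_nhds hU)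
      self_mem_nhdsWithin, measure_mono_null ?_ hp⟩
    rintro z ⟨hzU, hz, -⟩ h2
    exact hz (h2 hzU)
  refine measure_mono_null (fun z hz => ?_) (measure_union_null h1 surfaceMeasure_compl_frontier)
  by_cases hzf : z ∈ frontier Ω
  exacts [Or.inl ⟨hz, hzf⟩, Or.inr hzf]

theorem IsBoundedLipschitzDomain.ae_norm_outerNormal (hΩ : IsBoundedLipschitzDomain Ω) :
    ∀ᵐ z ∂surfaceMeasure Ω, ‖outerNormal Ω z‖ = 1 := by
  refine ae_surface_of_forall_nhds fun x hx => ?_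
  obtain ⟨e, a, K, r, h, hc⟩ := hΩ.exists_chart hx
  have ho := isOpen_coordCylinder hc.norm_e x r h
  exact ⟨_, ho.mem_nhds hc.mem_cylinder,
    (ae_restrict_iff' ho.measurableSet).1 (hc.ae_norm_outerNormal hΩ.isOpen)⟩

end Surface

end Bifluid

namespace Bifluid

open Module

/-! ### `C¹` extension across the faces of a strip -/

section Reflection

/-- The map `(s, θ) ↦ (s, c + m (θ - c))`. -/
def stretch (c m : ℝ) (p : ℝ × ℝ) : ℝ × ℝ := (p.1, c + m * (p.2 - c))

/-- The linear part of `stretch`. -/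
noncomputable def stretchL (m : ℝ) : ℝ × ℝ →L[ℝ] ℝ × ℝ :=
  (ContinuousLinearMap.fst ℝ ℝ ℝ).prod (m • ContinuousLinearMap.snd ℝ ℝ ℝ)

theorem hasFDerivAt_stretch (c m : ℝ) (p : ℝ × ℝ) : HasFDerivAt (stretch c m) (stretchL m) p :=
  hasFDerivAt_fst.prodMk (((hasFDerivAt_snd.sub_const c).const_mul m).const_add c)

theorem continuous_stretch (c m : ℝ) : Continuous (stretch c m) := by
  unfold stretch; fun_prop

theorem stretch_of_snd_eq {c m : ℝ} {p : ℝ × ℝ} (hp : p.2 = c) : stretch c m p = p := by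
  rw [stretch, hp]; ext <;> simp [hp]

/-- With the weights 2 and -1, the reflected function has the same full derivative as `f` on the
face `θ = c`. This is what makes the glued function `C¹`. -/
theorem two_smul_stretchL_sub (A : ℝ × ℝ →L[ℝ] ℝ) :
    (2 : ℝ) • A.comp (stretchL 0) - A.comp (stretchL (-1)) = A := by
  refine ContinuousLinearMap.ext fun v => ?_
  have h1 : (2 : ℝ) • stretchL 0 v - stretchL (-1) v = v := by
    ext <;> simp [stretchL]; ring
  conv_rhs => rw [← h1, map_sub, map_smul]
  rfl

/-- Extension by odd reflection across `θ = c`. -/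
noncomputable def oddReflection (c : ℝ) (f : ℝ × ℝ → ℝ) (p : ℝ × ℝ) : ℝ :=
  2 * f (stretch c 0 p) - f (stretch c (-1) p)

theorem oddReflection_of_snd_eq {c : ℝ} (f : ℝ × ℝ → ℝ) {p : ℝ × ℝ} (hp : p.2 = c) :
    oddReflection c f p = f p := by
  rw [oddReflection, stretch_of_snd_eq hp, stretch_of_snd_eq hp]; ring

/-- Gluing of derivatives along a finite closed cover. -/
theorem contDiffOn_one_of_closed_cover {E : Type*} [NormedAddCommGroup E] [NormedSpace ℝ E]
    {V : Set E} (hV : IsOpen V) {A : Fin 3 → Set E} (hA : ∀ i, IsClosed (A i)) (hcov : V ⊆ ⋃ i, A i)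
    {g : E → ℝ} {g' : E → E →L[ℝ] ℝ}
    (hd : ∀ i, ∀ p ∈ V ∩ A i, HasFDerivWithinAt g (g' p) (V ∩ A i) p)
    (hc : ∀ i, ContinuousOn g' (V ∩ A i)) : ContDiffOn ℝ 1 g V := by
  have hVu : V = (V ∩ A 0 ∪ V ∩ A 1) ∪ V ∩ A 2 := by
    ext p
    constructor
    · intro hp
      obtain ⟨i, hi⟩ := mem_iUnion.1 (hcov hp)
      fin_cases i
      exacts [Or.inl (Or.inl ⟨hp, hi⟩), Or.inl (Or.inr ⟨hp, hi⟩), Or.inr ⟨hp, hi⟩]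
    · rintro ((h | h) | h) <;> exact h.1
  have hcl : ∀ i p, p ∉ A i → p ∉ closure (V ∩ A i) := fun i p hp h =>
    hp ((hA i).closure_subset_iff.2 inter_subset_right h)
  -- A piece whose closure misses `p` imposes no condition, so derivatives within the three pieces
  -- combine to a derivative within their union `V`.
  have hd' : ∀ i, ∀ p ∈ V, HasFDerivWithinAt g (g' p) (V ∩ A i) p := fun i p hp => by
    by_cases h : p ∈ A i
    · exact hd i p ⟨hp, h⟩
    · exact HasFDerivWithinAt.of_notMem_closure (hcl i p h)
  have hc' : ∀ i, ∀ p ∈ V, ContinuousWithinAt g' (V ∩ A i) p := fun i p hp => by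
    by_cases h : p ∈ A i
    · exact hc i p ⟨hp, h⟩
    · exact continuousWithinAt_of_notMem_closure (hcl i p h)
  have hD : ∀ p ∈ V, HasFDerivAt g (g' p) p := fun p hp => by
    have := ((hd' 0 p hp).union (hd' 1 p hp)).union (hd' 2 p hp)
    rw [← hVu] at this
    exact this.hasFDerivAt (hV.mem_nhds hp)
  have hC : ContinuousOn g' V := fun p hp => by
    have := ((hc' 0 p hp).union (hc' 1 p hp)).union (hc' 2 p hp)
    rwa [← hVu] at this
  have h0 : ContDiffOn ℝ (0 + 1) g V := (contDiffOn_succ_iff_fderiv_of_isOpen hV).2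
    ⟨fun p hp => (hD p hp).differentiableAt.differentiableWithinAt, by simp,
      contDiffOn_zero.2 (hC.congr fun p hp => (hD p hp).fderiv)⟩
  simpa using h0

/-- A function which is `C¹` on a strip up to the boundary extends to a `C¹` function on a larger open
strip. -/
theorem exists_contDiffOn_strip {f : ℝ × ℝ → ℝ} {U : Set ℝ} (hU : IsOpen U) {a b : ℝ} (hab : a < b)
    (hf : ContDiffOn ℝ 1 f (U ×ˢ Icc a b)) :
    ∃ g : ℝ × ℝ → ℝ, ContDiffOn ℝ 1 g (U ×ˢ Ioo (a - (b - a)) (b + (b - a))) ∧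
      EqOn g f (U ×ˢ Icc a b) := by
  set S := U ×ˢ Icc a b
  have hS : UniqueDiffOn ℝ S := hU.uniqueDiffOn.prod (uniqueDiffOn_Icc hab)
  set f' : ℝ × ℝ → (ℝ × ℝ →L[ℝ] ℝ) := fderivWithin ℝ f S
  have hfd : ∀ p ∈ S, HasFDerivWithinAt f (f' p) S p := fun p hp =>
    (hf.differentiableOn one_ne_zero p hp).hasFDerivWithinAt
  have hfc : ContinuousOn f' S := hf.continuousOn_fderivWithin hS le_rfl
  -- Reflection in an endpoint maps an added strip of width `b - a` back into `[a, b]`, so the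
  -- extension cannot go further than this.
  set V := U ×ˢ Ioo (a - (b - a)) (b + (b - a))
  let Rf' : ℝ → ℝ × ℝ → (ℝ × ℝ →L[ℝ] ℝ) := fun c p =>
    (2 : ℝ) • (f' (stretch c 0 p)).comp (stretchL 0) - (f' (stretch c (-1) p)).comp (stretchL (-1))
  have hR : ∀ (c : ℝ) (B : Set (ℝ × ℝ)), MapsTo (stretch c 0) B S → MapsTo (stretch c (-1)) B S →
      (∀ p ∈ B, HasFDerivWithinAt (oddReflection c f) (Rf' c p) B p) ∧
      ContinuousOn (Rf' c) B := fun c B h1 h2 => by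
    refine ⟨fun p hp => ?_, ?_⟩
    · exact (((hfd _ (h1 hp)).comp p (hasFDerivAt_stretch c 0 p).hasFDerivWithinAt h1).const_mul 2).sub
        ((hfd _ (h2 hp)).comp p (hasFDerivAt_stretch c (-1) p).hasFDerivWithinAt h2)
    · refine ContinuousOn.sub ?_ ?_
      · exact ((hfc.comp (continuous_stretch c 0).continuousOn h1).clm_comp
          continuousOn_const).const_smul (2 : ℝ)
      · exact (hfc.comp (continuous_stretch c (-1)).continuousOn h2).clm_comp continuousOn_const
  have hReq : ∀ c p, p.2 = c → Rf' c p = f' p := fun c p hp => by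
    simp only [Rf', stretch_of_snd_eq hp, two_smul_stretchL_sub]
  let g : ℝ × ℝ → ℝ := fun p =>
    if p.2 < a then oddReflection a f p else if p.2 ≤ b then f p else oddReflection b f p
  let g' : ℝ × ℝ → (ℝ × ℝ →L[ℝ] ℝ) := fun p =>
    if p.2 < a then Rf' a p else if p.2 ≤ b then f' p else Rf' b p
  let A : Fin 3 → Set (ℝ × ℝ) := ![{p | p.2 ≤ a}, {p | a ≤ p.2 ∧ p.2 ≤ b}, {p | b ≤ p.2}]
  have hA2 : V ∩ A 1 ⊆ S := fun p hp => ⟨hp.1.1, hp.2⟩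
  have ha1 : MapsTo (stretch a 0) (V ∩ A 0) S := fun p hp =>
    ⟨hp.1.1, by simp [stretch], by simp [stretch, hab.le]⟩
  have ha2 : MapsTo (stretch a (-1)) (V ∩ A 0) S := fun p hp => by
    have h1 : p.2 ≤ a := hp.2
    have h2 := hp.1.2.1
    exact ⟨hp.1.1, by simp only [stretch]; linarith, by simp only [stretch]; linarith⟩
  have hb1 : MapsTo (stretch b 0) (V ∩ A 2) S := fun p hp =>
    ⟨hp.1.1, by simp [stretch, hab.le], by simp [stretch]⟩
  have hb2 : MapsTo (stretch b (-1)) (V ∩ A 2) S := fun p hp => by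
    have h1 : b ≤ p.2 := hp.2
    have h2 := hp.1.2.2
    exact ⟨hp.1.1, by simp only [stretch]; linarith, by simp only [stretch]; linarith⟩
  have hg0 : ∀ p ∈ V ∩ A 0, g p = oddReflection a f p ∧ g' p = Rf' a p := fun p hp => by
    have h1 : p.2 ≤ a := hp.2
    rcases h1.lt_or_eq with h | h
    · simp [g, g', h]
    · have h2 : ¬ p.2 < a := h.not_lt
      have h3 : p.2 ≤ b := by linarith
      simp only [g, g', if_neg h2, if_pos h3, oddReflection_of_snd_eq f h, hReq a p h, and_self]
  have hg1 : ∀ p ∈ V ∩ A 1, g p = f p ∧ g' p = f' p := fun p hp => by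
    have h1 : a ≤ p.2 ∧ p.2 ≤ b := hp.2
    simp only [g, g', if_neg (not_lt.2 h1.1), if_pos h1.2, and_self]
  have hg2 : ∀ p ∈ V ∩ A 2, g p = oddReflection b f p ∧ g' p = Rf' b p := fun p hp => by
    have h1 : b ≤ p.2 := hp.2
    have h2 : ¬ p.2 < a := by linarith
    rcases h1.lt_or_eq with h | h
    · simp only [g, g', if_neg h2, if_neg (not_le.2 h), and_self]
    · simp only [g, g', if_neg h2, if_pos h.ge, oddReflection_of_snd_eq f h.symm, hReq b p h.symm,
        and_self]
  refine ⟨g, contDiffOn_one_of_closed_cover (g' := g') (A := A) (hU.prod isOpen_Ioo) ?_ ?_ ?_ ?_, ?_⟩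
  · intro i
    fin_cases i
    · exact isClosed_le continuous_snd continuous_const
    · exact (isClosed_le continuous_const continuous_snd).inter
        (isClosed_le continuous_snd continuous_const)
    · exact isClosed_le continuous_const continuous_snd
  · intro p _
    rcases le_total p.2 a with h | h
    · exact mem_iUnion.2 ⟨0, h⟩
    · rcases le_total p.2 b with h' | h'
      · exact mem_iUnion.2 ⟨1, h, h'⟩
      · exact mem_iUnion.2 ⟨2, h'⟩
  · intro i
    fin_cases i <;> intro p hp
    · change HasFDerivWithinAt g (g' p) (V ∩ A 0) p
      rw [(hg0 p hp).2]
      exact ((hR a _ ha1 ha2).1 p hp).congr (fun q hq => (hg0 q hq).1) (hg0 p hp).1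
    · change HasFDerivWithinAt g (g' p) (V ∩ A 1) p
      rw [(hg1 p hp).2]
      exact ((hfd p (hA2 hp)).mono hA2).congr (fun q hq => (hg1 q hq).1) (hg1 p hp).1
    · change HasFDerivWithinAt g (g' p) (V ∩ A 2) p
      rw [(hg2 p hp).2]
      exact ((hR b _ hb1 hb2).1 p hp).congr (fun q hq => (hg2 q hq).1) (hg2 p hp).1
  · intro i
    fin_cases i
    · exact (hR a _ ha1 ha2).2.congr fun q hq => (hg0 q hq).2
    · exact (hfc.mono hA2).congr fun q hq => (hg1 q hq).2
    · exact (hR b _ hb1 hb2).2.congr fun q hq => (hg2 q hq).2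
  · intro p hp
    have h1 : ¬ p.2 < a := not_lt.2 hp.2.1
    simp only [g, if_neg h1, if_pos hp.2.2]

/-- A function which is `C¹` on a strip up to the boundary agrees on compact rectangles with a
globally `C¹` function. -/
theorem exists_contDiff_eqOn_rectangle {f : ℝ × ℝ → ℝ} {U : Set ℝ} (hU : IsOpen U) {a b : ℝ}
    (hab : a < b) (hf : ContDiffOn ℝ 1 f (U ×ˢ Icc a b)) {K : Set ℝ} (hK : IsCompact K)
    (hKU : K ⊆ U) : ∃ g : ℝ × ℝ → ℝ, ContDiff ℝ 1 g ∧ EqOn g f (K ×ˢ Icc a b) := by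
  obtain ⟨g, hg, hgf⟩ := exists_contDiffOn_strip hU hab hf
  obtain ⟨k, hk, hkg⟩ := exists_contDiff_eqOn_of_isCompact (hU.prod isOpen_Ioo)
    (hK.prod (isCompact_Icc (a := a) (b := b)))
    (Set.prod_mono hKU (Icc_subset_Ioo (by linarith) (by linarith))) hg
  exact ⟨k, hk, fun p hp => ((hkg p hp).eq_of_nhds).trans (hgf ⟨hKU hp.1, hp.2⟩)⟩

end Reflection

/-! ### Distributional and pointwise divergence -/

section PointwiseDivergence

variable {d : ℕ}

theorem integral_fderiv_of_hasCompactSupport {f : Vec d → ℝ} (hf : ContDiff ℝ 1 f)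
    (hc : HasCompactSupport f) (w : Vec d) : ∫ x, fderiv ℝ f x w = 0 := by
  obtain ⟨C, hC⟩ := ContDiff.lipschitzWith_of_hasCompactSupport hc hf one_ne_zero
  exact (integral_fderiv_eq_zero_of_lipschitz volume hC hc w).2

theorem eq_sum_smul_basisVec (v : Vec d) : v = ∑ j, v j • basisVec j := by
  have := (EuclideanSpace.basisFun (Fin d) ℝ).sum_repr v
  simpa [basisVec] using this.symm

theorem map_eq_sum_basisVec {F : Type*} [NormedAddCommGroup F] [NormedSpace ℝ F]
    (L : Vec d →L[ℝ] F) (v : Vec d) : L v = ∑ j, v j • L (basisVec j) := by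
  conv_lhs => rw [eq_sum_smul_basisVec v]
  simp

theorem fderiv_apply_coord {E : Type*} [NormedAddCommGroup E] [NormedSpace ℝ E] {V : E → Vec d}
    {x : E} (hV : DifferentiableAt ℝ V x) (j : Fin d) (w : E) :
    fderiv ℝ (fun y => V y j) x w = fderiv ℝ V x w j := by
  have h := ((EuclideanSpace.proj j : Vec d →L[ℝ] ℝ).hasFDerivAt (x := V x)).comp x hV.hasFDerivAt
  have h2 : HasFDerivAt (fun y => V y j) ((EuclideanSpace.proj j : Vec d →L[ℝ] ℝ).comp
    (fderiv ℝ V x)) x := h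
  rw [h2.fderiv]
  rfl

theorem contDiff_coord {E : Type*} [NormedAddCommGroup E] [NormedSpace ℝ E] {V : E → Vec d}
    {n : WithTop ℕ∞} (hV : ContDiff ℝ n V) (j : Fin d) : ContDiff ℝ n (fun y => V y j) :=
  (EuclideanSpace.proj j : Vec d →L[ℝ] ℝ).contDiff.comp hV

theorem divergence_eq_sum {V : Vec d → Vec d} {x : Vec d} :
    divergence V x = ∑ j, fderiv ℝ V x (basisVec j) j := rfl

theorem integral_fderiv_apply {ψ : Vec d → ℝ} (hψ : ContDiff ℝ 1 ψ) (hc : HasCompactSupport ψ)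
    {V : Vec d → Vec d} (hV : ContDiff ℝ 1 V) :
    ∫ x, fderiv ℝ ψ x (V x) = - ∫ x, ψ x * divergence V x := by
  have hψd : ∀ x, DifferentiableAt ℝ ψ x := hψ.differentiable one_ne_zero
  have hVd : ∀ x, DifferentiableAt ℝ V x := hV.differentiable one_ne_zero
  have hVj := contDiff_coord hV
  have hc1 : Continuous fun x => fderiv ℝ ψ x := hψ.continuous_fderiv one_ne_zero
  have hc2 : Continuous fun x => fderiv ℝ V x := hV.continuous_fderiv one_ne_zero
  have hI1 : ∀ j, Integrable fun x => V x j * fderiv ℝ ψ x (basisVec j) := fun j =>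
    Continuous.integrable_of_hasCompactSupport
      ((hVj j).continuous.mul (hc1.clm_apply continuous_const))
      ((hc.fderiv_apply (𝕜 := ℝ) (basisVec j)).mul_left)
  have hI2 : ∀ j, Integrable fun x => ψ x * fderiv ℝ V x (basisVec j) j := fun j =>
    Continuous.integrable_of_hasCompactSupport
      (hψ.continuous.mul ((EuclideanSpace.proj j : Vec d →L[ℝ] ℝ).continuous.comp
        (hc2.clm_apply continuous_const))) hc.mul_right
  have hj : ∀ j, ∫ x, V x j * fderiv ℝ ψ x (basisVec j)
      = - ∫ x, ψ x * fderiv ℝ V x (basisVec j) j := fun j => by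
    have h0 := integral_fderiv_of_hasCompactSupport (hψ.mul (hVj j)) hc.mul_right (basisVec j)
    have h1 : ∀ x, fderiv ℝ (ψ * fun y => V y j) x (basisVec j)
        = ψ x * fderiv ℝ V x (basisVec j) j + V x j * fderiv ℝ ψ x (basisVec j) := fun x => by
      have h := (hψd x).hasFDerivAt.mul ((hVj j).differentiable one_ne_zero x).hasFDerivAt
      rw [h.fderiv]
      simp [fderiv_apply_coord (hVd x) j (basisVec j)]
    have h2 : ∫ x, (ψ x * fderiv ℝ V x (basisVec j) j + V x j * fderiv ℝ ψ x (basisVec j)) = 0 := by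
      rw [← h0]; exact integral_congr_ae (ae_of_all _ fun x => (h1 x).symm)
    rw [integral_add (hI2 j) (hI1 j)] at h2
    linarith
  calc ∫ x, fderiv ℝ ψ x (V x) = ∫ x, ∑ j, V x j * fderiv ℝ ψ x (basisVec j) := by
        congr 1; ext x; rw [map_eq_sum_basisVec]; rfl
    _ = ∑ j, - ∫ x, ψ x * fderiv ℝ V x (basisVec j) j := by
        rw [integral_finsetSum _ fun j _ => hI1 j]; simp_rw [hj]
    _ = - ∫ x, ψ x * divergence V x := by
        rw [Finset.sum_neg_distrib, ← integral_finsetSum _ fun j _ => hI2 j]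
        simp_rw [divergence_eq_sum, Finset.mul_sum]

/-- A distributional divergence which is continuous agrees with the pointwise one where the field is
differentiable. -/
theorem eq_divergence_of_distributional {U : Set (Vec d)} (hU : IsOpen U) {f : Vec d → ℝ}
    {W : Vec d → Vec d} (hf : Continuous f) (hW : Continuous W)
    (h : ∀ ψ : Vec d → ℝ, ContDiff ℝ ∞ ψ → HasCompactSupport ψ → tsupport ψ ⊆ U →
      ∫ x, f x * ψ x = - ∫ x, fderiv ℝ ψ x (W x)) {x₀ : Vec d} (hx : x₀ ∈ U)
    (hd : DifferentiableAt ℝ W x₀) : f x₀ = divergence W x₀ := by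
  -- The identity is tested with bumps concentrated at `x₀` on the scale `ε` and rescaled to unit
  -- size, and then `ε → 0`.
  let η : ContDiffBump (0 : Vec d) := ⟨1, 2, one_pos, one_lt_two⟩
  have hη : ContDiff ℝ ∞ η := η.contDiff
  have hη1 : ContDiff ℝ 1 η := η.contDiff
  have hηd : Differentiable ℝ η := hη1.differentiable one_ne_zero
  have hηc : Continuous fun x => fderiv ℝ η x := hη1.continuous_fderiv one_ne_zero
  have hsupp : ∀ y : Vec d, 2 < ‖y‖ → η y = 0 ∧ fderiv ℝ η y = 0 := fun y hy => by
    have h0 : y ∉ tsupport η := by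
      rw [η.tsupport_eq]; simpa using hy
    exact ⟨image_eq_zero_of_notMem_tsupport h0,
      image_eq_zero_of_notMem_tsupport fun h1 => h0 (tsupport_fderiv_subset ℝ h1)⟩
  set A := fderiv ℝ W x₀
  obtain ⟨ρ, hρ, hball⟩ : ∃ ρ > 0, Metric.closedBall x₀ ρ ⊆ U :=
    Metric.nhds_basis_closedBall.mem_iff.1 (hU.mem_nhds hx)
  -- the scaled identity
  have hscale : ∀ ε : ℝ, 0 < ε → 2 * ε ≤ ρ →
      ∫ y, f (x₀ + ε • y) * η y
        = - ∫ y, fderiv ℝ η y (ε⁻¹ • (W (x₀ + ε • y) - W x₀)) := fun ε hε hερ => by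
    let L : Vec d → Vec d := fun x => ε⁻¹ • (x - x₀)
    have hL : ContDiff ℝ ∞ L := (contDiff_id.sub contDiff_const).const_smul _
    have hLd : ∀ x, HasFDerivAt L (ε⁻¹ • ContinuousLinearMap.id ℝ (Vec d)) x := fun x =>
      ((hasFDerivAt_id x).sub_const x₀).const_smul ε⁻¹
    have hLy : ∀ y, L (x₀ + ε • y) = y := fun y => by
      simp [L, smul_smul, inv_mul_cancel₀ hε.ne']
    have hts : tsupport (η ∘ L) ⊆ Metric.closedBall x₀ ρ := by
      refine closure_minimal (fun x hx => ?_) Metric.isClosed_closedBall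
      by_contra hcon
      refine hx (hsupp (L x) ?_).1
      rw [mem_closedBall_iff_norm, not_le] at hcon
      rw [norm_smul, norm_inv, Real.norm_of_nonneg hε.le, lt_inv_mul_iff₀ hε]
      linarith
    have hcs : HasCompactSupport (η ∘ L) :=
      HasCompactSupport.of_support_subset_isCompact (isCompact_closedBall x₀ ρ)
        ((subset_tsupport _).trans hts)
    have h1 := h (η ∘ L) (hη.comp hL) hcs (hts.trans hball)
    have hfd : ∀ x, fderiv ℝ (η ∘ L) x = ε⁻¹ • fderiv ℝ η (L x) := fun x => by
      have := ((hηd (L x)).hasFDerivAt.comp x (hLd x)).fderiv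
      rw [this]; ext v; simp
    -- A constant field pairs to zero with the derivative of a compactly supported function, so `W
    -- x₀` may be subtracted. This produces difference quotients after rescaling.
    have h0 := integral_fderiv_of_hasCompactSupport (hη1.comp (hL.of_le (by simp))) hcs (W x₀)
    have cv : ∀ F : Vec d → ℝ, ∫ x, F x = |ε ^ finrank ℝ (Vec d)| * ∫ y, F (x₀ + ε • y) := fun F => by
      have e1 := Measure.integral_comp_smul volume (fun z => F (x₀ + z)) ε
      rw [integral_add_left_eq_self (μ := volume) F x₀] at e1
      rw [e1, smul_eq_mul, ← mul_assoc, ← abs_mul, mul_inv_cancel₀ (pow_ne_zero _ hε.ne'), abs_one,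
        one_mul]
    have hcd : Continuous fun x => fderiv ℝ (η ∘ L) x :=
      (hη1.comp (hL.of_le (by simp))).continuous_fderiv one_ne_zero
    have hint : ∀ V : Vec d → Vec d, Continuous V →
        Integrable fun x => fderiv ℝ (η ∘ L) x (V x) := fun V hV =>
      Continuous.integrable_of_hasCompactSupport (hcd.clm_apply hV)
        ((hcs.fderiv ℝ).mono fun x hx h2 => hx (by simp [h2]))
    have h2 : ∫ x, f x * (η ∘ L) x = - ∫ x, fderiv ℝ (η ∘ L) x (W x - W x₀) := by
      rw [h1]
      simp_rw [map_sub]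
      rw [integral_sub (hint W hW) (hint _ continuous_const), h0, sub_zero]
    rw [cv, cv (fun x => fderiv ℝ (η ∘ L) x (W x - W x₀)), ← mul_neg] at h2
    have h3 := mul_left_cancel₀ (abs_ne_zero.2 (pow_ne_zero _ hε.ne')) h2
    simp_rw [hfd, Function.comp_apply, hLy] at h3
    rw [h3]
    congr 2; ext y; simp
  have hpos : 0 < ∫ y, η y := η.integral_pos
  have hlim1 : Tendsto (fun ε : ℝ => ∫ y, f (x₀ + ε • y) * η y) (𝓝[>] 0)
      (𝓝 (∫ y, f x₀ * η y)) := by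
    obtain ⟨C, hC⟩ := (isCompact_closedBall x₀ 2).exists_bound_of_continuousOn hf.continuousOn
    refine tendsto_integral_filter_of_dominated_convergence (fun y => C * η y) ?_ ?_ ?_ ?_
    · exact Eventually.of_forall fun ε => (by fun_prop : Continuous fun y =>
        f (x₀ + ε • y)).mul η.continuous |>.aestronglyMeasurable
    · filter_upwards [Ioc_mem_nhdsGT (zero_lt_one' ℝ)] with ε hε
      refine ae_of_all _ fun y => ?_
      rw [norm_mul, Real.norm_of_nonneg η.nonneg]
      rcases le_or_gt ‖y‖ 2 with hy | hy
      · refine mul_le_mul_of_nonneg_right (hC _ ?_) η.nonneg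
        rw [mem_closedBall_iff_norm, add_sub_cancel_left, norm_smul, Real.norm_of_nonneg hε.1.le]
        nlinarith [hε.1, hε.2, norm_nonneg y]
      · simp [(hsupp y hy).1]
    · exact η.integrable.const_mul C
    · refine ae_of_all _ fun y => ?_
      have : Continuous fun ε : ℝ => f (x₀ + ε • y) * η y := by fun_prop
      have h2 := (this.tendsto 0).mono_left (nhdsWithin_le_nhds (s := Ioi 0))
      simpa using h2
  -- Differentiability at the single point `x₀` gives both the pointwise limit `A y` of the
  -- difference quotients and their bound on the support of `η`. This is enough for dominated
  -- convergence.
  have hlim2 : Tendsto (fun ε : ℝ => ∫ y, fderiv ℝ η y (ε⁻¹ • (W (x₀ + ε • y) - W x₀))) (𝓝[>] 0)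
      (𝓝 (∫ y, fderiv ℝ η y (A y))) := by
    obtain ⟨C, hC⟩ : ∃ C : ℝ, ∀ᶠ x in 𝓝 x₀, ‖W x - W x₀‖ ≤ C * ‖x - x₀‖ :=
      hd.hasFDerivAt.isBigO_sub.bound
    obtain ⟨σ, hσ, hσC⟩ := Metric.eventually_nhds_iff_ball.1 hC
    have hC0 : 0 ≤ |C| := abs_nonneg C
    refine tendsto_integral_filter_of_dominated_convergence
      (fun y => ‖fderiv ℝ η y‖ * (|C| * 2)) ?_ ?_ ?_ ?_
    · refine Eventually.of_forall fun ε => Continuous.aestronglyMeasurable ?_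
      exact hηc.clm_apply (by fun_prop)
    · filter_upwards [Ioo_mem_nhdsGT (show (0 : ℝ) < σ / 3 by positivity)] with ε hε
      refine ae_of_all _ fun y => ?_
      rcases le_or_gt ‖y‖ 2 with hy | hy
      · refine (ContinuousLinearMap.le_opNorm _ _).trans
          (mul_le_mul_of_nonneg_left ?_ (norm_nonneg _))
        have hn : ‖x₀ + ε • y - x₀‖ = ε * ‖y‖ := by
          rw [add_sub_cancel_left, norm_smul, Real.norm_of_nonneg hε.1.le]
        have h3 := hσC (x₀ + ε • y) (by
          rw [mem_ball_iff_norm, hn]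
          nlinarith [hε.1, hε.2, norm_nonneg y])
        rw [hn] at h3
        rw [norm_smul, norm_inv, Real.norm_of_nonneg hε.1.le, inv_mul_le_iff₀ hε.1]
        refine h3.trans ?_
        have h4 : C * (ε * ‖y‖) ≤ |C| * (ε * 2) :=
          mul_le_mul (le_abs_self C) (mul_le_mul_of_nonneg_left hy hε.1.le)
            (mul_nonneg hε.1.le (norm_nonneg y)) hC0
        linarith
      · simp [(hsupp y hy).2]
    · exact (Continuous.integrable_of_hasCompactSupport hηc.norm
        ((η.hasCompactSupport.fderiv ℝ).norm)).mul_const _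
    · refine ae_of_all _ fun y => ?_
      have h5 : HasDerivAt (fun ε : ℝ => W (x₀ + ε • y)) (A y) 0 := by
        have h6 : HasDerivAt (fun ε : ℝ => x₀ + ε • y) y 0 := by
          simpa using ((hasDerivAt_id (0 : ℝ)).smul_const y).const_add x₀
        have h7 : HasFDerivAt W A (x₀ + (0 : ℝ) • y) := by simpa using hd.hasFDerivAt
        exact h7.comp_hasDerivAt 0 h6
      have h8 := h5.tendsto_slope_zero_right
      simp only [zero_add, zero_smul, add_zero] at h8
      exact ((fderiv ℝ η y).continuous.tendsto _).comp h8
  -- In the limit `W` is replaced by its linear part `A`, which is smooth with constant divergence.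
  -- The integration by parts is then legitimate, and the positive mass of `η` cancels.
  have heq : ∫ y, f x₀ * η y = - ∫ y, fderiv ℝ η y (A y) := by
    refine tendsto_nhds_unique hlim1 (hlim2.neg.congr' ?_)
    filter_upwards [Ioc_mem_nhdsGT (show (0 : ℝ) < ρ / 2 by positivity)] with ε hε
    exact (hscale ε hε.1 (by linarith [hε.2])).symm
  rw [integral_fderiv_apply hη1 η.hasCompactSupport A.contDiff, neg_neg, integral_const_mul] at heq
  have hA : ∀ y, divergence A y = divergence W x₀ := fun y => by
    rw [divergence, divergence, A.fderiv]
  simp_rw [hA] at heq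
  rw [integral_mul_const, mul_comm] at heq
  exact mul_left_cancel₀ hpos.ne' heq

end PointwiseDivergence

end Bifluid

namespace Bifluid

open Module

/-! ### Pressure and Helmholtz function along `C¹` densities -/

section Thermodynamics

variable {b₁ b₂ : ℝ}

theorem closure_stateCone_subset {q : ℝ × ℝ} (hq : q ∈ closure (stateCone b₁ b₂)) :
    b₁ * q.1 ≤ q.2 ∧ q.2 ≤ b₂ * q.1 := by
  have hc : IsClosed {q : ℝ × ℝ | b₁ * q.1 ≤ q.2 ∧ q.2 ≤ b₂ * q.1} := by
    rw [ofPred_and]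
    exact (isClosed_le (by fun_prop) (by fun_prop)).inter (isClosed_le (by fun_prop) (by fun_prop))
  exact hc.closure_subset_iff.2 (fun p (hp : p ∈ stateCone b₁ b₂) =>
    (⟨hp.1.le, hp.2.le⟩ : b₁ * p.1 ≤ p.2 ∧ p.2 ≤ b₂ * p.1)) hq

theorem mk_mem_closure_stateCone (hb : b₁ < b₂) {s θ : ℝ} (hs : 0 < s) (hθ : θ ∈ Icc b₁ b₂) :
    (s, s * θ) ∈ closure (stateCone b₁ b₂) := by
  rw [← closure_Ioo hb.ne] at hθ
  refine map_mem_closure (f := fun θ : ℝ => (s, s * θ)) (by fun_prop) hθ fun θ' h => ?_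
  constructor
  · change b₁ * s < s * θ'
    nlinarith [h.1]
  · change s * θ' < b₂ * s
    nlinarith [h.2]

variable {X : Type*} [NormedAddCommGroup X] [NormedSpace ℝ X] [FiniteDimensional ℝ X]

/-- Globally `C¹` versions of the pressure and of `H(R,Z)/R` along `C¹` functions `R`, `Z` with values
in the closed cone of states. -/
theorem exists_contDiff_pressure_helmholtz {P : ℝ × ℝ → ℝ} (hb : b₁ < b₂) (hb₁ : 0 < b₁)
    (hP : ContDiffOn ℝ 1 P (closure (stateCone b₁ b₂))) {K : Set X} (hK : IsCompact K)
    {R Z : X → ℝ} (hR : ContDiff ℝ 1 R) (hZ : ContDiff ℝ 1 Z)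
    (hst : ∀ p ∈ K, (R p, Z p) ∈ closure (stateCone b₁ b₂)) (hpos : ∀ p ∈ K, 0 < Z p) :
    ∃ gP gq : X → ℝ, ContDiff ℝ 1 gP ∧ ContDiff ℝ 1 gq ∧ (∀ p ∈ K, gP p = P (R p, Z p)) ∧
      (∀ p ∈ K, helmholtz P (R p) (Z p) = R p * gq p) ∧
      ∀ p ∈ K, ∀ v, R p * fderiv ℝ Z p v = Z p * fderiv ℝ R p v →
        fderiv ℝ gq p v = gP p / R p ^ 2 * fderiv ℝ R p v := by
  have hRpos : ∀ p ∈ K, 0 < R p := fun p hp => by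
    have h1 := (closure_stateCone_subset (hst p hp)).2
    have h2 := hpos p hp
    have h3 : 0 < b₂ * R p := h2.trans_le h1
    exact pos_of_mul_pos_right h3 (hb₁.trans hb).le
  have hθK : ∀ p ∈ K, Z p / R p ∈ Icc b₁ b₂ := fun p hp => by
    have h1 := closure_stateCone_subset (hst p hp)
    exact ⟨(le_div_iff₀ (hRpos p hp)).2 h1.1, (div_le_iff₀ (hRpos p hp)).2 h1.2⟩
  -- In the variables `(s, θ)`, `θ = Z/R`, the closed cone without its apex becomes the half-strip
  -- `(0, ∞) × [b₁, b₂]`. The Helmholtz integrand is `C¹` on it up to the two faces, so the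
  -- reflection argument applies.
  let f : ℝ × ℝ → ℝ := fun q => P (q.1, q.1 * q.2) / q.1 ^ 2
  have hf : ContDiffOn ℝ 1 f (Ioi 0 ×ˢ Icc b₁ b₂) := by
    refine ContDiffOn.div (hP.comp (by fun_prop) fun q hq => mk_mem_closure_stateCone hb hq.1 hq.2)
      (by fun_prop) fun q hq => pow_ne_zero _ (ne_of_gt hq.1)
  -- The number 1 is inserted because the Helmholtz integral starts at `s = 1`: the interval `[α,
  -- β]` must contain every `s` between 1 and `R p`.
  obtain ⟨α, β, hα, hα1, hβ1, hαβ⟩ : ∃ α β : ℝ, 0 < α ∧ α ≤ 1 ∧ 1 ≤ β ∧ ∀ p ∈ K, R p ∈ Icc α β := by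
    have hc : IsCompact (insert 1 (R '' K)) := (hK.image hR.continuous).insert 1
    obtain ⟨α, hα, hαm⟩ := hc.exists_isLeast (insert_nonempty _ _)
    obtain ⟨β, hβ, hβm⟩ := hc.exists_isGreatest (insert_nonempty _ _)
    refine ⟨α, β, ?_, hαm (mem_insert _ _), hβm (mem_insert _ _), fun p hp =>
      ⟨hαm (mem_insert_of_mem _ ⟨p, hp, rfl⟩), hβm (mem_insert_of_mem _ ⟨p, hp, rfl⟩)⟩⟩
    rcases hα with rfl | ⟨p, hp, rfl⟩
    exacts [one_pos, hRpos p hp]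
  obtain ⟨k, hk, hkf⟩ := exists_contDiff_eqOn_rectangle isOpen_Ioi hb hf
    (isCompact_Icc (a := α) (b := β)) fun s hs => lt_of_lt_of_le hα hs.1
  -- Away from `K` the density `R` may vanish, hence the cutoff. The agreement holds on a
  -- neighbourhood of each point of `K`, so the derivatives agree there too.
  obtain ⟨θ, hθ, hθe⟩ := exists_contDiff_eqOn_of_isCompact (f := fun p => Z p / R p)
    (isOpen_lt continuous_const hR.continuous : IsOpen {p | 0 < R p}) hK (fun p hp => hRpos p hp)
    (hZ.contDiffOn.div hR.contDiffOn fun p hp => ne_of_gt hp)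
  let k2 : ℝ × ℝ → ℝ := fun q => k (q.2, q.1)
  have hk2 : ContDiff ℝ 1 k2 := hk.comp (contDiff_snd.prodMk contDiff_fst)
  let Q : ℝ × ℝ → ℝ := fun q => ∫ s in (1 : ℝ)..q.2, k2 (q.1, s)
  have hQ : ContDiff ℝ 1 Q := contDiff_parametric_primitive hk2 1
  have hθR : ContDiff ℝ 1 fun p => (θ p, R p) := hθ.prodMk hR
  have hθeq : ∀ p ∈ K, θ p = Z p / R p := fun p hp => (hθe p hp).eq_of_nhds
  have hkP : ∀ p ∈ K, R p ^ 2 * k (R p, θ p) = P (R p, Z p) := fun p hp => by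
    rw [hθeq p hp, hkf ⟨hαβ p hp, hθK p hp⟩]
    have := (hRpos p hp).ne'
    simp only [f]
    rw [mul_div_cancel₀ _ this, mul_div_cancel₀ _ (pow_ne_zero _ this)]
  refine ⟨fun p => R p ^ 2 * k (R p, θ p), fun p => Q (θ p, R p), ?_, hQ.comp hθR, hkP, ?_, ?_⟩
  · exact (hR.pow 2).mul (hk.comp (hR.prodMk hθ))
  · intro p hp
    rw [helmholtz, if_pos (hRpos p hp)]
    congr 1
    refine intervalIntegral.integral_congr fun s hs => ?_
    have hs' : s ∈ Icc α β := by
      refine ⟨le_trans ?_ hs.1, hs.2.trans ?_⟩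
      · exact le_min hα1 (hαβ p hp).1
      · exact max_le hβ1 (hαβ p hp).2
    simp only [k2]
    rw [hθeq p hp, hkf ⟨hs', hθK p hp⟩]
  · intro p hp v hv
    have hRd := (hR.differentiable one_ne_zero p).hasFDerivAt
    have hZd := (hZ.differentiable one_ne_zero p).hasFDerivAt
    have hθd := (hθ.differentiable one_ne_zero p).hasFDerivAt
    have hne := (hRpos p hp).ne'
    -- The condition on `v` says that the ratio `Z/R` is stationary along `v`. Only the upper limit
    -- of the integral then contributes to the derivative of `gq`.
    have hθ0 : fderiv ℝ θ p v = 0 := by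
      have h1 : Z =ᶠ[𝓝 p] θ * R := by
        filter_upwards [hθe p hp, (hR.continuous.continuousAt (x := p)).eventually_ne hne] with x hx hx2
        rw [Pi.mul_apply, hx, div_mul_cancel₀ _ hx2]
      have h2 := h1.fderiv_eq (𝕜 := ℝ)
      rw [(hθd.mul hRd).fderiv] at h2
      have h3 := congrArg (fun L : X →L[ℝ] ℝ => L v) h2
      simp only [add_apply, smul_apply, smul_eq_mul] at h3
      rw [h3, hθeq p hp] at hv
      field_simp at hv
      have h4 : R p ^ 2 * fderiv ℝ θ p v = 0 := by linarith
      exact (mul_eq_zero.1 h4).resolve_left (pow_ne_zero _ hne)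
    have hQd := hasFDerivAt_parametric_primitive hk2 1 (θ p, R p)
    have hd := HasFDerivAt.comp p hQd (hθd.prodMk hRd)
    have hd2 : fderiv ℝ (fun p => Q (θ p, R p)) p = _ := hd.fderiv
    rw [hd2, mul_div_cancel_left₀ _ (pow_ne_zero 2 hne)]
    simp [hθ0, k2]

end Thermodynamics

end Bifluid

namespace Bifluid

open Module

/-! ### Control of the Reynolds defect by the energy defect -/

section DefectMeasures

variable {d : ℕ}

/-- Testing the form with `e_i ± e_j` gives `2 |a i j| ≤ a i i + a j j`. Each diagonal entry is
nonnegative, hence at most the trace. -/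
theorem abs_le_trace_of_quadratic_nonneg {a : Fin d → Fin d → ℝ} (hs : ∀ i j, a i j = a j i)
    (h : ∀ ξ : Fin d → ℝ, 0 ≤ ∑ i, ∑ j, ξ i * ξ j * a i j) (i j : Fin d) :
    |a i j| ≤ ∑ k, a k k := by
  have hB : ∀ (s : ℝ), 0 ≤ a i i + s * (2 * a i j) + s ^ 2 * a j j := fun s => by
    have h1 := h (Pi.single i 1 + s • Pi.single j 1)
    have h3 : ∀ (k : Fin d) (c : Fin d → ℝ), ∑ q, (Pi.single k (1 : ℝ) : Fin d → ℝ) q * c q = c k :=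
      fun k c => by simp [Pi.single_apply]
    simp only [Pi.add_apply, Pi.smul_apply, smul_eq_mul, add_mul, mul_assoc,
      Finset.sum_add_distrib, ← Finset.mul_sum, h3, mul_add] at h1
    rw [hs j i] at h1
    linarith
  have hd : ∀ k, 0 ≤ a k k := fun k => by
    have := h (Pi.single k 1)
    simpa [Pi.single_apply] using this
  have hle : ∀ k, a k k ≤ ∑ k, a k k := fun k =>
    Finset.single_le_sum (f := fun k => a k k) (fun k _ => hd k) (Finset.mem_univ k)
  have h1 := hB 1
  have h2 := hB (-1)
  have h3 := hle i
  have h4 := hle j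
  rw [abs_le]
  constructor <;> linarith

variable {X : Type*} [MeasurableSpace X]

theorem abs_apply_le_of_defect {M : Fin d → Fin d → SignedMeasure X} {E : SignedMeasure X} {c : ℝ}
    (hs : ∀ i j, M i j = M j i) (hp : ∀ ξ : Fin d → ℝ, 0 ≤ ∑ i, ∑ j, (ξ i * ξ j) • M i j)
    (htr : ∑ i, M i i ≤ c • E) (i j : Fin d) {B : Set X} (hB : MeasurableSet B) :
    |M i j B| ≤ c * E B := by
  have h1 := abs_le_trace_of_quadratic_nonneg (a := fun i j => M i j B)
    (fun i j => by rw [hs i j]) (fun ξ => by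
      have := hp ξ B hB
      simpa [FunLike.coe_sum, Finset.sum_apply] using this) i j
  have h2 := htr B hB
  simp only [FunLike.coe_sum, Finset.sum_apply, FunLike.coe_smul, Pi.smul_apply,
    smul_eq_mul] at h2
  exact h1.trans h2

/-- The bound `|M i j B| ≤ c * E B` on every measurable set makes the positive measure `c E` a
majorant of the variation. -/
theorem variation_univ_le_of_defect {M : Fin d → Fin d → SignedMeasure X} {E : SignedMeasure X}
    {c : ℝ} (hc : 0 ≤ c) (hE : 0 ≤ E) (hs : ∀ i j, M i j = M j i)
    (hp : ∀ ξ : Fin d → ℝ, 0 ≤ ∑ i, ∑ j, (ξ i * ξ j) • M i j)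
    (htr : ∑ i, M i i ≤ c • E) (i j : Fin d) :
    (M i j).variation univ ≤ ENNReal.ofReal (c * E univ) := by
  have hE' : 0 ≤[univ] E := by rwa [VectorMeasure.restrict_univ, VectorMeasure.restrict_univ]
  have hν : ∀ B, MeasurableSet B →
      SignedMeasure.toMeasureOfZeroLE E univ MeasurableSet.univ hE' B = ENNReal.ofReal (E B) :=
    fun B hB => by
      rw [SignedMeasure.toMeasureOfZeroLE_apply _ _ _ hB]
      simp only [univ_inter]
      rw [ENNReal.ofReal, Real.toNNReal_of_nonneg (hE B hB)]
  have h := VectorMeasure.variation_le_of_forall_enorm_le (μ := M i j)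
    (m := ENNReal.ofReal c • SignedMeasure.toMeasureOfZeroLE E univ MeasurableSet.univ hE')
    fun B hB => by
      rw [Measure.smul_apply, hν B hB, smul_eq_mul, ← ENNReal.ofReal_mul hc,
        Real.enorm_eq_ofReal_abs]
      exact ENNReal.ofReal_le_ofReal (abs_apply_le_of_defect hs hp htr i j hB)
  refine (h univ).trans_eq ?_
  rw [Measure.smul_apply, hν _ MeasurableSet.univ, smul_eq_mul, ENNReal.ofReal_mul hc]

theorem eq_zero_of_nonneg_of_univ {E : SignedMeasure X} (hE : 0 ≤ E) (h0 : E univ ≤ 0) : E = 0 := by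
  refine VectorMeasure.ext fun B hB => ?_
  have h1 := VectorMeasure.of_add_of_sdiff (v := E) hB MeasurableSet.univ (subset_univ B)
  have h2 := hE B hB
  have h3 := hE (univ \ B) (MeasurableSet.univ.diff hB)
  simp only [FunLike.coe_zero, Pi.zero_apply] at *
  linarith

theorem eq_zero_of_defect {M : Fin d → Fin d → SignedMeasure X} {E : SignedMeasure X} {c : ℝ}
    (hs : ∀ i j, M i j = M j i) (hp : ∀ ξ : Fin d → ℝ, 0 ≤ ∑ i, ∑ j, (ξ i * ξ j) • M i j)
    (htr : ∑ i, M i i ≤ c • E) (hE : E = 0) (i j : Fin d) : M i j = 0 := by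
  refine VectorMeasure.ext fun B hB => ?_
  have := abs_apply_le_of_defect hs hp htr i j hB
  rw [hE] at this
  simpa using this

/-- Each of the `d * d` entries contributes at most `C` times the variation of `M i j`. The bound is
linear in the mass of `E`, which is the form that Grönwall's inequality requires. -/
theorem abs_tensorPairing_le {K : Set (Vec d)} {M : Fin d → Fin d → SignedMeasure K}
    {E : SignedMeasure K} {c : ℝ} (hc : 0 ≤ c) (hE : 0 ≤ E) (hs : ∀ i j, M i j = M j i)
    (hp : ∀ ξ : Fin d → ℝ, 0 ≤ ∑ i, ∑ j, (ξ i * ξ j) • M i j)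
    (htr : ∑ i, M i i ≤ c • E) {A : Vec d → Tensor d} {C : ℝ} (hC : 0 ≤ C)
    (hA : ∀ x ∈ K, ∀ i j, |entry (A x) i j| ≤ C) :
    |tensorPairing A M| ≤ d * d * (C * c) * E univ := by
  have h0 : 0 ≤ c * E univ := mul_nonneg hc (hE univ MeasurableSet.univ)
  have h1 : ∀ i j, |∫ᵛ x, entry (A x) i j ∂•(M i j)| ≤ C * (c * E univ) := fun i j => by
    have hv := variation_univ_le_of_defect hc hE hs hp htr i j
    have : IsFiniteMeasure (M i j).variation := ⟨hv.trans_lt ENNReal.ofReal_lt_top⟩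
    have h2 := VectorMeasure.norm_integral_le_of_norm_le_const (μ := M i j)
      (B := ContinuousLinearMap.lsmul ℝ ℝ) (f := fun x : K => entry (A x) i j) (C := C)
      (ae_of_all _ fun x => hA x x.2 i j)
    refine h2.trans ?_
    have h3 : (M i j).variation.real univ ≤ c * E univ :=
      ENNReal.toReal_le_of_le_ofReal h0 hv
    have h4 : ‖(ContinuousLinearMap.lsmul ℝ ℝ : ℝ →L[ℝ] ℝ →L[ℝ] ℝ)‖ ≤ 1 :=
      ContinuousLinearMap.opNorm_lsmul_le
    calc C * ‖(ContinuousLinearMap.lsmul ℝ ℝ : ℝ →L[ℝ] ℝ →L[ℝ] ℝ)‖ * (M i j).variation.real univ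
        ≤ C * 1 * (c * E univ) :=
          mul_le_mul (mul_le_mul_of_nonneg_left h4 hC) h3 measureReal_nonneg (by linarith)
      _ = _ := by ring
  calc |tensorPairing A M| ≤ ∑ _i : Fin d, ∑ _j : Fin d, C * (c * E univ) :=
        (Finset.abs_sum_le_sum_abs _ _).trans (Finset.sum_le_sum fun i _ =>
          (Finset.abs_sum_le_sum_abs _ _).trans (Finset.sum_le_sum fun j _ => h1 i j))
    _ = _ := by simp; ring

end DefectMeasures

/-! ### Spatial integrals as functions of time -/

section TimeCalculus

variable {V : Type*} [NormedAddCommGroup V] [NormedSpace ℝ V] [MeasurableSpace V] [BorelSpace V]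
  [SecondCountableTopology V] {μ : Measure V} {K : Set V}

theorem exists_bound_on_slab (hK : IsCompact K) {F : Type*} [NormedAddCommGroup F]
    {f : ℝ × V → F} (hf : Continuous f) (t : ℝ) :
    ∃ C, 0 ≤ C ∧ ∀ s ∈ Metric.ball t 1, ∀ x ∈ K, ‖f (s, x)‖ ≤ C := by
  obtain ⟨C, hC⟩ := ((isCompact_closedBall t 1).prod hK).exists_bound_of_continuousOn
    hf.continuousOn
  exact ⟨max C 0, le_max_right _ _, fun s hs x hx =>
    (hC (s, x) ⟨Metric.ball_subset_closedBall hs, hx⟩).trans (le_max_left _ _)⟩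

/-- The factor `k` is merely integrable, which leaves room for the normal flux on the boundary. The
other factor is bounded on `K`, locally uniformly in time. -/
theorem integrable_slice (hK : IsCompact K) (hμ : ∀ᵐ x ∂μ, x ∈ K) {f : ℝ × V → ℝ}
    (hf : Continuous f) {k : V → ℝ} (hk : Integrable k μ) (t : ℝ) :
    Integrable (fun x => f (t, x) * k x) μ := by
  obtain ⟨C, hC0, hC⟩ := exists_bound_on_slab hK hf t
  refine (hk.norm.const_mul C).mono'
    ((hf.comp (Continuous.prodMk_right t)).aestronglyMeasurable.mul hk.1) ?_
  filter_upwards [hμ] with x hx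
  rw [norm_mul]
  exact mul_le_mul_of_nonneg_right (hC t (Metric.mem_ball_self one_pos) x hx) (norm_nonneg _)

theorem continuous_integral_slice (hK : IsCompact K) (hμ : ∀ᵐ x ∂μ, x ∈ K) {f : ℝ × V → ℝ}
    (hf : Continuous f) {k : V → ℝ} (hk : Integrable k μ) :
    Continuous fun t => ∫ x, f (t, x) * k x ∂μ := by
  refine continuous_iff_continuousAt.2 fun t => ?_
  obtain ⟨C, hC0, hC⟩ := exists_bound_on_slab hK hf t
  refine continuousAt_of_dominated (bound := fun x => C * ‖k x‖)
    (Eventually.of_forall fun s => (integrable_slice hK hμ hf hk s).1) ?_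
    (hk.norm.const_mul C) (ae_of_all _ fun x => ?_)
  · filter_upwards [Metric.ball_mem_nhds t one_pos] with s hs
    filter_upwards [hμ] with x hx
    rw [norm_mul]
    exact mul_le_mul_of_nonneg_right (hC s hs x hx) (norm_nonneg _)
  · exact ((hf.comp (Continuous.prodMk_left x)).mul continuous_const).continuousAt

theorem integral_slice_sub (hK : IsCompact K) (hμ : ∀ᵐ x ∂μ, x ∈ K) {f : ℝ × V → ℝ}
    (hf : ContDiff ℝ 1 f) {k : V → ℝ} (hk : Integrable k μ) (a b : ℝ) :
    (∫ x, f (b, x) * k x ∂μ) - ∫ x, f (a, x) * k x ∂μ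
      = ∫ t in a..b, ∫ x, fderiv ℝ f (t, x) (1, 0) * k x ∂μ := by
  have hf' : Continuous fun p => fderiv ℝ f p (1, 0) :=
    (hf.continuous_fderiv one_ne_zero).clm_apply continuous_const
  refine (intervalIntegral.integral_eq_sub_of_hasDerivAt
    (f := fun t => ∫ x, f (t, x) * k x ∂μ) (fun t _ => ?_)
    ((continuous_integral_slice hK hμ hf' hk).intervalIntegrable a b)).symm
  obtain ⟨C, hC0, hC⟩ := exists_bound_on_slab hK hf' t
  refine (hasDerivAt_integral_of_dominated_loc_of_deriv_le (μ := μ)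
    (F := fun t x => f (t, x) * k x) (F' := fun t x => fderiv ℝ f (t, x) (1, 0) * k x)
    (bound := fun x => C * ‖k x‖) (Metric.ball_mem_nhds t one_pos)
    (Eventually.of_forall fun s => (integrable_slice hK hμ hf.continuous hk s).1)
    (integrable_slice hK hμ hf.continuous hk t) (integrable_slice hK hμ hf' hk t).1 ?_
    (hk.norm.const_mul C) (ae_of_all _ fun x s _ => ?_)).2
  · filter_upwards [hμ] with x hx s hs
    rw [norm_mul]
    exact mul_le_mul_of_nonneg_right (hC s hs x hx) (norm_nonneg _)
  · have h1 : HasDerivAt (fun s : ℝ => (s, x)) ((1 : ℝ), (0 : V)) s :=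
      (hasDerivAt_id s).prodMk (hasDerivAt_const s x)
    exact ((hf.differentiable one_ne_zero (s, x)).hasFDerivAt.comp_hasDerivAt s h1).mul_const _

/-- Differentiation in `τ` gives zero inside the interval, and continuity of `g` gives it at the
endpoints. This turns weak formulations integrated over `(0, τ)` into identities at each time. -/
theorem eqOn_zero_of_integral_eq_zero {T : ℝ} (hT : 0 < T) {g : ℝ → ℝ} (hg : Continuous g)
    (h : ∀ τ ∈ Icc 0 T, ∫ t in (0 : ℝ)..τ, g t = 0) : ∀ t ∈ Icc 0 T, g t = 0 := by
  have h1 : EqOn g 0 (Ioo 0 T) := fun t ht => by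
    have hd : HasDerivAt (fun τ => ∫ s in (0 : ℝ)..τ, g s) (g t) t :=
      intervalIntegral.integral_hasDerivAt_right (hg.intervalIntegrable _ _)
        (hg.stronglyMeasurableAtFilter _ _) hg.continuousAt
    have h0 : (fun τ => ∫ s in (0 : ℝ)..τ, g s) =ᶠ[𝓝 t] fun _ => 0 := by
      filter_upwards [Icc_mem_nhds ht.1 ht.2] with τ hτ using h τ hτ
    exact (hd.unique ((hasDerivAt_const t (0 : ℝ)).congr_of_eventuallyEq h0))
  have h2 := h1.closure hg continuous_const
  rw [closure_Ioo hT.ne] at h2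
  exact fun t ht => h2 ht

end TimeCalculus

end Bifluid

namespace Bifluid

open Module

/-! ### Normal traces and zero boundary values -/

section BoundaryTraces

variable {d : ℕ} {Ω : Set (Vec d)}

theorem ae_mem_frontier : ∀ᵐ z ∂surfaceMeasure Ω, z ∈ frontier Ω := by
  rw [ae_iff]; exact surfaceMeasure_compl_frontier

theorem inner_eq_sum_coord (n v : Vec d) : inner ℝ n v = ∑ j, v j * inner ℝ n (basisVec j) := by
  conv_lhs => rw [eq_sum_smul_basisVec v]
  simp [inner_sum, inner_smul_right]

theorem IsBoundedLipschitzDomain.integrable_surface (hΩ : IsBoundedLipschitzDomain Ω)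
    {f : Vec d → ℝ} (hf : Continuous f) : Integrable f (surfaceMeasure Ω) := by
  have := hΩ.isFiniteMeasure_surfaceMeasure
  have hK : IsCompact (frontier Ω) :=
    Metric.isCompact_of_isClosed_isBounded isClosed_frontier
      (hΩ.isBounded.closure.subset frontier_subset_closure)
  obtain ⟨C, hC⟩ := hK.exists_bound_of_continuousOn hf.continuousOn
  exact Integrable.of_bound hf.aestronglyMeasurable C (ae_mem_frontier.mono fun x hx => hC x hx)

theorem IsBoundedLipschitzDomain.integrable_inner_outerNormal (hΩ : IsBoundedLipschitzDomain Ω)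
    {W : Vec d → Vec d} (hW : Continuous W) :
    Integrable (fun z => inner ℝ (outerNormal Ω z) (W z)) (surfaceMeasure Ω) := by
  refine (hΩ.integrable_surface hW.norm).mono'
    (hΩ.aestronglyMeasurable_outerNormal.inner hW.aestronglyMeasurable) ?_
  filter_upwards [hΩ.ae_norm_outerNormal] with z hz
  refine (norm_inner_le_norm _ _).trans_eq ?_
  rw [hz, one_mul]

/-- The normal trace of a `C¹` field is determined by its weak formulation. -/
theorem IsBoundedLipschitzDomain.ae_eq_inner_outerNormal (hΩ : IsBoundedLipschitzDomain Ω)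
    {W : Vec d → Vec d} (hW : ContDiff ℝ 1 W) {b : Vec d → ℝ}
    (hb : Integrable b (surfaceMeasure Ω))
    (h : ∀ ψ : Vec d → ℝ, ContDiff ℝ ∞ ψ → HasCompactSupport ψ →
      ∫ x in Ω, (ψ x * divergence W x + fderiv ℝ ψ x (W x)) = ∫ x, ψ x * b x ∂surfaceMeasure Ω) :
    ∀ᵐ x ∂surfaceMeasure Ω, b x = inner ℝ (outerNormal Ω x) (W x) := by
  have hn := hΩ.integrable_inner_outerNormal hW.continuous
  refine ae_surface_of_forall_nhds fun x hx => ?_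
  obtain ⟨e, a, K, r, l, hc⟩ := hΩ.exists_chart hx
  have ho := isOpen_coordCylinder hc.norm_e x r l
  refine ⟨_, ho.mem_nhds hc.mem_cylinder, ?_⟩
  -- Inside the chart, the divergence theorem for the components `ψ W_j` shows that `b` and the
  -- classical normal trace have the same integral against each `ψ`. The fundamental lemma is
  -- applied to their difference.
  have key := ho.ae_eq_zero_of_integral_contDiff_smul_eq_zero (μ := surfaceMeasure Ω)
    (f := fun z => b z - inner ℝ (outerNormal Ω z) (W z))
    ((hb.sub hn).locallyIntegrable.locallyIntegrableOn _) fun ψ hψ hψc hψs => ?_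
  · filter_upwards [key] with z hz hzU using sub_eq_zero.1 (hz hzU)
  have hψ1 : ContDiff ℝ 1 ψ := hψ.of_le (by simp)
  have hWj := contDiff_coord hW
  have hf : ∀ j, ContDiff ℝ 1 fun z => ψ z * W z j := fun j => hψ1.mul (hWj j)
  have hfc : ∀ j, HasCompactSupport fun z => ψ z * W z j := fun j => hψc.mul_right
  have hj : ∀ j, ∫ z in Ω, fderiv ℝ (fun z => ψ z * W z j) z (basisVec j)
      = ∫ z, ψ z * W z j * inner ℝ (outerNormal Ω z) (basisVec j) ∂surfaceMeasure Ω := fun j =>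
    hc.integral_fderiv_eq_surface hΩ.isOpen (hf j) (hfc j)
      ((tsupport_mul_subset_left (f := ψ) (g := fun z => W z j)).trans hψs) _
  have hfd : ∀ z, ψ z * divergence W z + fderiv ℝ ψ z (W z)
      = ∑ j, fderiv ℝ (fun z => ψ z * W z j) z (basisVec j) := fun z => by
    rw [divergence_eq_sum, map_eq_sum_basisVec (fderiv ℝ ψ z) (W z), Finset.mul_sum,
      ← Finset.sum_add_distrib]
    refine Finset.sum_congr rfl fun j _ => ?_
    have h1 := (hψ1.differentiable one_ne_zero z).hasFDerivAt.mul
      ((hWj j).differentiable one_ne_zero z).hasFDerivAt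
    have h2 : fderiv ℝ (fun z => ψ z * W z j) z = _ := h1.fderiv
    rw [h2]
    simp [fderiv_apply_coord (hW.differentiable one_ne_zero z)]
  have hI1 : ∀ j, Integrable (fun z => fderiv ℝ (fun z => ψ z * W z j) z (basisVec j))
      (volume.restrict Ω) := fun j =>
    (Continuous.integrable_of_hasCompactSupport
      (((hf j).continuous_fderiv one_ne_zero).clm_apply continuous_const)
      ((hfc j).fderiv_apply (𝕜 := ℝ) (basisVec j))).integrableOn
  obtain ⟨C, hC⟩ := hψc.exists_bound_of_continuous hψ.continuous
  have hI2 : ∀ j, Integrable (fun z => ψ z * W z j * inner ℝ (outerNormal Ω z) (basisVec j))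
      (surfaceMeasure Ω) := fun j => by
    have := (hΩ.integrable_inner_outerNormal (W := fun z => (W z j) • basisVec j)
      ((hWj j).continuous.smul continuous_const)).bdd_mul (f := ψ)
        hψ.continuous.aestronglyMeasurable (ae_of_all _ hC)
    refine this.congr (ae_of_all _ fun z => ?_)
    simp only [inner_smul_right]
    ring
  have h3 := h ψ hψ hψc
  simp_rw [hfd] at h3
  rw [integral_finsetSum _ fun j _ => hI1 j] at h3
  simp_rw [hj] at h3
  rw [← integral_finsetSum _ fun j _ => hI2 j] at h3
  have hψb := hb.bdd_mul (f := ψ) hψ.continuous.aestronglyMeasurable (ae_of_all _ hC)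
  have hψn := hn.bdd_mul (f := ψ) hψ.continuous.aestronglyMeasurable (ae_of_all _ hC)
  simp only [smul_eq_mul, mul_sub]
  rw [integral_sub hψb hψn, ← h3, sub_eq_zero]
  refine integral_congr_ae (ae_of_all _ fun z => ?_)
  simp only [inner_eq_sum_coord _ (W z), Finset.mul_sum, mul_assoc]

theorem setIntegral_fderiv_of_tsupport_subset {f : Vec d → ℝ} (hf : ContDiff ℝ 1 f)
    (hc : HasCompactSupport f) (hs : tsupport f ⊆ Ω) (w : Vec d) :
    ∫ x in Ω, fderiv ℝ f x w = 0 := by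
  rw [setIntegral_eq_integral_of_forall_compl_eq_zero fun x hx => ?_]
  · exact integral_fderiv_of_hasCompactSupport hf hc w
  · rw [image_eq_zero_of_notMem_tsupport fun h => hx (hs (tsupport_fderiv_subset ℝ h))]; rfl

theorem IsBoundedLipschitzDomain.exists_bound (hΩ : IsBoundedLipschitzDomain Ω) {F : Type*}
    [NormedAddCommGroup F] {f : Vec d → F} (hf : Continuous f) :
    ∃ C, ∀ x ∈ closure Ω, ‖f x‖ ≤ C :=
  (Metric.isCompact_of_isClosed_isBounded isClosed_closure
    hΩ.isBounded.closure).exists_bound_of_continuousOn hf.continuousOn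

theorem IsBoundedLipschitzDomain.isFiniteMeasure_volume (hΩ : IsBoundedLipschitzDomain Ω) :
    IsFiniteMeasure (volume.restrict Ω) :=
  ⟨by rw [Measure.restrict_apply_univ]; exact hΩ.isBounded.measure_lt_top⟩

theorem IsBoundedLipschitzDomain.integrableOn (hΩ : IsBoundedLipschitzDomain Ω) {F : Type*}
    [NormedAddCommGroup F] {f : Vec d → F} (hf : Continuous f) :
    Integrable f (volume.restrict Ω) := by
  have := hΩ.isFiniteMeasure_volume
  obtain ⟨C, hC⟩ := hΩ.exists_bound hf
  have : SecondCountableTopologyEither (Vec d) F := inferInstance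
  exact Integrable.of_bound hf.aestronglyMeasurable C
    ((ae_restrict_mem hΩ.isOpen.measurableSet).mono fun x hx => hC x (subset_closure hx))

/-- For smooth fields with compact support in `Ω` this is the product rule, and both terms depend
continuously on the pair `(v, G)` in `L²`. As `f` need not vanish on the boundary, the absence of a
boundary term expresses the zero trace of `v`. -/
theorem MemW012.integral_eq_zero (hΩ : IsBoundedLipschitzDomain Ω) {v : Vec d → Vec d}
    {G : Vec d → Tensor d} (hv : MemW012 Ω v G) {f : Vec d → ℝ} (hf : ContDiff ℝ 1 f) (w : Vec d)
    (i : Fin d) : ∫ x in Ω, (v x i * fderiv ℝ f x w + G x w i * f x) = 0 := by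
  have := hΩ.isFiniteMeasure_volume
  obtain ⟨hv2, hG2, happ⟩ := hv
  have hfw : Continuous fun x => fderiv ℝ f x w :=
    (hf.continuous_fderiv one_ne_zero).clm_apply continuous_const
  obtain ⟨A, hA⟩ := hΩ.exists_bound hfw
  obtain ⟨B, hB⟩ := hΩ.exists_bound hf.continuous
  have hmem := ae_restrict_mem (μ := (volume : Measure (Vec d))) hΩ.isOpen.measurableSet
  have hint : ∀ {v : Vec d → Vec d} {G : Vec d → Tensor d}, MemLp v 2 (volume.restrict Ω) →
      MemLp G 2 (volume.restrict Ω) →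
      Integrable (fun x => v x i * fderiv ℝ f x w + G x w i * f x) (volume.restrict Ω) :=
    fun {v G} hv hG => by
      have h1 : Integrable (fun x => v x i) (volume.restrict Ω) :=
        (EuclideanSpace.proj i : Vec d →L[ℝ] ℝ).integrable_comp (hv.integrable one_le_two)
      have h2 : Integrable (fun x => G x w i) (volume.restrict Ω) :=
        ((EuclideanSpace.proj i : Vec d →L[ℝ] ℝ).comp
          (ContinuousLinearMap.apply ℝ (Vec d) w)).integrable_comp (hG.integrable one_le_two)
      exact (h1.mul_bdd (c := A) hfw.aestronglyMeasurable
        (hmem.mono fun x hx => hA x (subset_closure hx))).add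
        (h2.mul_bdd (c := B) hf.continuous.aestronglyMeasurable
        (hmem.mono fun x hx => hB x (subset_closure hx)))
  set I := ∫ x in Ω, (v x i * fderiv ℝ f x w + G x w i * f x)
  -- The constant `|Ω|^(1/2)` of the embedding of `L²` into `L¹`.
  set V : ℝ≥0∞ := volume.restrict Ω univ ^ (1 / (1 : ℝ≥0∞).toReal - 1 / (2 : ℝ≥0∞).toReal)
  have hV : V ≠ ⊤ := (ENNReal.rpow_lt_top_of_nonneg (y := 1 / (1 : ℝ≥0∞).toReal - 1 / (2 : ℝ≥0∞).toReal)
    (by norm_num) (measure_ne_top (volume.restrict Ω) univ)).ne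
  have hL1 : ∀ {F : Type} [NormedAddCommGroup F] {g : Vec d → F},
      AEStronglyMeasurable g (volume.restrict Ω) →
      ∫⁻ x in Ω, ‖g x‖ₑ ≤ eLpNorm g 2 (volume.restrict Ω) * V := fun hg => by
    rw [← eLpNorm_one_eq_lintegral_enorm]
    exact eLpNorm_le_eLpNorm_mul_rpow_measure_univ one_le_two hg
  have hbound : ∀ ε : ℝ≥0∞, 0 < ε → ‖I‖ₑ ≤
      (ENNReal.ofReal A * V + ENNReal.ofReal B * ‖w‖ₑ * V) * ε := fun ε hε => by
    obtain ⟨ψ, hψ, hψc, hψs, h1, h2⟩ := happ ε hε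
    have hψ1 : ContDiff ℝ 1 ψ := hψ.of_le (by simp)
    have hψ2 : MemLp ψ 2 (volume.restrict Ω) :=
      (hψ.continuous.memLp_of_hasCompactSupport hψc).restrict Ω
    have hDψ2 : MemLp (fderiv ℝ ψ) 2 (volume.restrict Ω) :=
      ((hψ1.continuous_fderiv one_ne_zero).memLp_of_hasCompactSupport (hψc.fderiv ℝ)).restrict Ω
    have h0 : ∫ x in Ω, (ψ x i * fderiv ℝ f x w + fderiv ℝ ψ x w i * f x) = 0 := by
      have hψi := contDiff_coord hψ1 i
      have hci : HasCompactSupport fun x => ψ x i * f x :=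
        (hψc.mono (f := ψ) fun x hx h0 => hx (by simp [h0]) :
          HasCompactSupport fun x => ψ x i * f x)
      have hts : tsupport (fun x => ψ x i * f x) ⊆ Ω :=
        by
        refine (closure_mono fun x hx => ?_).trans hψs
        rw [Function.mem_support] at hx ⊢
        exact fun h0 => hx (by simp [h0])
      rw [← setIntegral_fderiv_of_tsupport_subset (hψi.mul hf) hci hts w]
      refine integral_congr_ae (ae_of_all _ fun x => ?_)
      have h1 := (hψi.differentiable one_ne_zero x).hasFDerivAt.mul
        (hf.differentiable one_ne_zero x).hasFDerivAt
      have h2 : fderiv ℝ (fun x => ψ x i * f x) x = _ := h1.fderiv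
      simp only [h2]
      simp [fderiv_apply_coord (hψ1.differentiable one_ne_zero x)]
      ring
    have hI : I = ∫ x in Ω, ((v - ψ) x i * fderiv ℝ f x w + (G - fderiv ℝ ψ) x w i * f x) := by
      rw [← sub_zero I, ← h0, ← integral_sub (hint hv2 hG2) (hint hψ2 hDψ2)]
      refine integral_congr_ae (ae_of_all _ fun x => ?_)
      simp
      ring
    rw [hI]
    calc _ ≤ ∫⁻ x in Ω, ‖(v - ψ) x i * fderiv ℝ f x w + (G - fderiv ℝ ψ) x w i * f x‖ₑ :=
          enorm_integral_le_lintegral_enorm _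
      _ ≤ ∫⁻ x in Ω, (ENNReal.ofReal A * ‖(v - ψ) x‖ₑ
            + ENNReal.ofReal B * ‖w‖ₑ * ‖(G - fderiv ℝ ψ) x‖ₑ) := by
          refine lintegral_mono_ae (hmem.mono fun x hx => ?_)
          refine (enorm_add_le _ _).trans (add_le_add ?_ ?_)
          · rw [enorm_mul, mul_comm]
            refine mul_le_mul' ?_ ?_
            · rw [← ofReal_norm]
              exact ENNReal.ofReal_le_ofReal (hA x (subset_closure hx))
            · rw [← ofReal_norm, ← ofReal_norm]
              exact ENNReal.ofReal_le_ofReal (PiLp.norm_apply_le _ i)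
          · rw [enorm_mul, mul_comm, mul_assoc]
            refine mul_le_mul' ?_ ?_
            · rw [← ofReal_norm]
              exact ENNReal.ofReal_le_ofReal (hB x (subset_closure hx))
            · rw [← ofReal_norm, ← ofReal_norm, ← ofReal_norm,
                ← ENNReal.ofReal_mul (norm_nonneg _)]
              refine ENNReal.ofReal_le_ofReal ((PiLp.norm_apply_le _ i).trans ?_)
              rw [mul_comm]
              exact ContinuousLinearMap.le_opNorm _ _
      _ = ENNReal.ofReal A * (∫⁻ x in Ω, ‖(v - ψ) x‖ₑ)
            + ENNReal.ofReal B * ‖w‖ₑ * ∫⁻ x in Ω, ‖(G - fderiv ℝ ψ) x‖ₑ := by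
          rw [lintegral_add_left' ((hv2.sub hψ2).1.enorm.const_mul _),
            lintegral_const_mul' _ _ ENNReal.ofReal_ne_top,
            lintegral_const_mul' _ _ (ENNReal.mul_ne_top ENNReal.ofReal_ne_top enorm_ne_top)]
      _ ≤ ENNReal.ofReal A * (ε * V) + ENNReal.ofReal B * ‖w‖ₑ * (ε * V) :=
          add_le_add
            (mul_le_mul' le_rfl ((hL1 (hv2.sub hψ2).1).trans (mul_le_mul' h1.le le_rfl)))
            (mul_le_mul' le_rfl ((hL1 (hG2.sub hDψ2).1).trans (mul_le_mul' h2.le le_rfl)))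
      _ = _ := by ring
  set c := ENNReal.ofReal A * V + ENNReal.ofReal B * ‖w‖ₑ * V
  have hc : c ≠ ⊤ := ENNReal.add_ne_top.2 ⟨ENNReal.mul_ne_top ENNReal.ofReal_ne_top hV,
    ENNReal.mul_ne_top (ENNReal.mul_ne_top ENNReal.ofReal_ne_top enorm_ne_top) hV⟩
  have hlim : Tendsto (fun ε : ℝ≥0∞ => c * ε) (𝓝[>] 0) (𝓝 (c * 0)) :=
    (ENNReal.Tendsto.const_mul tendsto_id (Or.inr hc)).mono_left nhdsWithin_le_nhds
  have h3 : ‖I‖ₑ ≤ c * 0 := ge_of_tendsto hlim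
    (eventually_nhdsWithin_of_forall fun ε hε => hbound ε hε)
  rw [mul_zero] at h3
  simpa using h3

/-- For a `C¹` representative of a function in `W^{1,2}_0`,
the weak gradient is the classical one, and the function vanishes on the boundary. -/
theorem MemW012.of_contDiff (hΩ : IsBoundedLipschitzDomain Ω) {v g : Vec d → Vec d}
    {G : Vec d → Tensor d} (hv : MemW012 Ω v G) (hg : ContDiff ℝ 1 g) (hgv : EqOn g v Ω) :
    (∀ᵐ x ∂volume.restrict Ω, G x = fderiv ℝ g x) ∧ ∀ x ∈ frontier Ω, g x = 0 := by
  have hmem := ae_restrict_mem (μ := (volume : Measure (Vec d))) hΩ.isOpen.measurableSet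
  have hgd : ∀ x, DifferentiableAt ℝ g x := hg.differentiable one_ne_zero
  have hgi := contDiff_coord hg
  have hDg : Continuous fun x => fderiv ℝ g x := hg.continuous_fderiv one_ne_zero
  have := hΩ.isFiniteMeasure_volume
  have hIBP : ∀ (f : Vec d → ℝ), ContDiff ℝ 1 f → ∀ w i,
      ∫ x in Ω, (g x i * fderiv ℝ f x w + G x w i * f x) = 0 := fun f hf w i => by
    rw [← hv.integral_eq_zero hΩ hf w i]
    refine integral_congr_ae (hmem.mono fun x hx => ?_)
    simp only [hgv hx]
  have hGint : ∀ w i, Integrable (fun x => G x w i) (volume.restrict Ω) := fun w i =>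
    ((EuclideanSpace.proj i : Vec d →L[ℝ] ℝ).comp
      (ContinuousLinearMap.apply ℝ (Vec d) w)).integrable_comp (hv.2.1.integrable one_le_two)
  have hprod : ∀ {f : Vec d → ℝ}, ContDiff ℝ 1 f → ∀ w i x,
      fderiv ℝ (fun x => g x i * f x) x w = g x i * fderiv ℝ f x w + fderiv ℝ g x w i * f x :=
    fun {f} hf w i x => by
      have h1 := ((hgi i).differentiable one_ne_zero x).hasFDerivAt.mul
        (hf.differentiable one_ne_zero x).hasFDerivAt
      have h2 : fderiv ℝ (fun x => g x i * f x) x = _ := h1.fderiv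
      rw [h2]
      simp [fderiv_apply_coord (hgd x)]
      ring
  have hDgi : ∀ w i, Continuous fun x => fderiv ℝ g x w i := fun w i =>
    (EuclideanSpace.proj i : Vec d →L[ℝ] ℝ).continuous.comp (hDg.clm_apply continuous_const)
  -- Tests supported in `Ω` only see the interior, and for them the classical gradient satisfies the
  -- same identity as `G`.
  have hG : ∀ᵐ x ∂volume.restrict Ω, G x = fderiv ℝ g x := by
    have hwi : ∀ j i, ∀ᵐ x ∂volume.restrict Ω,
        G x (basisVec j) i - fderiv ℝ g x (basisVec j) i = 0 := fun j i => by
      have hint : Integrable (fun x => G x (basisVec j) i - fderiv ℝ g x (basisVec j) i)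
        (volume.restrict Ω) := (hGint _ i).sub (hΩ.integrableOn (hDgi _ i))
      have h1 := hΩ.isOpen.ae_eq_zero_of_integral_contDiff_smul_eq_zero
        (μ := (volume : Measure (Vec d))) (IntegrableOn.locallyIntegrableOn hint)
        fun ψ hψ hψc hψs => ?_
      · exact (ae_restrict_iff' hΩ.isOpen.measurableSet).2 h1
      have hψ1 : ContDiff ℝ 1 ψ := hψ.of_le (by simp)
      rw [← setIntegral_eq_integral_of_forall_compl_eq_zero (s := Ω) fun x hx => by
        rw [image_eq_zero_of_notMem_tsupport fun h => hx (hψs h), zero_smul]]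
      have hci : HasCompactSupport fun x => g x i * ψ x := hψc.mul_left
      have h2 := setIntegral_fderiv_of_tsupport_subset ((hgi i).mul hψ1) hci
        ((tsupport_mul_subset_right (f := fun x => g x i) (g := ψ)).trans hψs) (basisVec j)
      have h2' : ∫ x in Ω, (g x i * fderiv ℝ ψ x (basisVec j)
          + fderiv ℝ g x (basisVec j) i * ψ x) = 0 := by
        rw [← h2]; exact integral_congr_ae (ae_of_all _ fun x => (hprod hψ1 _ i x).symm)
      have h3 := hIBP ψ hψ1 (basisVec j) i
      have hDψ := hψ1.continuous_fderiv one_ne_zero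
      have i1 : Integrable (fun x => g x i * fderiv ℝ ψ x (basisVec j)) (volume.restrict Ω) :=
        hΩ.integrableOn ((hgi i).continuous.mul (hDψ.clm_apply continuous_const))
      have i2 : Integrable (fun x => fderiv ℝ g x (basisVec j) i * ψ x) (volume.restrict Ω) :=
        hΩ.integrableOn ((hDgi _ i).mul hψ.continuous)
      obtain ⟨C, hC⟩ := hψc.exists_bound_of_continuous hψ.continuous
      have i3 : Integrable (fun x => G x (basisVec j) i * ψ x) (volume.restrict Ω) :=
        (hGint _ i).mul_bdd (c := C) hψ.continuous.aestronglyMeasurable (ae_of_all _ hC)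
      rw [integral_add i1 i2] at h2'
      rw [integral_add i1 i3] at h3
      have h4 : ∫ x in Ω, ψ x • (G x (basisVec j) i - fderiv ℝ g x (basisVec j) i)
          = (∫ x in Ω, G x (basisVec j) i * ψ x) - ∫ x in Ω, fderiv ℝ g x (basisVec j) i * ψ x := by
        rw [← integral_sub i3 i2]
        refine integral_congr_ae (ae_of_all _ fun x => ?_)
        simp only [smul_eq_mul]; ring
      rw [h4]; linarith
    have hall : ∀ᵐ x ∂volume.restrict Ω, ∀ j i,
        G x (basisVec j) i - fderiv ℝ g x (basisVec j) i = 0 :=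
      ae_all_iff.2 fun j => ae_all_iff.2 fun i => hwi j i
    filter_upwards [hall] with x hx
    refine ContinuousLinearMap.ext fun w => ?_
    rw [map_eq_sum_basisVec, map_eq_sum_basisVec (fderiv ℝ g x)]
    refine Finset.sum_congr rfl fun j _ => ?_
    congr 1
    ext i
    exact sub_eq_zero.1 (hx j i)
  refine ⟨hG, ?_⟩
  -- With `G` identified, the integration by parts says that each field `g_i e_j` has zero normal
  -- trace, that is `g_i n_j = 0`. As `n` is a unit vector, some `n_j` is nonzero.
  have hzero : ∀ᵐ x ∂surfaceMeasure Ω, g x = 0 := by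
    have hij : ∀ i j, ∀ᵐ x ∂surfaceMeasure Ω,
        (0 : ℝ) = inner ℝ (outerNormal Ω x) (g x i • basisVec j) := fun i j => by
      have hW : ContDiff ℝ 1 fun x => g x i • (basisVec j : Vec d) := (hgi i).smul contDiff_const
      refine hΩ.ae_eq_inner_outerNormal hW (integrable_zero _ _ _) fun ψ hψ _ => ?_
      have hψ1 : ContDiff ℝ 1 ψ := hψ.of_le (by simp)
      rw [← hIBP ψ hψ1 (basisVec j) i |>.trans (by simp : (0 : ℝ) = ∫ x, ψ x * 0 ∂surfaceMeasure Ω)]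
      refine integral_congr_ae ?_
      filter_upwards [hG] with x hx
      have h1 : HasFDerivAt (fun x => g x i • (basisVec j : Vec d)) _ x :=
        ((hgi i).differentiable one_ne_zero x).hasFDerivAt.smul_const (basisVec j : Vec d)
      rw [divergence_eq_sum, h1.fderiv, hx]
      simp [fderiv_apply_coord (hgd x), basisVec]
      ring
    have hall : ∀ᵐ x ∂surfaceMeasure Ω, ∀ i j,
        (0 : ℝ) = inner ℝ (outerNormal Ω x) (g x i • basisVec j) :=
      ae_all_iff.2 fun i => ae_all_iff.2 fun j => hij i j
    filter_upwards [hall, hΩ.ae_norm_outerNormal] with x hx hn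
    ext i
    by_contra hne
    have h1 : ∀ j, inner ℝ (outerNormal Ω x) (basisVec j : Vec d) = 0 := fun j => by
      have := hx i j
      rw [inner_smul_right] at this
      exact (mul_eq_zero.1 this.symm).resolve_left hne
    have h2 := inner_eq_sum_coord (outerNormal Ω x) (outerNormal Ω x)
    simp only [h1, mul_zero, Finset.sum_const_zero, real_inner_self_eq_norm_sq, hn] at h2
    norm_num at h2
  -- If `g` were nonzero at one boundary point, it would be nonzero on a neighbourhood, which has
  -- positive surface measure.
  intro x hx
  by_contra hne
  obtain ⟨e, a, K, r, l, hc⟩ := hΩ.exists_chart hx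
  have h1 := hc.surfaceMeasure_pos hΩ.isOpen hx
    (isOpen_ne.preimage hg.continuous : IsOpen {y | g y ≠ 0}) hne
  exact h1.ne' hzero

end BoundaryTraces

end Bifluid

namespace Bifluid

open Module

/-! ### The continuity equations, pointwise and on the inflow boundary -/

section ContinuityEquation

variable {d : ℕ}

/-- `g` is a `C¹` extension of `f` from `[0,T] × closure Ω`. -/
structure IsC1Extension {F : Type*} [NormedAddCommGroup F] [NormedSpace ℝ F]
    (T : ℝ) (Ω : Set (Vec d)) (f : ℝ → Vec d → F) (g : ℝ × Vec d → F) : Prop where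
  contDiff : ContDiff ℝ 1 g
  eq : ∀ t ∈ Icc 0 T, ∀ x ∈ closure Ω, g (t, x) = f t x

theorem eqOn_closure_zero_of_integral_eq_zero {U : Set (Vec d)} (hU : IsOpen U) {f : Vec d → ℝ}
    (hf : Continuous f) (h : ∀ ψ : Vec d → ℝ, ContDiff ℝ ∞ ψ → HasCompactSupport ψ →
      tsupport ψ ⊆ U → ∫ x in U, ψ x * f x = 0) : ∀ x ∈ closure U, f x = 0 := by
  have h1 := hU.ae_eq_zero_of_integral_contDiff_smul_eq_zero (μ := (volume : Measure (Vec d)))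
    (hf.locallyIntegrable.locallyIntegrableOn U) fun ψ hψ hψc hψs => by
      rw [← h ψ hψ hψc hψs, setIntegral_eq_integral_of_forall_compl_eq_zero fun x hx => by
        rw [image_eq_zero_of_notMem_tsupport fun h => hx (hψs h), zero_mul]]
      rfl
  have h2 : EqOn f 0 U := Measure.eqOn_open_of_ae_eq (μ := (volume : Measure (Vec d)))
    ((ae_restrict_iff' hU.measurableSet).2 h1) hU hf.continuousOn continuousOn_const
  exact fun x hx => h2.closure hf continuous_const hx

theorem fderiv_slice {F : Type*} [NormedAddCommGroup F] [NormedSpace ℝ F] {g : ℝ × Vec d → F}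
    {p : ℝ × Vec d} (hg : DifferentiableAt ℝ g p) :
    fderiv ℝ (fun y => g (p.1, y)) p.2 = spaceDeriv g p := by
  have h1 : HasFDerivAt (fun y : Vec d => (p.1, y)) (ContinuousLinearMap.inr ℝ ℝ (Vec d)) p.2 :=
    hasFDerivAt_prodMk_right p.1 p.2
  exact (HasFDerivAt.comp p.2 (f := fun y : Vec d => (p.1, y)) (g := g)
    (hg.hasFDerivAt) h1).fderiv

theorem contDiff_slice {F : Type*} [NormedAddCommGroup F] [NormedSpace ℝ F] {g : ℝ × Vec d → F}
    {n : WithTop ℕ∞} (hg : ContDiff ℝ n g) (t : ℝ) : ContDiff ℝ n fun y => g (t, y) :=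
  hg.comp (contDiff_const.prodMk contDiff_id)

theorem hasDerivAt_slice {F : Type*} [NormedAddCommGroup F] [NormedSpace ℝ F] {g : ℝ × Vec d → F}
    {t : ℝ} {x : Vec d} (hg : DifferentiableAt ℝ g (t, x)) :
    HasDerivAt (fun s => g (s, x)) (timeDeriv g (t, x)) t :=
  HasFDerivAt.comp_hasDerivAt t hg.hasFDerivAt ((hasDerivAt_id t).prodMk (hasDerivAt_const t x))

theorem continuous_timeDeriv {F : Type*} [NormedAddCommGroup F] [NormedSpace ℝ F]
    {g : ℝ × Vec d → F} (hg : ContDiff ℝ 1 g) : Continuous (timeDeriv g) :=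
  (hg.continuous_fderiv one_ne_zero).clm_apply continuous_const

theorem continuous_spaceDeriv {F : Type*} [NormedAddCommGroup F] [NormedSpace ℝ F]
    {g : ℝ × Vec d → F} (hg : ContDiff ℝ 1 g) : Continuous (spaceDeriv g) :=
  (hg.continuous_fderiv one_ne_zero).clm_comp continuous_const

namespace ProblemData

variable {D : ProblemData d}

theorem Admissible.isCompact_closure (hD : D.Admissible) : IsCompact (closure D.Ω) :=
  Metric.isCompact_of_isClosed_isBounded isClosed_closure hD.domain.isBounded.closure

theorem Admissible.ae_mem (hD : D.Admissible) : ∀ᵐ x ∂D.dx, x ∈ D.Ω :=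
  ae_restrict_mem hD.domain.isOpen.measurableSet

theorem ae_dS_mem_frontier : ∀ᵐ x ∂D.dS, x ∈ frontier D.Ω := ae_mem_frontier

theorem Admissible.integrable_normalFlux (hD : D.Admissible) : Integrable D.normalFlux D.dS :=
  (hD.domain.integrable_inner_outerNormal hD.uB_C1.continuous).congr
    (ae_of_all _ fun _ => real_inner_comm _ _)

/-- The normal field is known to be measurable only up to null sets, so the inflow set is handled as
a null measurable set. -/
theorem Admissible.nullMeasurableSet_inflow (hD : D.Admissible) :
    NullMeasurableSet D.inflow D.dS := by
  have h1 : NullMeasurableSet {x | D.normalFlux x < 0} D.dS :=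
    nullMeasurableSet_lt hD.integrable_normalFlux.1.aemeasurable aemeasurable_const
  exact isClosed_frontier.measurableSet.nullMeasurableSet.inter h1

theorem Admissible.setIntegral_outflow_add_inflow (hD : D.Admissible) {f : Vec d → ℝ}
    (hf : Integrable f D.dS) :
    (∫ x in D.outflow, f x ∂D.dS) + ∫ x in D.inflow, f x ∂D.dS = ∫ x, f x ∂D.dS := by
  have h1 : (D.outflow : Set (Vec d)) =ᵐ[D.dS] (D.inflowᶜ : Set (Vec d)) := by
    filter_upwards [ae_dS_mem_frontier (D := D)] with x hx
    exact propext ⟨fun h => h.2, fun h => ⟨hx, h⟩⟩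
  rw [setIntegral_congr_set h1, add_comm, integral_add_compl₀ hD.nullMeasurableSet_inflow hf]

theorem Admissible.integrable_dS_mul (hD : D.Admissible) {k : Vec d → ℝ} (hk : Continuous k) :
    Integrable (fun x => k x * D.normalFlux x) D.dS := by
  have hK : IsCompact (frontier D.Ω) := hD.isCompact_closure.of_isClosed_subset
    isClosed_frontier frontier_subset_closure
  obtain ⟨C, hC⟩ := hK.exists_bound_of_continuousOn hk.continuousOn
  exact hD.integrable_normalFlux.bdd_mul hk.aestronglyMeasurable
    (ae_dS_mem_frontier.mono fun x hx => hC x hx)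

theorem Admissible.integrable_dx (hD : D.Admissible) {k : Vec d → ℝ} (hk : Continuous k) :
    Integrable k D.dx := hD.domain.integrableOn hk

/-- The continuity equation tested with a function of space, at each time. -/
theorem WeakContinuity.slice {r : ℝ → Vec d → ℝ} {rB : Vec d → ℝ} {u : ℝ → Vec d → Vec d}
    (h : D.WeakContinuity r rB u) (hD : D.Admissible) {g : ℝ × Vec d → ℝ} {gu : ℝ × Vec d → Vec d}
    (hg : IsC1Extension D.T D.Ω r g) (hgu : IsC1Extension D.T D.Ω u gu)
    {ψ : Vec d → ℝ} (hψ : ContDiff ℝ 1 ψ) {t : ℝ} (ht : t ∈ Icc 0 D.T) :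
    (∫ x, timeDeriv g (t, x) * ψ x ∂D.dx)
      + (∫ x in D.outflow, g (t, x) * (ψ x * D.normalFlux x) ∂D.dS)
      + (∫ x in D.inflow, rB x * (ψ x * D.normalFlux x) ∂D.dS)
      - ∫ x, g (t, x) * fderiv ℝ ψ x (gu (t, x)) ∂D.dx = 0 := by
  have hK := hD.isCompact_closure
  have hμ : ∀ᵐ x ∂D.dx, x ∈ closure D.Ω := hD.ae_mem.mono fun _ hx => subset_closure hx
  have hdψ : Continuous fun x => fderiv ℝ ψ x := hψ.continuous_fderiv one_ne_zero
  have hS : ∀ᵐ x ∂(D.dS.restrict D.outflow), x ∈ closure D.Ω :=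
    ae_restrict_of_ae (ae_dS_mem_frontier.mono fun x hx => frontier_subset_closure hx)
  have hA := continuous_integral_slice hK hμ (continuous_timeDeriv hg.contDiff)
    (hD.integrable_dx hψ.continuous)
  have hB := continuous_integral_slice hK hS hg.contDiff.continuous
    (hD.integrable_dS_mul hψ.continuous).restrict
  have hF : Continuous fun p : ℝ × Vec d => g p * fderiv ℝ ψ p.2 (gu p) :=
    hg.contDiff.continuous.mul ((hdψ.comp continuous_snd).clm_apply hgu.contDiff.continuous)
  have hC := continuous_integral_slice hK hμ hF (hD.integrable_dx continuous_const (k := fun _ => 1))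
  simp only [mul_one] at hC
  have hAB : Continuous fun t => (∫ x, timeDeriv g (t, x) * ψ x ∂D.dx)
      + ∫ x in D.outflow, g (t, x) * (ψ x * D.normalFlux x) ∂D.dS := hA.add hB
  have hABC : Continuous fun t => (∫ x, timeDeriv g (t, x) * ψ x ∂D.dx)
      + (∫ x in D.outflow, g (t, x) * (ψ x * D.normalFlux x) ∂D.dS)
      + ∫ x in D.inflow, rB x * (ψ x * D.normalFlux x) ∂D.dS := hAB.add continuous_const
  -- The expression is continuous in `t`, and its integral over each `(0, τ)` is the weak
  -- formulation with a test function independent of time.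
  refine eqOn_zero_of_integral_eq_zero hD.T_pos (g := fun t =>
      (∫ x, timeDeriv g (t, x) * ψ x ∂D.dx)
      + (∫ x in D.outflow, g (t, x) * (ψ x * D.normalFlux x) ∂D.dS)
      + (∫ x in D.inflow, rB x * (ψ x * D.normalFlux x) ∂D.dS)
      - ∫ x, g (t, x) * fderiv ℝ ψ x (gu (t, x)) ∂D.dx) (hABC.sub hC) (fun τ hτ => ?_) t ht
  have hφ : ContDiff ℝ 1 fun p : ℝ × Vec d => ψ p.2 := hψ.comp contDiff_snd
  have hφd : ∀ p : ℝ × Vec d, fderiv ℝ (fun p : ℝ × Vec d => ψ p.2) p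
      = (fderiv ℝ ψ p.2).comp (ContinuousLinearMap.snd ℝ ℝ (Vec d)) := fun p =>
    (HasFDerivAt.comp p (hψ.differentiable one_ne_zero p.2).hasFDerivAt hasFDerivAt_snd).fderiv
  have h1 := h _ hφ τ hτ
  have hsub : ∀ s ∈ uIcc 0 τ, s ∈ Icc 0 D.T := fun s hs => by
    rw [uIcc_of_le hτ.1] at hs
    exact ⟨hs.1, hs.2.trans hτ.2⟩
  have e0 : ∀ s ∈ Icc 0 D.T, ∫ x, r s x * ψ x ∂D.dx = ∫ x, g (s, x) * ψ x ∂D.dx := fun s hs =>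
    integral_congr_ae (hμ.mono fun x hx => by simp only [hg.eq s hs x hx])
  have e1 : ∫ s in (0 : ℝ)..τ, ∫ x in D.outflow, ψ x * r s x * D.normalFlux x ∂D.dS
      = ∫ s in (0 : ℝ)..τ, ∫ x in D.outflow, g (s, x) * (ψ x * D.normalFlux x) ∂D.dS :=
    intervalIntegral.integral_congr fun s hs => integral_congr_ae (hS.mono fun x hx => by
      simp only [hg.eq s (hsub s hs) x hx]; ring)
  have e2 : ∫ x in D.inflow, ψ x * rB x * D.normalFlux x ∂D.dS
      = ∫ x in D.inflow, rB x * (ψ x * D.normalFlux x) ∂D.dS := by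
    congr 1; ext x; ring
  have e3 : ∫ s in (0 : ℝ)..τ, ∫ x, (r s x * timeDeriv (fun p : ℝ × Vec d => ψ p.2) (s, x)
      + r s x * spaceDeriv (fun p : ℝ × Vec d => ψ p.2) (s, x) (u s x)) ∂D.dx
      = ∫ s in (0 : ℝ)..τ, ∫ x, g (s, x) * fderiv ℝ ψ x (gu (s, x)) ∂D.dx :=
    intervalIntegral.integral_congr fun s hs => integral_congr_ae (hμ.mono fun x hx => by
      simp only [hg.eq s (hsub s hs) x hx, hgu.eq s (hsub s hs) x hx, timeDeriv, spaceDeriv, hφd]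
      simp)
  rw [e0 τ hτ, e0 0 ⟨le_rfl, hD.T_pos.le⟩, integral_slice_sub hK hμ hg.contDiff
    (hD.integrable_dx hψ.continuous) 0 τ] at h1
  simp only [e2] at h1
  rw [e1, e3] at h1
  rw [intervalIntegral.integral_sub (hABC.intervalIntegrable _ _)
    (hC.intervalIntegrable _ _), intervalIntegral.integral_add
    (hAB.intervalIntegrable _ _) (continuous_const.intervalIntegrable _ _),
    intervalIntegral.integral_add (hA.intervalIntegrable _ _) (hB.intervalIntegrable _ _)]
  simp only [timeDeriv]
  linarith

theorem divergence_smul {f : Vec d → ℝ} {v : Vec d → Vec d} {x : Vec d}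
    (hf : DifferentiableAt ℝ f x) (hv : DifferentiableAt ℝ v x) :
    divergence (fun y => f y • v y) x = f x * divergence v x + fderiv ℝ f x (v x) := by
  have h1 : HasFDerivAt (fun y => f y • v y) _ x := hf.hasFDerivAt.smul hv.hasFDerivAt
  rw [divergence_eq_sum, divergence_eq_sum, h1.fderiv, map_eq_sum_basisVec (fderiv ℝ f x) (v x),
    Finset.mul_sum, ← Finset.sum_add_distrib]
  refine Finset.sum_congr rfl fun j _ => ?_
  simp
  ring

theorem continuous_divergence {v : Vec d → Vec d} (hv : ContDiff ℝ 1 v) :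
    Continuous (divergence v) := by
  change Continuous fun x => ∑ j, fderiv ℝ v x (basisVec j) j
  refine continuous_finsetSum (f := fun j x => fderiv ℝ v x (basisVec j) j) _ fun j _ => ?_
  exact (EuclideanSpace.proj j : Vec d →L[ℝ] ℝ).continuous.comp
    ((hv.continuous_fderiv one_ne_zero).clm_apply continuous_const)

theorem notMem_tsupport_of_mem_frontier {Ω : Set (Vec d)} (hΩ : IsOpen Ω) {F : Type*}
    [NormedAddCommGroup F] {ψ : Vec d → F} (hs : tsupport ψ ⊆ Ω) {x : Vec d}
    (hx : x ∈ frontier Ω) : ψ x = 0 :=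
  image_eq_zero_of_notMem_tsupport fun h => by
    rw [hΩ.frontier_eq] at hx
    exact hx.2 (hs h)

theorem setIntegral_fderiv_apply {Ω : Set (Vec d)} {ψ : Vec d → ℝ} (hψ : ContDiff ℝ 1 ψ)
    (hc : HasCompactSupport ψ) (hs : tsupport ψ ⊆ Ω) {V : Vec d → Vec d} (hV : ContDiff ℝ 1 V) :
    ∫ x in Ω, fderiv ℝ ψ x (V x) = - ∫ x in Ω, ψ x * divergence V x := by
  rw [setIntegral_eq_integral_of_forall_compl_eq_zero fun x hx => ?_,
    setIntegral_eq_integral_of_forall_compl_eq_zero fun x hx => ?_]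
  · exact integral_fderiv_apply hψ hc hV
  · rw [image_eq_zero_of_notMem_tsupport fun h => hx (hs h), zero_mul]
  · rw [image_eq_zero_of_notMem_tsupport fun h => hx (hs (tsupport_fderiv_subset ℝ h))]; rfl

/-- Test functions supported in `Ω` remove the boundary integrals and allow integration by parts.
Continuity then carries the equation up to the boundary. -/
theorem WeakContinuity.timeDeriv_add_divergence {r : ℝ → Vec d → ℝ} {rB : Vec d → ℝ}
    {u : ℝ → Vec d → Vec d} (h : D.WeakContinuity r rB u) (hD : D.Admissible)
    {g : ℝ × Vec d → ℝ} {gu : ℝ × Vec d → Vec d}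
    (hg : IsC1Extension D.T D.Ω r g) (hgu : IsC1Extension D.T D.Ω u gu)
    {t : ℝ} (ht : t ∈ Icc 0 D.T) : ∀ x ∈ closure D.Ω,
      timeDeriv g (t, x) + divergence (fun y => g (t, y) • gu (t, y)) x = 0 := by
  have hW : ContDiff ℝ 1 fun y => g (t, y) • gu (t, y) :=
    (contDiff_slice hg.contDiff t).smul (contDiff_slice hgu.contDiff t)
  have hc1 : Continuous fun x => timeDeriv g (t, x) :=
    (continuous_timeDeriv hg.contDiff).comp (Continuous.prodMk_right t)
  refine eqOn_closure_zero_of_integral_eq_zero hD.domain.isOpen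
    (hc1.add (continuous_divergence hW)) fun ψ hψ hψc hψs => ?_
  have hψ1 : ContDiff ℝ 1 ψ := hψ.of_le (by simp)
  have h1 := h.slice hD hg hgu hψ1 ht
  have hz : ∀ᵐ x ∂D.dS, ψ x = 0 := ae_dS_mem_frontier.mono fun x hx =>
    notMem_tsupport_of_mem_frontier hD.domain.isOpen hψs hx
  have e1 : ∫ x in D.outflow, g (t, x) * (ψ x * D.normalFlux x) ∂D.dS = 0 :=
    integral_eq_zero_of_ae ((ae_restrict_of_ae hz).mono fun x hx => by simp [hx])
  have e2 : ∫ x in D.inflow, rB x * (ψ x * D.normalFlux x) ∂D.dS = 0 :=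
    integral_eq_zero_of_ae ((ae_restrict_of_ae hz).mono fun x hx => by simp [hx])
  have e3 := setIntegral_fderiv_apply hψ1 hψc hψs hW
  simp only [map_smul, smul_eq_mul] at e3
  rw [e1, e2, show (∫ x, g (t, x) * fderiv ℝ ψ x (gu (t, x)) ∂D.dx) = _ from e3] at h1
  have i1 : Integrable (fun x => ψ x * timeDeriv g (t, x)) D.dx :=
    hD.integrable_dx (hψ.continuous.mul hc1)
  have i2 : Integrable (fun x => ψ x * divergence (fun y => g (t, y) • gu (t, y)) x) D.dx :=
    hD.integrable_dx (hψ.continuous.mul (continuous_divergence hW))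
  simp only [mul_add]
  have e4 := integral_add i1 i2
  simp only [dx] at e4 h1
  rw [e4]
  simp only [mul_comm (timeDeriv g _)] at h1
  linarith

/-- Once the equation holds pointwise, what remains of the weak form prescribes the normal trace of
`r u`: it is `r_B u_B · n` on the inflow part and `r u_B · n` elsewhere. Since `u = u_B` on the
boundary, the true trace is `r u_B · n`, and `u_B · n ≠ 0` on the inflow part. A countable dense set
of times makes the exceptional set independent of `t`. -/
theorem WeakContinuity.ae_eq_inflow {r : ℝ → Vec d → ℝ} {rB : Vec d → ℝ}
    {u : ℝ → Vec d → Vec d} (h : D.WeakContinuity r rB u) (hD : D.Admissible)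
    {g : ℝ × Vec d → ℝ} {gu : ℝ × Vec d → Vec d}
    (hg : IsC1Extension D.T D.Ω r g) (hgu : IsC1Extension D.T D.Ω u gu) (hrB : Continuous rB)
    (hbd : ∀ t ∈ Icc 0 D.T, ∀ x ∈ frontier D.Ω, gu (t, x) = D.uB x) :
    ∀ᵐ x ∂(D.dS.restrict D.inflow), ∀ t ∈ Icc 0 D.T, g (t, x) = rB x := by
  have hS := ae_dS_mem_frontier (D := D)
  have hin := hD.nullMeasurableSet_inflow
  have hslice : ∀ t ∈ Icc 0 D.T, ∀ᵐ x ∂(D.dS.restrict D.inflow), g (t, x) = rB x := fun t ht => by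
    have hgt : Continuous fun x => g (t, x) := (contDiff_slice hg.contDiff t).continuous
    have hW : ContDiff ℝ 1 fun y => g (t, y) • gu (t, y) :=
      (contDiff_slice hg.contDiff t).smul (contDiff_slice hgu.contDiff t)
    have hc1 : Continuous fun x => timeDeriv g (t, x) :=
      (continuous_timeDeriv hg.contDiff).comp (Continuous.prodMk_right t)
    let b : Vec d → ℝ := fun x => g (t, x) * D.normalFlux x
      + D.inflow.indicator (fun x => (rB x - g (t, x)) * D.normalFlux x) x
    have hb1 := hD.integrable_dS_mul hgt
    have hb2 := (hD.integrable_dS_mul (hrB.sub hgt)).indicator₀ hin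
    have key := hD.domain.ae_eq_inner_outerNormal hW (b := b) (hb1.add hb2) fun ψ hψ hψc => by
      have hψ1 : ContDiff ℝ 1 ψ := hψ.of_le (by simp)
      have h1 := h.slice hD hg hgu hψ1 ht
      have h2 : ∫ x, timeDeriv g (t, x) * ψ x ∂D.dx
          = - ∫ x, ψ x * divergence (fun y => g (t, y) • gu (t, y)) x ∂D.dx := by
        rw [← integral_neg]
        refine integral_congr_ae (hD.ae_mem.mono fun x hx => ?_)
        have := h.timeDeriv_add_divergence hD hg hgu ht x (subset_closure hx)
        simp only
        linear_combination ψ x * this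
      have i1 : Integrable (fun x => ψ x * divergence (fun y => g (t, y) • gu (t, y)) x) D.dx :=
        hD.integrable_dx (hψ.continuous.mul (continuous_divergence hW))
      have i2 : Integrable (fun x => g (t, x) * fderiv ℝ ψ x (gu (t, x))) D.dx :=
        hD.integrable_dx (hgt.mul ((hψ1.continuous_fderiv one_ne_zero).clm_apply
          (contDiff_slice hgu.contDiff t).continuous))
      have j1 := hD.integrable_dS_mul (hgt.mul hψ.continuous)
      have j2 := hD.integrable_dS_mul (hrB.mul hψ.continuous)
      have j1' : Integrable (fun x => g (t, x) * (ψ x * D.normalFlux x)) D.dS := by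
        simpa only [Pi.mul_apply, mul_assoc] using j1
      have j2' : Integrable (fun x => rB x * (ψ x * D.normalFlux x)) D.dS := by
        simpa only [Pi.mul_apply, mul_assoc] using j2
      have j3 : Integrable (fun x => rB x * (ψ x * D.normalFlux x)
          - g (t, x) * (ψ x * D.normalFlux x)) D.dS := j2'.sub j1'
      have h3 := hD.setIntegral_outflow_add_inflow j1'
      have h4 : ∫ x, ψ x * b x ∂D.dS = (∫ x, g (t, x) * (ψ x * D.normalFlux x) ∂D.dS)
          + ((∫ x in D.inflow, rB x * (ψ x * D.normalFlux x) ∂D.dS)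
          - ∫ x in D.inflow, g (t, x) * (ψ x * D.normalFlux x) ∂D.dS) := by
        rw [← integral_sub j2'.restrict j1'.restrict, ← integral_indicator₀ hin,
          ← integral_add j1' (j3.indicator₀ hin)]
        refine integral_congr_ae (ae_of_all _ fun x => ?_)
        by_cases hx : x ∈ D.inflow
        · simp only [b, indicator_of_mem hx]; ring
        · simp only [b, indicator_of_notMem hx]; ring
      change _ = ∫ x, ψ x * b x ∂D.dS
      simp only [map_smul, smul_eq_mul]
      have e4 := integral_add i1 i2
      simp only [dx] at e4 h1 h2
      rw [e4, h4]
      linarith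
    have key' : ∀ᵐ x ∂D.dS, b x = inner ℝ (outerNormal D.Ω x) (g (t, x) • gu (t, x)) := key
    rw [ae_restrict_iff'₀ hin]
    filter_upwards [key', hS] with x hx hxS hxin
    rw [hbd t ht x hxS, inner_smul_right, real_inner_comm] at hx
    change b x = g (t, x) * D.normalFlux x at hx
    simp only [b, indicator_of_mem hxin] at hx
    have h5 : (rB x - g (t, x)) * D.normalFlux x = 0 := by linarith
    have h6 := (mul_eq_zero.1 h5).resolve_right (ne_of_lt hxin.2)
    linarith
  obtain ⟨s, hs, hsd⟩ := TopologicalSpace.exists_countable_dense (Icc 0 D.T)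
  have hall : ∀ᵐ x ∂(D.dS.restrict D.inflow), ∀ t ∈ s, g (t, x) = rB x :=
    (ae_ball_iff hs).2 fun t _ => hslice t t.2
  filter_upwards [hall] with x hx t ht
  have h1 : Continuous fun t : Icc 0 D.T => g (t, x) :=
    hg.contDiff.continuous.comp (continuous_subtype_val.prodMk continuous_const)
  have h2 := Continuous.ext_on hsd h1 continuous_const hx
  exact congrFun h2 ⟨t, ht⟩

end ProblemData

end ContinuityEquation

end Bifluid

namespace Bifluid

open Module

/-! ### Tensor algebra -/

section TensorAlgebra

variable {d : ℕ}

theorem entry_add (A B : Tensor d) (i j : Fin d) : entry (A + B) i j = entry A i j + entry B i j :=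
  rfl

theorem entry_smul (c : ℝ) (A : Tensor d) (i j : Fin d) : entry (c • A) i j = c * entry A i j := rfl

theorem entry_sub (A B : Tensor d) (i j : Fin d) : entry (A - B) i j = entry A i j - entry B i j :=
  rfl

theorem contract_add_left (A B C : Tensor d) : contract (A + B) C = contract A C + contract B C := by
  simp only [contract, entry_add, add_mul, Finset.sum_add_distrib]

theorem contract_smul_left (c : ℝ) (A B : Tensor d) : contract (c • A) B = c * contract A B := by
  simp only [contract, entry_smul, mul_assoc, Finset.mul_sum]

theorem contract_sub_right (A B C : Tensor d) : contract A (B - C) = contract A B - contract A C := by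
  simp only [contract, entry_sub, mul_sub, Finset.sum_sub_distrib]

theorem apply_coord (A : Tensor d) (v : Vec d) (i : Fin d) : A v i = ∑ j, entry A i j * v j := by
  rw [map_eq_sum_basisVec A v]
  simp [entry, mul_comm]

theorem inner_eq_sum (v w : Vec d) : inner ℝ v w = ∑ i, v i * w i := by
  simp [PiLp.inner_apply, mul_comm]

theorem inner_basisVec (v : Vec d) (j : Fin d) : inner ℝ v (basisVec j) = v j := by
  simp [basisVec, EuclideanSpace.inner_single_right]

theorem entry_tensorSq (v : Vec d) (i j : Fin d) : entry (tensorSq v) i j = v i * v j := by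
  change (inner ℝ v (basisVec j) • v) i = v i * v j
  rw [inner_basisVec, PiLp.smul_apply, smul_eq_mul, mul_comm]

theorem contract_tensorSq (v : Vec d) (A : Tensor d) : contract (tensorSq v) A = inner ℝ v (A v) := by
  rw [inner_eq_sum, contract]
  refine Finset.sum_congr rfl fun i _ => ?_
  rw [apply_coord, Finset.mul_sum]
  refine Finset.sum_congr rfl fun j _ => ?_
  rw [entry_tensorSq]; ring

theorem entry_id (i j : Fin d) :
    entry (ContinuousLinearMap.id ℝ (Vec d)) i j = if i = j then 1 else 0 := by
  simp [entry, basisVec]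

theorem contract_id (A : Tensor d) :
    contract (ContinuousLinearMap.id ℝ (Vec d)) A = tensorTrace A := by
  simp [contract, entry_id, tensorTrace]

theorem tensorTrace_sub (A B : Tensor d) : tensorTrace (A - B) = tensorTrace A - tensorTrace B := by
  simp only [tensorTrace, entry_sub, Finset.sum_sub_distrib]

theorem entry_adjoint (A : Tensor d) (i j : Fin d) :
    entry (ContinuousLinearMap.adjoint A) i j = entry A j i := by
  have h1 : ∀ v : Vec d, ∀ k, v k = inner ℝ (basisVec k) v := fun v k => by
    rw [real_inner_comm, inner_basisVec]
  rw [entry, entry, h1, ContinuousLinearMap.adjoint_inner_right, real_inner_comm, ← h1]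

theorem entry_stress_symm (mu lam : ℝ) (A : Tensor d) (i j : Fin d) :
    entry (stress mu lam A) i j = entry (stress mu lam A) j i := by
  simp only [stress, entry_add, entry_smul, entry_adjoint, entry_id, eq_comm (a := i) (b := j)]
  ring

variable {X : Type*} [TopologicalSpace X]

theorem continuous_entry {A : X → Tensor d} (hA : Continuous A) (i j : Fin d) :
    Continuous fun p => entry (A p) i j :=
  (EuclideanSpace.proj i : Vec d →L[ℝ] ℝ).continuous.comp (hA.clm_apply continuous_const)

theorem continuous_contract {A B : X → Tensor d} (hA : Continuous A) (hB : Continuous B) :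
    Continuous fun p => contract (A p) (B p) :=
  continuous_finsetSum _ fun i _ => continuous_finsetSum _ fun j _ =>
    (continuous_entry hA i j).mul (continuous_entry hB i j)

theorem continuous_tensorTrace {A : X → Tensor d} (hA : Continuous A) :
    Continuous fun p => tensorTrace (A p) :=
  continuous_finsetSum _ fun i _ => continuous_entry hA i i

theorem continuous_stress {A : X → Tensor d} (mu lam : ℝ) (hA : Continuous A) :
    Continuous fun p => stress mu lam (A p) :=
  ((hA.add ((LinearIsometryEquiv.continuous _).comp hA)).const_smul mu).add
    (((continuous_tensorTrace hA).const_mul lam).smul continuous_const)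

theorem continuous_tensorSq {v : X → Vec d} (hv : Continuous v) :
    Continuous fun p => tensorSq (v p) :=
  ((ContinuousLinearMap.smulRightL ℝ (Vec d) (Vec d)).continuous.comp
    ((innerSL ℝ).continuous.comp hv)).clm_apply hv

end TensorAlgebra

/-! ### Regular solutions: states, velocity and momentum at every time -/

namespace ProblemData

variable {d : ℕ} {D : ProblemData d}

/-- The integral over `(0,τ) × Ω`. -/
noncomputable def slab (D : ProblemData d) (τ : ℝ) (F : ℝ × Vec d → ℝ) : ℝ :=
  ∫ t in (0 : ℝ)..τ, ∫ x, F (t, x) ∂D.dx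

theorem Admissible.ae_mem_closure (hD : D.Admissible) : ∀ᵐ x ∂D.dx, x ∈ closure D.Ω :=
  hD.ae_mem.mono fun _ hx => subset_closure hx

theorem Admissible.continuous_integral (hD : D.Admissible) {F : ℝ × Vec d → ℝ} (hF : Continuous F) :
    Continuous fun t => ∫ x, F (t, x) ∂D.dx := by
  have := continuous_integral_slice hD.isCompact_closure hD.ae_mem_closure hF
    (hD.integrable_dx continuous_const (k := fun _ => 1))
  simpa only [mul_one] using this

theorem Admissible.integrable_slice (hD : D.Admissible) {F : ℝ × Vec d → ℝ} (hF : Continuous F)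
    (t : ℝ) : Integrable (fun x => F (t, x)) D.dx :=
  hD.integrable_dx (hF.comp (Continuous.prodMk_right t))

theorem Admissible.slab_add (hD : D.Admissible) {F G : ℝ × Vec d → ℝ} (hF : Continuous F)
    (hG : Continuous G) (τ : ℝ) : D.slab τ (fun p => F p + G p) = D.slab τ F + D.slab τ G := by
  rw [slab, slab, slab, ← intervalIntegral.integral_add
    ((hD.continuous_integral hF).intervalIntegrable _ _)
    ((hD.continuous_integral hG).intervalIntegrable _ _)]
  refine intervalIntegral.integral_congr fun t _ => ?_
  exact integral_add (hD.integrable_slice hF t) (hD.integrable_slice hG t)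

theorem Admissible.slab_sub (hD : D.Admissible) {F G : ℝ × Vec d → ℝ} (hF : Continuous F)
    (hG : Continuous G) (τ : ℝ) : D.slab τ (fun p => F p - G p) = D.slab τ F - D.slab τ G := by
  rw [slab, slab, slab, ← intervalIntegral.integral_sub
    ((hD.continuous_integral hF).intervalIntegrable _ _)
    ((hD.continuous_integral hG).intervalIntegrable _ _)]
  refine intervalIntegral.integral_congr fun t _ => ?_
  exact integral_sub (hD.integrable_slice hF t) (hD.integrable_slice hG t)

theorem Admissible.integral_sub_eq_slab (hD : D.Admissible) {F : ℝ × Vec d → ℝ}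
    (hF : ContDiff ℝ 1 F) (τ : ℝ) :
    (∫ x, F (τ, x) ∂D.dx) - ∫ x, F (0, x) ∂D.dx = D.slab τ (timeDeriv F) := by
  have := integral_slice_sub hD.isCompact_closure hD.ae_mem_closure hF
    (hD.integrable_dx continuous_const (k := fun _ => 1)) 0 τ
  simp only [mul_one] at this
  exact this

theorem ae_timeMeasure_imp {p : ℝ → Prop} (h : ∀ᵐ t ∂D.timeMeasure, p t) :
    ∀ᵐ t, t ∈ Ioc 0 D.T → p t := by
  rw [timeMeasure, Measure.restrict_congr_set Ioo_ae_eq_Ioc] at h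
  exact (ae_restrict_iff' measurableSet_Ioc).1 h

theorem slab_congr_ae {τ : ℝ} (hτ : τ ∈ Icc 0 D.T) {f : ℝ → Vec d → ℝ} {F : ℝ × Vec d → ℝ}
    (h : ∀ᵐ t ∂D.timeMeasure, ∀ᵐ x ∂D.dx, f t x = F (t, x)) :
    ∫ t in (0 : ℝ)..τ, ∫ x, f t x ∂D.dx = D.slab τ F := by
  refine intervalIntegral.integral_congr_ae ?_
  filter_upwards [ae_timeMeasure_imp h] with t ht hts
  rw [uIoc_of_le hτ.1] at hts
  exact integral_congr_ae (ht ⟨hts.1, hts.2.trans hτ.2⟩)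

theorem Admissible.slab_congr (hD : D.Admissible) {τ : ℝ} (hτ : τ ∈ Icc 0 D.T)
    {f : ℝ → Vec d → ℝ} {F : ℝ × Vec d → ℝ}
    (h : ∀ t ∈ Icc 0 D.T, ∀ x ∈ closure D.Ω, f t x = F (t, x)) :
    ∫ t in (0 : ℝ)..τ, ∫ x, f t x ∂D.dx = D.slab τ F :=
  slab_congr_ae hτ ((ae_restrict_mem measurableSet_Ioo).mono fun t ht =>
    hD.ae_mem_closure.mono fun x hx => h t (Ioo_subset_Icc_self ht) x hx)

/-- A turbulent solution with `C¹` extensions of the densities and the velocity. -/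
structure RegularSolution (D : ProblemData d) (γ : ℝ) (R Z : ℝ → Vec d → ℝ)
    (u : ℝ → Vec d → Vec d) (Du : ℝ → Vec d → Tensor d) (m : ℝ → Vec d → Vec d)
    (M : ℝ → Fin d → Fin d → SignedMeasure (closure D.Ω)) (E : ℝ → SignedMeasure (closure D.Ω))
    (gR gZ : ℝ × Vec d → ℝ) (gu : ℝ × Vec d → Vec d) : Prop where
  adm : D.Admissible
  sol : D.IsDissipativeTurbulentSolution γ R Z u Du m M E
  extR : IsC1Extension D.T D.Ω R gR
  extZ : IsC1Extension D.T D.Ω Z gZ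
  extu : IsC1Extension D.T D.Ω u gu
  inf : ∃ c : ℝ, 0 < c ∧ ∀ t ∈ Ioo 0 D.T, ∀ x ∈ D.Ω, c ≤ Z t x

namespace RegularSolution

variable {γ : ℝ} {R Z : ℝ → Vec d → ℝ} {u : ℝ → Vec d → Vec d} {Du : ℝ → Vec d → Tensor d}
  {m : ℝ → Vec d → Vec d} {M : ℝ → Fin d → Fin d → SignedMeasure (closure D.Ω)}
  {E : ℝ → SignedMeasure (closure D.Ω)} {gR gZ : ℝ × Vec d → ℝ} {gu : ℝ × Vec d → Vec d}

/-- The condition is closed and holds almost everywhere. The set of points of `Ω` where it fails is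
open and null, hence empty, and continuity reaches the boundary. -/
theorem state_mem (h : RegularSolution D γ R Z u Du m M E gR gZ gu) {t : ℝ} (ht : t ∈ Icc 0 D.T)
    {x : Vec d} (hx : x ∈ closure D.Ω) : (gR (t, x), gZ (t, x)) ∈ closure D.O := by
  have hc : Continuous fun x => (gR (t, x), gZ (t, x)) :=
    (h.extR.contDiff.continuous.comp (Continuous.prodMk_right t)).prodMk
      (h.extZ.contDiff.continuous.comp (Continuous.prodMk_right t))
  have hcl : IsClosed {x | (gR (t, x), gZ (t, x)) ∈ closure D.O} := isClosed_closure.preimage hc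
  have hsub : D.Ω ⊆ {x | (gR (t, x), gZ (t, x)) ∈ closure D.O} := fun x hx => by
    by_contra hcon
    have hU : IsOpen (D.Ω ∩ {x | (gR (t, x), gZ (t, x)) ∈ closure D.O}ᶜ) :=
      h.adm.domain.isOpen.inter hcl.isOpen_compl
    have hpos := hU.measure_pos volume ⟨x, hx, hcon⟩
    have h1 : ∀ᵐ x ∂D.dx, (gR (t, x), gZ (t, x)) ∈ closure D.O := by
      filter_upwards [h.sol.state t ht, h.adm.ae_mem_closure] with x hx hxc
      rwa [h.extR.eq t ht x hxc, h.extZ.eq t ht x hxc]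
    have h2 := (ae_restrict_iff' h.adm.domain.isOpen.measurableSet).1 h1
    refine hpos.ne' (measure_mono_null (fun y hy => ?_) h2)
    exact fun h3 => hy.2 (h3 hy.1)
  exact hcl.closure_subset_iff.2 hsub hx

theorem gZ_pos (h : RegularSolution D γ R Z u Du m M E gR gZ gu) {t : ℝ} (ht : t ∈ Icc 0 D.T)
    {x : Vec d} (hx : x ∈ closure D.Ω) : 0 < gZ (t, x) := by
  obtain ⟨c, hc, hcZ⟩ := h.inf
  have hcl : IsClosed {p : ℝ × Vec d | c ≤ gZ p} :=
    isClosed_le continuous_const h.extZ.contDiff.continuous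
  have hsub : Ioo 0 D.T ×ˢ D.Ω ⊆ {p : ℝ × Vec d | c ≤ gZ p} := fun p hp => by
    have h1 := hcZ p.1 hp.1 p.2 hp.2
    rwa [← h.extZ.eq p.1 (Ioo_subset_Icc_self hp.1) p.2 (subset_closure hp.2)] at h1
  have h2 := hcl.closure_subset_iff.2 hsub
  rw [closure_prod_eq, closure_Ioo h.adm.T_pos.ne] at h2
  exact hc.trans_le (h2 (⟨ht, hx⟩ : (t, x) ∈ Icc 0 D.T ×ˢ closure D.Ω))

/-- On the closed cone `Z ≤ b₂ R`, so positivity of `Z` forces that of `R`. -/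
theorem gR_pos (h : RegularSolution D γ R Z u Du m M E gR gZ gu) {t : ℝ} (ht : t ∈ Icc 0 D.T)
    {x : Vec d} (hx : x ∈ closure D.Ω) : 0 < gR (t, x) := by
  have h1 := (closure_stateCone_subset (h.state_mem ht hx)).2
  exact pos_of_mul_pos_right ((h.gZ_pos ht hx).trans_le h1)
    (h.adm.b₁_pos.trans h.adm.b₁_lt_b₂).le

theorem exists_pressure (h : RegularSolution D γ R Z u Du m M E gR gZ gu) :
    ∃ gP gq : ℝ × Vec d → ℝ, ContDiff ℝ 1 gP ∧ ContDiff ℝ 1 gq ∧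
      (∀ t ∈ Icc 0 D.T, ∀ x ∈ closure D.Ω, gP (t, x) = D.P (gR (t, x), gZ (t, x))) ∧
      (∀ t ∈ Icc 0 D.T, ∀ x ∈ closure D.Ω,
        D.H (gR (t, x)) (gZ (t, x)) = gR (t, x) * gq (t, x)) ∧
      ∀ t ∈ Icc 0 D.T, ∀ x ∈ closure D.Ω, ∀ v,
        gR (t, x) * fderiv ℝ gZ (t, x) v = gZ (t, x) * fderiv ℝ gR (t, x) v →
        fderiv ℝ gq (t, x) v = gP (t, x) / gR (t, x) ^ 2 * fderiv ℝ gR (t, x) v := by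
  obtain ⟨gP, gq, h1, h2, h3, h4, h5⟩ := exists_contDiff_pressure_helmholtz h.adm.b₁_lt_b₂
    h.adm.b₁_pos h.adm.P_C1 ((isCompact_Icc (a := 0) (b := D.T)).prod h.adm.isCompact_closure)
    h.extR.contDiff h.extZ.contDiff (fun p hp => h.state_mem hp.1 hp.2)
    (fun p hp => h.gZ_pos hp.1 hp.2)
  exact ⟨gP, gq, h1, h2, fun t ht x hx => h3 (t, x) ⟨ht, hx⟩, fun t ht x hx => h4 (t, x) ⟨ht, hx⟩,
    fun t ht x hx => h5 (t, x) ⟨ht, hx⟩⟩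

/-- For almost every time both claims come from `MemW012.of_contDiff`. The boundary values extend to
all times by continuity. -/
theorem velocity (h : RegularSolution D γ R Z u Du m M E gR gZ gu) :
    (∀ᵐ t ∂D.timeMeasure, ∀ᵐ x ∂D.dx, Du t x = spaceDeriv gu (t, x)) ∧
      ∀ t ∈ Icc 0 D.T, ∀ x ∈ frontier D.Ω, gu (t, x) = D.uB x := by
  have key : ∀ᵐ t ∂D.timeMeasure, (∀ᵐ x ∂D.dx, Du t x = spaceDeriv gu (t, x)) ∧
      ∀ x ∈ frontier D.Ω, gu (t, x) = D.uB x := by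
    filter_upwards [h.sol.vel_W012, ae_restrict_mem measurableSet_Ioo] with t ht htI
    have hgu := contDiff_slice h.extu.contDiff t
    have h1 := ht.of_contDiff h.adm.domain (g := fun x => gu (t, x) - D.uB x)
      (hgu.sub h.adm.uB_C1) fun x hx => by
        simp only [h.extu.eq t (Ioo_subset_Icc_self htI) x (subset_closure hx)]
    refine ⟨?_, fun x hx => sub_eq_zero.1 (h1.2 x hx)⟩
    filter_upwards [h1.1] with x hx
    have h2 : fderiv ℝ (fun x => gu (t, x) - D.uB x) x = _ :=
      ((hgu.differentiable one_ne_zero x).hasFDerivAt.sub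
        (h.adm.uB_C1.differentiable one_ne_zero x).hasFDerivAt).fderiv
    rw [h2, sub_left_inj] at hx
    rw [hx]
    exact fderiv_slice (p := (t, x)) (h.extu.contDiff.differentiable one_ne_zero _)
  refine ⟨key.mono fun t ht => ht.1, fun t ht x hx => ?_⟩
  have h1 : (fun t => gu (t, x)) =ᵐ[volume.restrict (Icc 0 D.T)] fun _ => D.uB x := by
    rw [Measure.restrict_congr_set Ioo_ae_eq_Icc.symm]
    exact key.mono fun t ht => ht.2 x hx
  exact Measure.eqOn_Icc_of_ae_eq volume h.adm.T_pos.ne h1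
    (h.extu.contDiff.continuous.comp (Continuous.prodMk_left x)).continuousOn
    continuousOn_const ht

theorem ae_ae_cylinder (h : RegularSolution D γ R Z u Du m M E gR gZ gu) {p : ℝ × Vec d → Prop}
    (hp : ∀ᵐ z ∂D.cylinderMeasure, p z) :
    ∀ᵐ t ∂D.timeMeasure, ∀ᵐ x ∂D.dx, p (t, x) := by
  have : IsFiniteMeasure D.dx := h.adm.domain.isFiniteMeasure_volume
  rw [cylinderMeasure, Measure.volume_eq_prod, ← Measure.prod_restrict] at hp
  exact Measure.ae_ae_of_ae_prod hp

/-- The hypothesis identifies `m` with `(R + Z) u` only almost everywhere in space-time. Against a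
fixed continuous test field with compact support both sides are continuous in time, so they agree at
every time. -/
theorem momentum_ae_eq (h : RegularSolution D γ R Z u Du m M E gR gZ gu) {t : ℝ}
    (ht : t ∈ Icc 0 D.T) : ∀ᵐ x ∂D.dx, m t x = (gR (t, x) + gZ (t, x)) • gu (t, x) := by
  have hfin : IsFiniteMeasure D.dx := h.adm.domain.isFiniteMeasure_volume
  let gm : ℝ × Vec d → Vec d := fun p => (gR p + gZ p) • gu p
  have hgm : Continuous gm := (h.extR.contDiff.continuous.add h.extZ.contDiff.continuous).smul
    h.extu.contDiff.continuous
  have hγ := h.sol.one_lt_γ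
  -- This is equivalent to `γ > 1`. An exponent above 1 has a conjugate exponent, in whose dual
  -- class weak continuity is tested.
  have hp : 1 < 2 * γ / (γ + 1) := by
    rw [lt_div_iff₀ (by linarith)]; linarith
  have hpq := Real.HolderConjugate.conjExponent hp
  have hae : ∀ᵐ s ∂D.timeMeasure, ∀ᵐ x ∂D.dx, m s x = gm (s, x) := by
    filter_upwards [h.ae_ae_cylinder h.sol.m_eq, ae_restrict_mem measurableSet_Ioo] with s hs hsI
    filter_upwards [hs, h.adm.ae_mem_closure] with x hx hxc
    have hsI' := Ioo_subset_Icc_self hsI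
    rw [hx]
    simp only [gm, h.extR.eq s hsI' x hxc, h.extZ.eq s hsI' x hxc, h.extu.eq s hsI' x hxc]
  have htest : ∀ η : Vec d → Vec d, Continuous η → HasCompactSupport η →
      ∫ x, inner ℝ (m t x) (η x) ∂D.dx = ∫ x, inner ℝ (gm (t, x)) (η x) ∂D.dx := fun η hη hηc => by
    have hc1 := h.sol.m_weak.continuous _ hpq η ((hη.memLp_of_hasCompactSupport hηc).restrict D.Ω)
    have hc2 := h.adm.continuous_integral (F := fun p : ℝ × Vec d => inner ℝ (gm p) (η p.2))
      (hgm.inner (hη.comp continuous_snd))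
    refine Measure.eqOn_Icc_of_ae_eq volume h.adm.T_pos.ne ?_ hc1 hc2.continuousOn ht
    rw [Measure.restrict_congr_set Ioo_ae_eq_Icc.symm]
    exact hae.mono fun s hs => integral_congr_ae (hs.mono fun x hx => by simp only [hx])
  have hint : Integrable (m t) D.dx :=
    MemLp.integrable (μ := D.dx) (q := ENNReal.ofReal (2 * γ / (γ + 1))) (by
      rw [← ENNReal.ofReal_one]; exact ENNReal.ofReal_le_ofReal hp.le)
      (h.sol.m_weak.memLp t ht)
  have hgmt : Continuous fun x => gm (t, x) := hgm.comp (Continuous.prodMk_right t)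
  have hi : ∀ i, ∀ᵐ x ∂D.dx, m t x i - gm (t, x) i = 0 := fun i => by
    have i1 : Integrable (fun x => m t x i) D.dx :=
      (EuclideanSpace.proj i : Vec d →L[ℝ] ℝ).integrable_comp hint
    have hgi : Continuous fun x => gm (t, x) i :=
      (EuclideanSpace.proj i : Vec d →L[ℝ] ℝ).continuous.comp hgmt
    have i2 : Integrable (fun x => gm (t, x) i) D.dx := h.adm.integrable_dx hgi
    have i3 : IntegrableOn (fun x => m t x i - gm (t, x) i) D.Ω := i1.sub i2
    have h1 := h.adm.domain.isOpen.ae_eq_zero_of_integral_contDiff_smul_eq_zero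
      (μ := (volume : Measure (Vec d))) i3.locallyIntegrableOn fun ψ hψ hψc hψs => ?_
    · exact (ae_restrict_iff' h.adm.domain.isOpen.measurableSet).2 h1
    rw [← setIntegral_eq_integral_of_forall_compl_eq_zero (s := D.Ω) fun x hx => by
      rw [image_eq_zero_of_notMem_tsupport fun h => hx (hψs h), zero_smul]]
    have h2 := htest (fun x => ψ x • basisVec i) (hψ.continuous.smul continuous_const)
      hψc.smul_right
    obtain ⟨C, hC⟩ := hψc.exists_bound_of_continuous hψ.continuous
    have e : ∀ v : Vec d, ∀ c : ℝ, inner ℝ v (c • (basisVec i : Vec d)) = c * v i := fun v c => by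
      rw [inner_smul_right, inner_basisVec]
    simp only [e] at h2
    have j1 := i1.bdd_mul (f := ψ) hψ.continuous.aestronglyMeasurable (ae_of_all _ hC)
    have j2 := i2.bdd_mul (f := ψ) hψ.continuous.aestronglyMeasurable (ae_of_all _ hC)
    simp only [smul_eq_mul, mul_sub]
    exact (integral_sub j1 j2).trans (sub_eq_zero.2 h2)
  filter_upwards [ae_all_iff.2 hi] with x hx
  ext i
  exact sub_eq_zero.1 (hx i)

end RegularSolution

end ProblemData

end Bifluid

namespace Bifluid

open Module

/-! ### Material derivatives and the tested momentum equation -/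

section SpaceTimeDerivatives

variable {d : ℕ}

theorem fderiv_one_mk {F : Type*} [NormedAddCommGroup F] [NormedSpace ℝ F] (f : ℝ × Vec d → F)
    (p : ℝ × Vec d) (v : Vec d) :
    fderiv ℝ f p ((1 : ℝ), v) = timeDeriv f p + spaceDeriv f p v := by
  have h : ((1 : ℝ), v) = ((1 : ℝ), (0 : Vec d)) + ((0 : ℝ), v) := by simp
  rw [h, map_add]
  rfl

theorem timeDeriv_eq_of_hasDerivAt {F : Type*} [NormedAddCommGroup F] [NormedSpace ℝ F]
    {f : ℝ × Vec d → F} {t : ℝ} {x : Vec d} {f' : F} (hf : DifferentiableAt ℝ f (t, x))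
    (h : HasDerivAt (fun s => f (s, x)) f' t) : timeDeriv f (t, x) = f' :=
  (hasDerivAt_slice hf).unique h

theorem spaceDeriv_eq_of_hasFDerivAt {F : Type*} [NormedAddCommGroup F] [NormedSpace ℝ F]
    {f : ℝ × Vec d → F} {t : ℝ} {x : Vec d} {f' : Vec d →L[ℝ] F}
    (hf : DifferentiableAt ℝ f (t, x)) (h : HasFDerivAt (fun y => f (t, y)) f' x) :
    spaceDeriv f (t, x) = f' := by
  rw [← fderiv_slice (p := (t, x)) hf]
  exact h.fderiv

theorem hasFDerivAt_slice {F : Type*} [NormedAddCommGroup F] [NormedSpace ℝ F] {g : ℝ × Vec d → F}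
    {t : ℝ} {x : Vec d} (hg : DifferentiableAt ℝ g (t, x)) :
    HasFDerivAt (fun y => g (t, y)) (spaceDeriv g (t, x)) x :=
  HasFDerivAt.comp x (f := fun y : Vec d => (t, y)) (g := g) hg.hasFDerivAt
    (hasFDerivAt_prodMk_right t x)

end SpaceTimeDerivatives

namespace ProblemData

variable {d : ℕ} {D : ProblemData d}

/-- `C¹` versions of the pressure and of `H/R` along the densities `gR`, `gZ`. -/
structure PressureExtension (D : ProblemData d) (gR gZ gP gq : ℝ × Vec d → ℝ) : Prop where
  contDiff_P : ContDiff ℝ 1 gP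
  contDiff_q : ContDiff ℝ 1 gq
  P_eq : ∀ t ∈ Icc 0 D.T, ∀ x ∈ closure D.Ω, gP (t, x) = D.P (gR (t, x), gZ (t, x))
  H_eq : ∀ t ∈ Icc 0 D.T, ∀ x ∈ closure D.Ω,
    D.H (gR (t, x)) (gZ (t, x)) = gR (t, x) * gq (t, x)
  fderiv_q : ∀ t ∈ Icc 0 D.T, ∀ x ∈ closure D.Ω, ∀ v,
    gR (t, x) * fderiv ℝ gZ (t, x) v = gZ (t, x) * fderiv ℝ gR (t, x) v →
    fderiv ℝ gq (t, x) v = gP (t, x) / gR (t, x) ^ 2 * fderiv ℝ gR (t, x) v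

theorem WeakContinuity.pointwise {r : ℝ → Vec d → ℝ} {rB : Vec d → ℝ}
    {u : ℝ → Vec d → Vec d} (h : D.WeakContinuity r rB u) (hD : D.Admissible)
    {g : ℝ × Vec d → ℝ} {gu : ℝ × Vec d → Vec d}
    (hg : IsC1Extension D.T D.Ω r g) (hgu : IsC1Extension D.T D.Ω u gu)
    {t : ℝ} (ht : t ∈ Icc 0 D.T) {x : Vec d} (hx : x ∈ closure D.Ω) :
    timeDeriv g (t, x) + spaceDeriv g (t, x) (gu (t, x))
      = - (g (t, x) * tensorTrace (spaceDeriv gu (t, x))) := by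
  have h1 := h.timeDeriv_add_divergence hD hg hgu ht x hx
  have hgd := hg.contDiff.differentiable one_ne_zero (t, x)
  have hgud := hgu.contDiff.differentiable one_ne_zero (t, x)
  rw [divergence_smul (hasFDerivAt_slice hgd).differentiableAt
    (hasFDerivAt_slice hgud).differentiableAt, divergence, (hasFDerivAt_slice hgd).fderiv,
    (hasFDerivAt_slice hgud).fderiv] at h1
  linarith

namespace RegularSolution

variable {γ : ℝ} {R Z : ℝ → Vec d → ℝ} {u : ℝ → Vec d → Vec d} {Du : ℝ → Vec d → Tensor d}
  {m : ℝ → Vec d → Vec d} {M : ℝ → Fin d → Fin d → SignedMeasure (closure D.Ω)}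
  {E : ℝ → SignedMeasure (closure D.Ω)} {gR gZ gP gq : ℝ × Vec d → ℝ} {gu : ℝ × Vec d → Vec d}

theorem mass_R (h : RegularSolution D γ R Z u Du m M E gR gZ gu) {t : ℝ} (ht : t ∈ Icc 0 D.T)
    {x : Vec d} (hx : x ∈ closure D.Ω) :
    timeDeriv gR (t, x) + spaceDeriv gR (t, x) (gu (t, x))
      = - (gR (t, x) * tensorTrace (spaceDeriv gu (t, x))) :=
  h.sol.continuity_R.pointwise h.adm h.extR h.extu ht hx

theorem mass_Z (h : RegularSolution D γ R Z u Du m M E gR gZ gu) {t : ℝ} (ht : t ∈ Icc 0 D.T)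
    {x : Vec d} (hx : x ∈ closure D.Ω) :
    timeDeriv gZ (t, x) + spaceDeriv gZ (t, x) (gu (t, x))
      = - (gZ (t, x) * tensorTrace (spaceDeriv gu (t, x))) :=
  h.sol.continuity_Z.pointwise h.adm h.extZ h.extu ht hx

/-- The two densities have the same logarithmic material derivative `-div u`, so the ratio `Z/R` is
stationary in the direction `(1, u)`. There `dq = P / R² dR`, and the material derivative of `R` is
`-R div u`. -/
theorem transport_q (h : RegularSolution D γ R Z u Du m M E gR gZ gu)
    (hp : PressureExtension D gR gZ gP gq) {t : ℝ} (ht : t ∈ Icc 0 D.T)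
    {x : Vec d} (hx : x ∈ closure D.Ω) :
    gR (t, x) * (timeDeriv gq (t, x) + spaceDeriv gq (t, x) (gu (t, x)))
      = - (gP (t, x) * tensorTrace (spaceDeriv gu (t, x))) := by
  have hne := (h.gR_pos ht hx).ne'
  have h1 := hp.fderiv_q t ht x hx ((1 : ℝ), gu (t, x)) (by
    rw [fderiv_one_mk, fderiv_one_mk, h.mass_R ht hx, h.mass_Z ht hx]; ring)
  rw [fderiv_one_mk, fderiv_one_mk, h.mass_R ht hx] at h1
  rw [h1]
  field_simp

/-- The integrand of the momentum equation tested with `φ`, after integration by parts in time. -/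
noncomputable def momentumDensity (D : ProblemData d) (gR gZ gP : ℝ × Vec d → ℝ)
    (gu φ : ℝ × Vec d → Vec d) (p : ℝ × Vec d) : ℝ :=
  inner ℝ (timeDeriv (fun p => (gR p + gZ p) • gu p) p) (φ p)
    - contract ((gR p + gZ p) • tensorSq (gu p)) (spaceDeriv φ p)
    - gP p * tensorTrace (spaceDeriv φ p)
    + contract (D.S (spaceDeriv gu p)) (spaceDeriv φ p)

theorem contDiff_momentum (h : RegularSolution D γ R Z u Du m M E gR gZ gu) :
    ContDiff ℝ 1 fun p => (gR p + gZ p) • gu p :=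
  (h.extR.contDiff.add h.extZ.contDiff).smul h.extu.contDiff

theorem continuous_convection (h : RegularSolution D γ R Z u Du m M E gR gZ gu) :
    Continuous fun p => (gR p + gZ p) • tensorSq (gu p) :=
  (h.extR.contDiff.continuous.add h.extZ.contDiff.continuous).smul
    (continuous_tensorSq h.extu.contDiff.continuous)

theorem continuous_S (h : RegularSolution D γ R Z u Du m M E gR gZ gu) :
    Continuous fun p => D.S (spaceDeriv gu p) :=
  continuous_stress _ _ (continuous_spaceDeriv h.extu.contDiff)

theorem continuous_momentumDensity (h : RegularSolution D γ R Z u Du m M E gR gZ gu)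
    (hp : PressureExtension D gR gZ gP gq) {φ : ℝ × Vec d → Vec d} (hφ : ContDiff ℝ 1 φ) :
    Continuous (momentumDensity D gR gZ gP gu φ) := by
  have hs := continuous_spaceDeriv hφ
  exact ((((continuous_timeDeriv h.contDiff_momentum).inner hφ.continuous).sub
    (continuous_contract h.continuous_convection hs)).sub
    (hp.contDiff_P.continuous.mul (continuous_tensorTrace hs))).add
    (continuous_contract h.continuous_S hs)

/-- As the momentum is `C¹`, the terms at the times `0` and `τ` form the integral of a time
derivative. This moves the derivative from the test field to the momentum, and only the Reynolds
defect remains on the right. -/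
theorem slab_momentumDensity (h : RegularSolution D γ R Z u Du m M E gR gZ gu)
    (hp : PressureExtension D gR gZ gP gq) {φ : ℝ × Vec d → Vec d} (hφ : ContDiff ℝ 1 φ)
    (hφ0 : ∀ t ∈ Icc 0 D.T, ∀ x ∈ frontier D.Ω, φ (t, x) = 0) {τ : ℝ} (hτ : τ ∈ Icc 0 D.T) :
    D.slab τ (momentumDensity D gR gZ gP gu φ)
      = ∫ t in (0 : ℝ)..τ, tensorPairing (fun x => spaceDeriv φ (t, x)) (M t) := by
  have h1 := h.sol.momentum φ hφ hφ0 τ hτ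
  have hgm := h.contDiff_momentum
  have hs := continuous_spaceDeriv hφ
  have e0 : ∀ s ∈ Icc 0 D.T, ∫ x, inner ℝ (m s x) (φ (s, x)) ∂D.dx
      = ∫ x, inner ℝ ((gR (s, x) + gZ (s, x)) • gu (s, x)) (φ (s, x)) ∂D.dx := fun s hs =>
    integral_congr_ae ((h.momentum_ae_eq hs).mono fun x hx => by simp only [hx])
  have hin : ContDiff ℝ 1 fun p : ℝ × Vec d => inner ℝ ((gR p + gZ p) • gu p) (φ p) :=
    hgm.inner ℝ hφ
  have e1 := h.adm.integral_sub_eq_slab hin τ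
  let A : ℝ × Vec d → ℝ := fun p => (gR p + gZ p) * inner ℝ (gu p) (timeDeriv φ p)
  let F : ℝ × Vec d → ℝ := fun p => A p
    + contract ((gR p + gZ p) • tensorSq (gu p)) (spaceDeriv φ p)
    + gP p * tensorTrace (spaceDeriv φ p)
    - contract (D.S (spaceDeriv gu p)) (spaceDeriv φ p)
  have hA : Continuous A := (h.extR.contDiff.continuous.add h.extZ.contDiff.continuous).mul
    (h.extu.contDiff.continuous.inner (continuous_timeDeriv hφ))
  have hF : Continuous F := ((hA.add (continuous_contract h.continuous_convection hs)).add
    (hp.contDiff_P.continuous.mul (continuous_tensorTrace hs))).sub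
    (continuous_contract h.continuous_S hs)
  have e2 : timeDeriv (fun p : ℝ × Vec d => inner ℝ ((gR p + gZ p) • gu p) (φ p))
      = fun p => momentumDensity D gR gZ gP gu φ p + F p := by
    funext p
    have h2 := timeDeriv_eq_of_hasDerivAt (t := p.1) (x := p.2)
      (hin.differentiable one_ne_zero _)
      ((hasDerivAt_slice (hgm.differentiable one_ne_zero _)).inner ℝ
        (hasDerivAt_slice (hφ.differentiable one_ne_zero _)))
    refine h2.trans ?_
    simp only [momentumDensity, F, A, real_inner_smul_left]
    ring
  have e3 := slab_congr_ae (D := D) hτ (F := F) (f := fun t x =>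
      (R t x + Z t x) * inner ℝ (u t x) (timeDeriv φ (t, x))
          + contract ((R t x + Z t x) • tensorSq (u t x)) (spaceDeriv φ (t, x))
          + D.P (R t x, Z t x) * tensorTrace (spaceDeriv φ (t, x))
          - contract (D.S (Du t x)) (spaceDeriv φ (t, x))) (by
    filter_upwards [h.velocity.1, ae_restrict_mem measurableSet_Ioo] with t ht htI
    filter_upwards [ht, h.adm.ae_mem_closure] with x hx hxc
    have htI' := Ioo_subset_Icc_self htI
    simp only [F, A, hx, ← h.extR.eq t htI' x hxc, ← h.extZ.eq t htI' x hxc,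
      ← h.extu.eq t htI' x hxc, hp.P_eq t htI' x hxc])
  rw [e0 τ hτ, e0 0 ⟨le_rfl, h.adm.T_pos.le⟩, e1, e2,
    h.adm.slab_add (h.continuous_momentumDensity hp hφ) hF, e3] at h1
  linarith

end RegularSolution

end ProblemData

end Bifluid

namespace Bifluid

open Module

/-! ### The pointwise energy balance -/

namespace ProblemData

variable {d : ℕ} {D : ProblemData d}

namespace RegularSolution

variable {γ : ℝ} {R Z : ℝ → Vec d → ℝ} {u : ℝ → Vec d → Vec d} {Du : ℝ → Vec d → Tensor d}
  {m : ℝ → Vec d → Vec d} {M : ℝ → Fin d → Fin d → SignedMeasure (closure D.Ω)}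
  {E : ℝ → SignedMeasure (closure D.Ω)} {gR gZ gP gq : ℝ × Vec d → ℝ} {gu : ℝ × Vec d → Vec d}

/-- The energy density relative to the boundary velocity. -/
noncomputable def energyDensity (D : ProblemData d) (gR gZ gq : ℝ × Vec d → ℝ)
    (gu : ℝ × Vec d → Vec d) (p : ℝ × Vec d) : ℝ :=
  1 / 2 * (gR p + gZ p) * ‖gu p - D.uB p.2‖ ^ 2 + gR p * gq p

/-- The work of the boundary velocity. -/
noncomputable def boundaryWork (D : ProblemData d) (gR gZ gP : ℝ × Vec d → ℝ)
    (gu : ℝ × Vec d → Vec d) (p : ℝ × Vec d) : ℝ :=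
  contract (D.S (spaceDeriv gu p)) (spaceDeriv gu p)
    + contract ((gR p + gZ p) • tensorSq (gu p) + gP p • ContinuousLinearMap.id ℝ (Vec d))
        (fderiv ℝ D.uB p.2)
    - (gR p + gZ p) * inner ℝ (fderiv ℝ D.uB p.2 (gu p)) (D.uB p.2)
    - contract (D.S (spaceDeriv gu p)) (fderiv ℝ D.uB p.2)

theorem contDiff_uB (hD : D.Admissible) : ContDiff ℝ 1 fun p : ℝ × Vec d => D.uB p.2 :=
  hD.uB_C1.comp contDiff_snd

theorem contDiff_energyDensity (h : RegularSolution D γ R Z u Du m M E gR gZ gu)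
    (hp : PressureExtension D gR gZ gP gq) : ContDiff ℝ 1 (energyDensity D gR gZ gq gu) :=
  ((contDiff_const.mul (h.extR.contDiff.add h.extZ.contDiff)).mul
    ((h.extu.contDiff.sub (contDiff_uB h.adm)).norm_sq ℝ)).add (h.extR.contDiff.mul hp.contDiff_q)

theorem spaceDeriv_comp_snd {f : Vec d → Vec d} (hf : ContDiff ℝ 1 f) (p : ℝ × Vec d) :
    spaceDeriv (fun p : ℝ × Vec d => f p.2) p = fderiv ℝ f p.2 :=
  spaceDeriv_eq_of_hasFDerivAt (t := p.1) (x := p.2)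
    ((hf.comp contDiff_snd).differentiable one_ne_zero _)
    (hf.differentiable one_ne_zero _).hasFDerivAt

theorem spaceDeriv_sub_uB (h : RegularSolution D γ R Z u Du m M E gR gZ gu) (p : ℝ × Vec d) :
    spaceDeriv (fun p => gu p - D.uB p.2) p = spaceDeriv gu p - fderiv ℝ D.uB p.2 :=
  spaceDeriv_eq_of_hasFDerivAt (t := p.1) (x := p.2)
    ((h.extu.contDiff.sub (contDiff_uB h.adm)).differentiable one_ne_zero _)
    ((hasFDerivAt_slice (h.extu.contDiff.differentiable one_ne_zero _)).sub
      (h.adm.uB_C1.differentiable one_ne_zero _).hasFDerivAt)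

/-- The half difference of the squared speeds. -/
noncomputable def speedGap (D : ProblemData d) (gu : ℝ × Vec d → Vec d) (t : ℝ) (x : Vec d) : ℝ :=
  1 / 2 * ‖D.uB x‖ ^ 2 - 1 / 2 * ‖gu (t, x)‖ ^ 2

theorem contDiff_speedGap (h : RegularSolution D γ R Z u Du m M E gR gZ gu) (t : ℝ) :
    ContDiff ℝ 1 (speedGap D gu t) :=
  (contDiff_const.mul (h.adm.uB_C1.norm_sq ℝ)).sub
    (contDiff_const.mul ((contDiff_slice h.extu.contDiff t).norm_sq ℝ))

theorem fderiv_speedGap (h : RegularSolution D γ R Z u Du m M E gR gZ gu) (t : ℝ) (x v : Vec d) :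
    fderiv ℝ (speedGap D gu t) x v = inner ℝ (D.uB x) (fderiv ℝ D.uB x v)
      - inner ℝ (gu (t, x)) (spaceDeriv gu (t, x) v) := by
  have h1 := ((h.adm.uB_C1.differentiable one_ne_zero x).hasFDerivAt.norm_sq.const_mul (1 / 2)).sub
    ((hasFDerivAt_slice (h.extu.contDiff.differentiable one_ne_zero
      (t, x))).norm_sq.const_mul (1 / 2))
  have h2 : fderiv ℝ (speedGap D gu t) x = _ := h1.fderiv
  rw [h2]
  simp

theorem timeDeriv_energyDensity (h : RegularSolution D γ R Z u Du m M E gR gZ gu)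
    (hp : PressureExtension D gR gZ gP gq) (p : ℝ × Vec d) :
    timeDeriv (energyDensity D gR gZ gq gu) p
      = 1 / 2 * (timeDeriv gR p + timeDeriv gZ p) * ‖gu p - D.uB p.2‖ ^ 2
        + (gR p + gZ p) * inner ℝ (gu p - D.uB p.2) (timeDeriv gu p)
        + (timeDeriv gR p * gq p + gR p * timeDeriv gq p) := by
  have hR := hasDerivAt_slice (h.extR.contDiff.differentiable one_ne_zero (p.1, p.2))
  have hZ := hasDerivAt_slice (h.extZ.contDiff.differentiable one_ne_zero (p.1, p.2))
  have hu := hasDerivAt_slice (h.extu.contDiff.differentiable one_ne_zero (p.1, p.2))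
  have hq := hasDerivAt_slice (hp.contDiff_q.differentiable one_ne_zero (p.1, p.2))
  refine (timeDeriv_eq_of_hasDerivAt (t := p.1) (x := p.2)
    ((h.contDiff_energyDensity hp).differentiable one_ne_zero _)
    ((((hR.add hZ).const_mul (1 / 2)).mul (hu.sub_const (D.uB p.2)).norm_sq).add
      (hR.mul hq))).trans ?_
  simp only [Pi.add_apply]
  ring

theorem timeDeriv_momentum (h : RegularSolution D γ R Z u Du m M E gR gZ gu) (p : ℝ × Vec d) :
    timeDeriv (fun p => (gR p + gZ p) • gu p) p
      = (gR p + gZ p) • timeDeriv gu p + (timeDeriv gR p + timeDeriv gZ p) • gu p := by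
  have hR := hasDerivAt_slice (h.extR.contDiff.differentiable one_ne_zero (p.1, p.2))
  have hZ := hasDerivAt_slice (h.extZ.contDiff.differentiable one_ne_zero (p.1, p.2))
  have hu := hasDerivAt_slice (h.extu.contDiff.differentiable one_ne_zero (p.1, p.2))
  exact timeDeriv_eq_of_hasDerivAt (t := p.1) (x := p.2)
    (h.contDiff_momentum.differentiable one_ne_zero _) ((hR.add hZ).smul hu)

/-- The pointwise form of the energy balance relative to the momentum balance. -/
theorem energy_balance_pointwise (h : RegularSolution D γ R Z u Du m M E gR gZ gu)
    (hp : PressureExtension D gR gZ gP gq) {t : ℝ} (ht : t ∈ Icc 0 D.T)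
    {x : Vec d} (hx : x ∈ closure D.Ω) :
    timeDeriv (energyDensity D gR gZ gq gu) (t, x) + boundaryWork D gR gZ gP gu (t, x)
      - momentumDensity D gR gZ gP gu (fun p => gu p - D.uB p.2) (t, x)
    = (timeDeriv gR (t, x) * speedGap D gu t x
        - gR (t, x) * fderiv ℝ (speedGap D gu t) x (gu (t, x)))
      + (timeDeriv gZ (t, x) * speedGap D gu t x
        - gZ (t, x) * fderiv ℝ (speedGap D gu t) x (gu (t, x)))
      + (timeDeriv gR (t, x) * gq (t, x)
        - gR (t, x) * fderiv ℝ (fun y => gq (t, y)) x (gu (t, x))) := by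
  -- Only the transport of `q` is used here; the continuity equations stay untouched in the brackets
  -- on the right. The weight `speedGap` arises as the coefficient of the time derivative of `R +
  -- Z`: `½|u - u_B|²` from the energy minus `u · (u - u_B)` from the momentum equals `½|u_B|² -
  -- ½|u|²`.
  have hq := h.transport_q hp ht hx
  rw [(hasFDerivAt_slice (hp.contDiff_q.differentiable one_ne_zero (t, x))).fderiv,
    h.fderiv_speedGap, h.timeDeriv_energyDensity hp, momentumDensity, boundaryWork,
    h.timeDeriv_momentum, h.spaceDeriv_sub_uB]
  simp only [contract_sub_right, contract_add_left, contract_smul_left, contract_tensorSq,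
    contract_id, tensorTrace_sub, speedGap, ← real_inner_self_eq_norm_sq, inner_add_left,
    inner_sub_left, inner_sub_right, real_inner_smul_left]
  rw [real_inner_comm (gu (t, x)) (D.uB x), real_inner_comm (gu (t, x)) (timeDeriv gu (t, x)),
    real_inner_comm (D.uB x) (fderiv ℝ D.uB x (gu (t, x)))] at *
  rw [real_inner_comm (timeDeriv gu (t, x)) (D.uB x)]
  linear_combination hq

end RegularSolution

end ProblemData

end Bifluid

namespace Bifluid

open Module

/-! ### The integrated balance and the inequality for the energy defect -/

namespace ProblemData

variable {d : ℕ} {D : ProblemData d}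

namespace RegularSolution

variable {γ : ℝ} {R Z : ℝ → Vec d → ℝ} {u : ℝ → Vec d → Vec d} {Du : ℝ → Vec d → Tensor d}
  {m : ℝ → Vec d → Vec d} {M : ℝ → Fin d → Fin d → SignedMeasure (closure D.Ω)}
  {E : ℝ → SignedMeasure (closure D.Ω)} {gR gZ gP gq : ℝ × Vec d → ℝ} {gu : ℝ × Vec d → Vec d}

theorem ae_inflow (h : RegularSolution D γ R Z u Du m M E gR gZ gu) :
    ∀ᵐ x ∂(D.dS.restrict D.inflow), ∀ t ∈ Icc 0 D.T, gR (t, x) = D.RB x ∧ gZ (t, x) = D.ZB x := by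
  filter_upwards [h.sol.continuity_R.ae_eq_inflow h.adm h.extR h.extu h.adm.RB_cont h.velocity.2,
    h.sol.continuity_Z.ae_eq_inflow h.adm h.extZ h.extu h.adm.ZB_cont h.velocity.2]
    with x h1 h2 t ht using ⟨h1 t ht, h2 t ht⟩

/-- The weight vanishes on the boundary because `u = u_B` there, so no boundary value of the density
enters. -/
theorem integral_speedGap (h : RegularSolution D γ R Z u Du m M E gR gZ gu) {r : ℝ → Vec d → ℝ}
    {rB : Vec d → ℝ} {g : ℝ × Vec d → ℝ} (hr : D.WeakContinuity r rB u)
    (hg : IsC1Extension D.T D.Ω r g) {t : ℝ} (ht : t ∈ Icc 0 D.T) :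
    (∫ x, timeDeriv g (t, x) * speedGap D gu t x ∂D.dx)
      - ∫ x, g (t, x) * fderiv ℝ (speedGap D gu t) x (gu (t, x)) ∂D.dx = 0 := by
  have h1 := hr.slice h.adm hg h.extu (h.contDiff_speedGap t) ht
  have hz : ∀ᵐ x ∂D.dS, speedGap D gu t x = 0 := ae_dS_mem_frontier.mono fun x hx => by
    rw [speedGap, h.velocity.2 t ht x hx, sub_self]
  have e1 : ∫ x in D.outflow, g (t, x) * (speedGap D gu t x * D.normalFlux x) ∂D.dS = 0 :=
    integral_eq_zero_of_ae ((ae_restrict_of_ae hz).mono fun x hx => by simp [hx])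
  have e2 : ∫ x in D.inflow, rB x * (speedGap D gu t x * D.normalFlux x) ∂D.dS = 0 :=
    integral_eq_zero_of_ae ((ae_restrict_of_ae hz).mono fun x hx => by simp [hx])
  rw [e1, e2] at h1
  linarith

/-- After integration the brackets with `speedGap` vanish. The bracket with `q` is the continuity
equation for `R` tested with `q`. On the inflow part its boundary term is `R_B q`, which is `H(R_B,
Z_B)` because the densities attain their boundary values there. -/
theorem energy_balance (h : RegularSolution D γ R Z u Du m M E gR gZ gu)
    (hp : PressureExtension D gR gZ gP gq) {t : ℝ} (ht : t ∈ Icc 0 D.T) :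
    (∫ x, (timeDeriv (energyDensity D gR gZ gq gu) (t, x) + boundaryWork D gR gZ gP gu (t, x)
      - momentumDensity D gR gZ gP gu (fun p => gu p - D.uB p.2) (t, x)) ∂D.dx)
    + (∫ x in D.outflow, gR (t, x) * gq (t, x) * D.normalFlux x ∂D.dS)
    + (∫ x in D.inflow, D.H (D.RB x) (D.ZB x) * D.normalFlux x ∂D.dS) = 0 := by
  have hgq := contDiff_slice hp.contDiff_q t
  have hw := h.contDiff_speedGap t
  have h1 := h.integral_speedGap h.sol.continuity_R h.extR ht
  have h2 := h.integral_speedGap h.sol.continuity_Z h.extZ ht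
  have h3 := h.sol.continuity_R.slice h.adm h.extR h.extu hgq ht
  have hslice : ∀ {f : ℝ × Vec d → ℝ}, Continuous f → Continuous fun x => f (t, x) :=
    fun hf => hf.comp (Continuous.prodMk_right t)
  have hut : Continuous fun x => gu (t, x) := (contDiff_slice h.extu.contDiff t).continuous
  have i1 : ∀ {g : ℝ × Vec d → ℝ}, ContDiff ℝ 1 g → ∀ {ψ : Vec d → ℝ}, ContDiff ℝ 1 ψ →
      Integrable (fun x => timeDeriv g (t, x) * ψ x) D.dx := fun hg _ hψ =>
    h.adm.integrable_dx ((hslice (continuous_timeDeriv hg)).mul hψ.continuous)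
  have i2 : ∀ {g : ℝ × Vec d → ℝ}, ContDiff ℝ 1 g → ∀ {ψ : Vec d → ℝ}, ContDiff ℝ 1 ψ →
      Integrable (fun x => g (t, x) * fderiv ℝ ψ x (gu (t, x))) D.dx := fun hg _ hψ =>
    h.adm.integrable_dx ((hslice hg.continuous).mul
      ((hψ.continuous_fderiv one_ne_zero).clm_apply hut))
  have i3 : ∀ {g : ℝ × Vec d → ℝ}, ContDiff ℝ 1 g → ∀ {ψ : Vec d → ℝ}, ContDiff ℝ 1 ψ →
      Integrable (fun x => timeDeriv g (t, x) * ψ x - g (t, x) * fderiv ℝ ψ x (gu (t, x))) D.dx :=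
    fun hg _ hψ => (i1 hg hψ).sub (i2 hg hψ)
  have i4 : Integrable (fun x => (timeDeriv gR (t, x) * speedGap D gu t x
        - gR (t, x) * fderiv ℝ (speedGap D gu t) x (gu (t, x)))
      + (timeDeriv gZ (t, x) * speedGap D gu t x
        - gZ (t, x) * fderiv ℝ (speedGap D gu t) x (gu (t, x)))) D.dx :=
    (i3 h.extR.contDiff hw).add (i3 h.extZ.contDiff hw)
  rw [integral_congr_ae (h.adm.ae_mem_closure.mono fun x hx =>
    h.energy_balance_pointwise hp ht hx), integral_add i4 (i3 h.extR.contDiff hgq),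
    integral_add (i3 h.extR.contDiff hw) (i3 h.extZ.contDiff hw),
    integral_sub (i1 h.extR.contDiff hw) (i2 h.extR.contDiff hw),
    integral_sub (i1 h.extZ.contDiff hw) (i2 h.extZ.contDiff hw),
    integral_sub (i1 h.extR.contDiff hgq) (i2 h.extR.contDiff hgq), h1, h2]
  have e1 : ∫ x in D.outflow, gR (t, x) * (gq (t, x) * D.normalFlux x) ∂D.dS
      = ∫ x in D.outflow, gR (t, x) * gq (t, x) * D.normalFlux x ∂D.dS := by
    simp only [mul_assoc]
  have e2 : ∫ x in D.inflow, D.RB x * (gq (t, x) * D.normalFlux x) ∂D.dS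
      = ∫ x in D.inflow, D.H (D.RB x) (D.ZB x) * D.normalFlux x ∂D.dS := by
    refine integral_congr_ae ?_
    filter_upwards [h.ae_inflow, ae_restrict_of_ae ae_dS_mem_frontier] with x hx hxf
    have h4 := hp.H_eq t ht x (frontier_subset_closure hxf)
    rw [(hx t ht).1, (hx t ht).2] at h4
    rw [h4, mul_assoc]
  rw [e1, e2] at h3
  linarith

/-- The initial momentum determines the initial velocity, since `R + Z` is positive at time `0` as
well. This is needed because the initial energy is computed from `u₀`. -/
theorem initial_ae (h : RegularSolution D γ R Z u Du m M E gR gZ gu) :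
    ∀ᵐ x ∂D.dx, gR (0, x) = D.R₀ x ∧ gZ (0, x) = D.Z₀ x ∧
      (gR (0, x) + gZ (0, x)) • gu (0, x) = (D.R₀ x + D.Z₀ x) • D.u₀ x ∧
      gu (0, x) = D.u₀ x := by
  have h0 : (0 : ℝ) ∈ Icc 0 D.T := ⟨le_rfl, h.adm.T_pos.le⟩
  filter_upwards [h.sol.init_R, h.sol.init_Z, h.sol.init_m, h.momentum_ae_eq h0,
    h.adm.ae_mem_closure] with x hR hZ hm hm' hx
  rw [← h.extR.eq 0 h0 x hx] at hR
  rw [← h.extZ.eq 0 h0 x hx] at hZ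
  have h1 : (gR (0, x) + gZ (0, x)) • gu (0, x) = (D.R₀ x + D.Z₀ x) • D.u₀ x := by
    rw [← hm', hm]
  refine ⟨hR, hZ, h1, ?_⟩
  rw [← hR, ← hZ] at h1
  exact smul_right_injective (Vec d) (add_pos (h.gR_pos h0 hx) (h.gZ_pos h0 hx)).ne' h1

theorem relEnergy_eq (hp : PressureExtension D gR gZ gP gq) {t : ℝ} (ht : t ∈ Icc 0 D.T)
    {x : Vec d} (hx : x ∈ closure D.Ω) :
    D.relEnergy (gR (t, x)) (gZ (t, x)) (gu (t, x)) x = energyDensity D gR gZ gq gu (t, x) := by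
  rw [relEnergy, energyDensity, hp.H_eq t ht x hx]

/-- This is the energy inequality minus the energy balance integrated over `(0, τ)`. The momentum
density tested with `u - u_B`, admissible because it vanishes on the boundary, integrates to the
Reynolds term. All other terms cancel. -/
theorem energy_defect_le (h : RegularSolution D γ R Z u Du m M E gR gZ gu)
    (hp : PressureExtension D gR gZ gP gq) : ∀ᵐ τ ∂D.timeMeasure, E τ univ
      ≤ - (∫ t in (0 : ℝ)..τ, tensorPairing
          (fun x => spaceDeriv (fun p : ℝ × Vec d => gu p - D.uB p.2) (t, x)) (M t))
        - ∫ t in (0 : ℝ)..τ, tensorPairing (fun x => fderiv ℝ D.uB x) (M t) := by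
  have h0 : (0 : ℝ) ∈ Icc 0 D.T := ⟨le_rfl, h.adm.T_pos.le⟩
  have hK := h.adm.isCompact_closure
  have hφ : ContDiff ℝ 1 fun p : ℝ × Vec d => gu p - D.uB p.2 :=
    h.extu.contDiff.sub (contDiff_uB h.adm)
  have hDuB : Continuous fun p : ℝ × Vec d => fderiv ℝ D.uB p.2 :=
    (h.adm.uB_C1.continuous_fderiv one_ne_zero).comp continuous_snd
  have huB : Continuous fun p : ℝ × Vec d => D.uB p.2 := (contDiff_uB h.adm).continuous
  have hρ : Continuous fun p => gR p + gZ p :=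
    h.extR.contDiff.continuous.add h.extZ.contDiff.continuous
  have cEn := continuous_timeDeriv (h.contDiff_energyDensity hp)
  have cM := h.continuous_momentumDensity hp hφ
  let Fa : ℝ × Vec d → ℝ := fun p => contract (D.S (spaceDeriv gu p)) (spaceDeriv gu p)
  let F1 : ℝ × Vec d → ℝ := fun p =>
    contract ((gR p + gZ p) • tensorSq (gu p) + gP p • ContinuousLinearMap.id ℝ (Vec d))
      (fderiv ℝ D.uB p.2)
  let F2 : ℝ × Vec d → ℝ := fun p =>
    (gR p + gZ p) * inner ℝ (fderiv ℝ D.uB p.2 (gu p)) (D.uB p.2)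
  let F3 : ℝ × Vec d → ℝ := fun p => contract (D.S (spaceDeriv gu p)) (fderiv ℝ D.uB p.2)
  have ca : Continuous Fa := continuous_contract h.continuous_S (continuous_spaceDeriv h.extu.contDiff)
  have c1 : Continuous F1 := continuous_contract (h.continuous_convection.add
    (hp.contDiff_P.continuous.smul continuous_const)) hDuB
  have c2 : Continuous F2 := hρ.mul ((hDuB.clm_apply h.extu.contDiff.continuous).inner huB)
  have c3 : Continuous F3 := continuous_contract h.continuous_S hDuB
  have ca1 : Continuous fun p => Fa p + F1 p := ca.add c1
  have ca2 : Continuous fun p => Fa p + F1 p - F2 p := ca1.sub c2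
  have cW : Continuous (boundaryWork D gR gZ gP gu) := ca2.sub c3
  have cEW : Continuous fun p => timeDeriv (energyDensity D gR gZ gq gu) p
    + boundaryWork D gR gZ gP gu p := cEn.add cW
  have cG : Continuous fun p => timeDeriv (energyDensity D gR gZ gq gu) p
    + boundaryWork D gR gZ gP gu p
    - momentumDensity D gR gZ gP gu (fun p => gu p - D.uB p.2) p := cEW.sub cM
  have hS : ∀ᵐ x ∂(D.dS.restrict D.outflow), x ∈ closure D.Ω :=
    ae_restrict_of_ae (ae_dS_mem_frontier.mono fun x hx => frontier_subset_closure hx)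
  have cO : Continuous fun t =>
      ∫ x in D.outflow, gR (t, x) * gq (t, x) * D.normalFlux x ∂D.dS :=
    continuous_integral_slice hK hS
      (h.extR.contDiff.continuous.mul hp.contDiff_q.continuous) h.adm.integrable_normalFlux.restrict
  have e0 : ∫ x, D.relEnergy (D.R₀ x) (D.Z₀ x) (D.u₀ x) x ∂D.dx
      = ∫ x, energyDensity D gR gZ gq gu (0, x) ∂D.dx := by
    refine integral_congr_ae ?_
    filter_upwards [h.initial_ae, h.adm.ae_mem_closure] with x hx hxc
    rw [← relEnergy_eq hp h0 hxc, hx.1, hx.2.1, hx.2.2.2]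
  filter_upwards [h.sol.energy, ae_restrict_mem measurableSet_Ioo] with τ hE hτo
  have hτ : τ ∈ Icc 0 D.T := Ioo_subset_Icc_self hτo
  have hsub : ∀ s ∈ uIcc 0 τ, s ∈ Icc 0 D.T := fun s hs => by
    rw [uIcc_of_le hτ.1] at hs
    exact ⟨hs.1, hs.2.trans hτ.2⟩
  have e1 : ∫ x, D.relEnergy (R τ x) (Z τ x) (u τ x) x ∂D.dx
      = ∫ x, energyDensity D gR gZ gq gu (τ, x) ∂D.dx :=
    integral_congr_ae (h.adm.ae_mem_closure.mono fun x hx => by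
      simp only [← relEnergy_eq hp hτ hx, ← h.extR.eq τ hτ x hx, ← h.extZ.eq τ hτ x hx,
        ← h.extu.eq τ hτ x hx])
  have e2 := h.adm.integral_sub_eq_slab (h.contDiff_energyDensity hp) τ
  have ea : ∫ t in (0 : ℝ)..τ, ∫ x, contract (D.S (Du t x)) (Du t x) ∂D.dx = D.slab τ Fa :=
    slab_congr_ae hτ (h.velocity.1.mono fun t ht => ht.mono fun x hx => by simp only [Fa, hx])
  have e3 : ∫ t in (0 : ℝ)..τ, ∫ x, contract (D.S (Du t x)) (fderiv ℝ D.uB x) ∂D.dx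
      = D.slab τ F3 :=
    slab_congr_ae hτ (h.velocity.1.mono fun t ht => ht.mono fun x hx => by simp only [F3, hx])
  have e4 : ∫ t in (0 : ℝ)..τ, ∫ x, contract ((R t x + Z t x) • tensorSq (u t x)
      + D.P (R t x, Z t x) • ContinuousLinearMap.id ℝ (Vec d)) (fderiv ℝ D.uB x) ∂D.dx
      = D.slab τ F1 := h.adm.slab_congr hτ fun t ht x hx => by
    simp only [F1, ← h.extR.eq t ht x hx, ← h.extZ.eq t ht x hx, ← h.extu.eq t ht x hx,
      hp.P_eq t ht x hx]
  have e5 : ∫ t in (0 : ℝ)..τ, ∫ x,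
      (R t x + Z t x) * inner ℝ (fderiv ℝ D.uB x (u t x)) (D.uB x) ∂D.dx = D.slab τ F2 :=
    h.adm.slab_congr hτ fun t ht x hx => by
      simp only [F2, ← h.extR.eq t ht x hx, ← h.extZ.eq t ht x hx, ← h.extu.eq t ht x hx]
  have e6 : ∫ t in (0 : ℝ)..τ, ∫ x in D.outflow, D.H (R t x) (Z t x) * D.normalFlux x ∂D.dS
      = ∫ t in (0 : ℝ)..τ, ∫ x in D.outflow, gR (t, x) * gq (t, x) * D.normalFlux x ∂D.dS :=
    intervalIntegral.integral_congr fun t ht => integral_congr_ae (hS.mono fun x hx => by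
      simp only [← h.extR.eq t (hsub t ht) x hx, ← h.extZ.eq t (hsub t ht) x hx,
        hp.H_eq t (hsub t ht) x hx])
  have hbal : ∫ t in (0 : ℝ)..τ,
      ((∫ x, (timeDeriv (energyDensity D gR gZ gq gu) (t, x) + boundaryWork D gR gZ gP gu (t, x)
      - momentumDensity D gR gZ gP gu (fun p => gu p - D.uB p.2) (t, x)) ∂D.dx)
      + (∫ x in D.outflow, gR (t, x) * gq (t, x) * D.normalFlux x ∂D.dS)
      + ∫ x in D.inflow, D.H (D.RB x) (D.ZB x) * D.normalFlux x ∂D.dS) = 0 := by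
    rw [intervalIntegral.integral_congr (g := fun _ => 0) fun t ht =>
      h.energy_balance hp (hsub t ht)]
    exact intervalIntegral.integral_zero
  have cGi := h.adm.continuous_integral cG
  have cGO : Continuous fun t =>
      (∫ x, (timeDeriv (energyDensity D gR gZ gq gu) (t, x) + boundaryWork D gR gZ gP gu (t, x)
      - momentumDensity D gR gZ gP gu (fun p => gu p - D.uB p.2) (t, x)) ∂D.dx)
      + ∫ x in D.outflow, gR (t, x) * gq (t, x) * D.normalFlux x ∂D.dS := cGi.add cO
  rw [intervalIntegral.integral_add (cGO.intervalIntegrable _ _)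
    (continuous_const.intervalIntegrable _ _), intervalIntegral.integral_add
    (cGi.intervalIntegrable _ _) (cO.intervalIntegrable _ _)] at hbal
  have e7 := h.adm.slab_sub cEW cM τ
  rw [h.adm.slab_add cEn cW, h.slab_momentumDensity hp hφ (fun t ht x hx => by
    simp only [h.velocity.2 t ht x hx, sub_self]) hτ] at e7
  have e8 : D.slab τ (boundaryWork D gR gZ gP gu)
      = D.slab τ Fa + D.slab τ F1 - D.slab τ F2 - D.slab τ F3 := by
    rw [← h.adm.slab_add ca c1, ← h.adm.slab_sub ca1 c2, ← h.adm.slab_sub ca2 c3]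
    rfl
  simp only [slab] at e7 e8 e2 ea e3 e4 e5
  rw [e0, e1, e2, ea, e3, e4, e5, e6] at hE
  rw [e7, e8] at hbal
  linarith

end RegularSolution

end ProblemData

end Bifluid

namespace Bifluid

open Module

/-! ### Grönwall's inequality and the vanishing of the defects -/

section Gronwall

/-- Grönwall's inequality for nonnegative integrable functions. -/
theorem ae_le_zero_of_le_integral {T c : ℝ} {e : ℝ → ℝ} (hc : 0 ≤ c)
    (he : IntegrableOn e (Ioo 0 T)) (h0 : ∀ᵐ t ∂volume.restrict (Ioo 0 T), 0 ≤ e t)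
    (h : ∀ᵐ τ ∂volume.restrict (Ioo 0 T), e τ ≤ c * ∫ t in (0 : ℝ)..τ, e t) :
    ∀ᵐ t ∂volume.restrict (Ioo 0 T), e t ≤ 0 := by
  let f : ℝ → ℝ := (Ioo 0 T).indicator e
  have hf : Integrable f := he.integrable_indicator measurableSet_Ioo
  have hf0 : ∀ᵐ t, 0 ≤ f t := by
    filter_upwards [(ae_restrict_iff' measurableSet_Ioo).1 h0] with t ht
    by_cases hm : t ∈ Ioo 0 T
    · rw [show f t = e t from indicator_of_mem hm e]; exact ht hm
    · rw [show f t = 0 from indicator_of_notMem hm e]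
  let K : ℝ → ℝ := fun τ => ∫ t in (0 : ℝ)..τ, f t
  have hK : Continuous K :=
    intervalIntegral.continuous_primitive (fun a b => hf.intervalIntegrable) 0
  have hK0 : ∀ τ, 0 ≤ τ → 0 ≤ K τ := fun τ hτ => intervalIntegral.integral_nonneg_of_ae hτ hf0
  have hfK : ∀ᵐ t, 0 ≤ t → f t ≤ c * K t := by
    filter_upwards [(ae_restrict_iff' measurableSet_Ioo).1 h] with t ht ht0
    by_cases hm : t ∈ Ioo 0 T
    · rw [show f t = e t from indicator_of_mem hm e]
      refine (ht hm).trans_eq ?_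
      congr 1
      refine intervalIntegral.integral_congr_ae (ae_of_all _ fun s hs => ?_)
      rw [uIoc_of_le ht0] at hs
      have hsT : s ∈ Ioo 0 T := ⟨hs.1, hs.2.trans_lt hm.2⟩
      exact (indicator_of_mem hsT e).symm
    · rw [show f t = 0 from indicator_of_notMem hm e]
      exact mul_nonneg hc (hK0 t ht0)
  -- The hypothesis on `e` holds only almost everywhere and `e` need not be continuous, so one more
  -- integration is made. `F` has the continuous derivative `K`, and integrating `f ≤ c K` gives `K
  -- ≤ c F`, to which the differential form of the inequality applies.
  let F : ℝ → ℝ := fun τ => ∫ t in (0 : ℝ)..τ, K t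
  have hFd : ∀ t, HasDerivAt F (K t) t := fun t =>
    intervalIntegral.integral_hasDerivAt_right (hK.intervalIntegrable _ _)
      (hK.stronglyMeasurableAtFilter _ _) hK.continuousAt
  have hF0 : ∀ τ, 0 ≤ τ → 0 ≤ F τ := fun τ hτ =>
    intervalIntegral.integral_nonneg hτ fun t ht => hK0 t ht.1
  have hKF : ∀ τ, 0 ≤ τ → K τ ≤ c * F τ := fun τ hτ => by
    rw [← intervalIntegral.integral_const_mul]
    refine intervalIntegral.integral_mono_ae_restrict hτ hf.intervalIntegrable
      ((continuous_const.mul hK).intervalIntegrable _ _) ?_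
    exact (ae_restrict_iff' measurableSet_Icc).2 (hfK.mono fun t ht h1 => ht h1.1)
  have hFz : ∀ τ, 0 ≤ τ → F τ = 0 := fun τ hτ => by
    have h1 := norm_le_gronwallBound_of_norm_deriv_right_le (f := F) (f' := K) (δ := 0) (K := c)
      (ε := 0) (a := 0) (b := τ) (fun t _ => (hFd t).continuousAt.continuousWithinAt)
      (fun t _ => (hFd t).hasDerivWithinAt) (by simp [F]) (fun t ht => by
        rw [Real.norm_of_nonneg (hK0 t ht.1), Real.norm_of_nonneg (hF0 t ht.1), add_zero]
        exact hKF t ht.1) τ ⟨hτ, le_rfl⟩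
    rw [gronwallBound_ε0_δ0] at h1
    exact norm_le_zero_iff.1 h1
  rw [ae_restrict_iff' measurableSet_Ioo]
  filter_upwards [hfK] with t ht hm
  have h1 := ht hm.1.le
  have h2 := hKF t hm.1.le
  rw [hFz t hm.1.le, mul_zero] at h2
  rw [show f t = e t from indicator_of_mem hm e] at h1
  exact h1.trans (mul_nonpos_of_nonneg_of_nonpos hc h2)

end Gronwall

namespace ProblemData

variable {d : ℕ} {D : ProblemData d}

/-- The mass is the pairing with the constant function 1, hence measurable in time, and it is
dominated by the total variation. -/
theorem integrableOn_mass {K : Set (Vec d)} {T : ℝ} {ν : ℝ → SignedMeasure K}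
    (h : LInftyMeasure T K ν) : IntegrableOn (fun t => ν t univ) (Ioo 0 T) := by
  obtain ⟨hm, C, hC⟩ := h
  have h1 : ∀ t, ∫ᵛ x, (1 : C(K, ℝ)) x ∂•(ν t) = ν t univ := fun t => by
    have : IsFiniteMeasure (ν t).variation := by
      rw [← SignedMeasure.totalVariation_eq_variation]; infer_instance
    have h2 := VectorMeasure.integral_const (μ := ν t) (B := ContinuousLinearMap.lsmul ℝ ℝ) (1 : ℝ)
    refine Eq.trans ?_ (h2.trans (by simp))
    rfl
  have h2 := hm 1
  simp only [h1] at h2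
  refine Integrable.of_bound h2 (C : ℝ) (hC.mono fun t ht => ?_)
  refine (SignedMeasure.norm_le_totalVariation (ν t) univ).trans ?_
  exact ENNReal.toReal_le_coe_of_le_coe ht

namespace RegularSolution

variable {γ : ℝ} {R Z : ℝ → Vec d → ℝ} {u : ℝ → Vec d → Vec d} {Du : ℝ → Vec d → Tensor d}
  {m : ℝ → Vec d → Vec d} {M : ℝ → Fin d → Fin d → SignedMeasure (closure D.Ω)}
  {E : ℝ → SignedMeasure (closure D.Ω)} {gR gZ gP gq : ℝ × Vec d → ℝ} {gu : ℝ × Vec d → Vec d}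

theorem exists_tensorPairing_bound (h : RegularSolution D γ R Z u Du m M E gR gZ gu)
    {A : ℝ × Vec d → Tensor d} (hA : Continuous A) : ∃ c, 0 ≤ c ∧ ∀ᵐ t ∂D.timeMeasure,
      |tensorPairing (fun x => A (t, x)) (M t)| ≤ c * E t univ := by
  obtain ⟨c₁, c₂, h1, h2, hcomp⟩ := h.sol.compatibility
  have hc₂ : 0 ≤ c₂ := h1.le.trans h2
  have hb : ∃ C, 0 ≤ C ∧ ∀ t ∈ Icc 0 D.T, ∀ x ∈ closure D.Ω, ∀ i j, |entry (A (t, x)) i j| ≤ C := by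
    obtain ⟨C, hC⟩ := ((isCompact_Icc (a := 0) (b := D.T)).prod
      h.adm.isCompact_closure).exists_bound_of_continuousOn hA.continuousOn
    refine ⟨max C 0, le_max_right _ _, fun t ht x hx i j => ?_⟩
    have e1 : |entry (A (t, x)) i j| ≤ ‖A (t, x) (basisVec j)‖ := PiLp.norm_apply_le (A (t, x) (basisVec j)) i
    have e2 := (A (t, x)).le_opNorm (basisVec j)
    have e3 : ‖(basisVec j : Vec d)‖ = 1 := by simp [basisVec]
    rw [e3, mul_one] at e2
    exact e1.trans (e2.trans ((hC (t, x) ⟨ht, hx⟩).trans (le_max_left _ _)))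
  obtain ⟨C, hC0, hC⟩ := hb
  refine ⟨d * d * (C * c₂), by positivity, ?_⟩
  filter_upwards [hcomp, h.sol.M_symm, h.sol.M_psd, h.sol.E_nonneg,
    ae_restrict_mem measurableSet_Ioo] with t ht hs hpsd hE htI
  exact abs_tensorPairing_le hc₂ hE hs hpsd ht.2 hC0 (hC t (Ioo_subset_Icc_self htI))

theorem exists_integral_tensorPairing_bound (h : RegularSolution D γ R Z u Du m M E gR gZ gu)
    {A : ℝ × Vec d → Tensor d} (hA : Continuous A) : ∃ c, 0 ≤ c ∧ ∀ τ ∈ Icc 0 D.T,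
      |∫ t in (0 : ℝ)..τ, tensorPairing (fun x => A (t, x)) (M t)|
        ≤ c * ∫ t in (0 : ℝ)..τ, E t univ := by
  obtain ⟨c, hc, hb⟩ := h.exists_tensorPairing_bound hA
  refine ⟨c, hc, fun τ hτ => ?_⟩
  have hi : IntervalIntegrable (fun t => E t univ) volume 0 τ := by
    rw [intervalIntegrable_iff_integrableOn_Ioo_of_le hτ.1]
    exact (integrableOn_mass h.sol.E_LInfty).mono_set (Ioo_subset_Ioo_right hτ.2)
  rw [← intervalIntegral.integral_const_mul]
  rw [← Real.norm_eq_abs]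
  refine intervalIntegral.norm_integral_le_of_norm_le hτ.1 ?_ (hi.const_mul c)
  filter_upwards [ae_timeMeasure_imp hb] with t ht hts using ht ⟨hts.1, hts.2.trans hτ.2⟩

/-- Both Reynolds terms of `energy_defect_le` are bounded by constants times the time integral of
the mass of `E`. Grönwall's inequality gives `E = 0`, and the trace bound with positivity then
removes every entry of `M`. -/
theorem defects_eq_zero (h : RegularSolution D γ R Z u Du m M E gR gZ gu)
    (hp : PressureExtension D gR gZ gP gq) :
    ∀ᵐ t ∂D.timeMeasure, E t = 0 ∧ ∀ i j, M t i j = 0 := by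
  have hφ : ContDiff ℝ 1 fun p : ℝ × Vec d => gu p - D.uB p.2 :=
    h.extu.contDiff.sub (contDiff_uB h.adm)
  obtain ⟨cX, hcX, hX⟩ := h.exists_integral_tensorPairing_bound (continuous_spaceDeriv hφ)
  obtain ⟨cY, hcY, hY⟩ := h.exists_integral_tensorPairing_bound
    (A := fun p : ℝ × Vec d => fderiv ℝ D.uB p.2)
    ((h.adm.uB_C1.continuous_fderiv one_ne_zero).comp continuous_snd)
  have hE0 : ∀ᵐ t ∂D.timeMeasure, 0 ≤ E t univ :=
    h.sol.E_nonneg.mono fun t ht => ht univ MeasurableSet.univ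
  have hle : ∀ᵐ τ ∂D.timeMeasure, E τ univ ≤ (cX + cY) * ∫ t in (0 : ℝ)..τ, E t univ := by
    filter_upwards [h.energy_defect_le hp, ae_restrict_mem measurableSet_Ioo] with τ h1 hτo
    have h2 := neg_abs_le (∫ t in (0 : ℝ)..τ, tensorPairing
      (fun x => spaceDeriv (fun p : ℝ × Vec d => gu p - D.uB p.2) (t, x)) (M t))
    have h3 := neg_abs_le (∫ t in (0 : ℝ)..τ, tensorPairing (fun x => fderiv ℝ D.uB x) (M t))
    have h4 := hX τ (Ioo_subset_Icc_self hτo)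
    have h5 := hY τ (Ioo_subset_Icc_self hτo)
    simp only at h5
    rw [add_mul]
    linarith
  have hz := ae_le_zero_of_le_integral (add_nonneg hcX hcY) (integrableOn_mass h.sol.E_LInfty)
    hE0 hle
  obtain ⟨c₁, c₂, -, -, hcomp⟩ := h.sol.compatibility
  have hz' : ∀ᵐ t ∂D.timeMeasure, E t univ ≤ 0 := hz
  filter_upwards [hz', h.sol.E_nonneg, hcomp, h.sol.M_symm, h.sol.M_psd] with t h1 h2 h3 h4 h5
  have h6 := eq_zero_of_nonneg_of_univ h2 h1
  exact ⟨h6, eq_zero_of_defect h4 h5 h3.2 h6⟩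

end RegularSolution

end ProblemData

end Bifluid

namespace Bifluid

open Module

/-! ### Divergence of tensor fields -/

section TensorDivergence

variable {d : ℕ}

theorem tensorDiv_eq {T : Vec d → Tensor d} {x : Vec d} (hT : DifferentiableAt ℝ T x) :
    tensorDiv T x = ∑ j, fderiv ℝ (fun y => T y (basisVec j)) x (basisVec j) := by
  refine Finset.sum_congr rfl fun j _ => ?_
  have h1 : HasFDerivAt (fun y => T y (basisVec j)) _ x :=
    hT.hasFDerivAt.clm_apply (hasFDerivAt_const (basisVec j : Vec d) x)
  rw [h1.fderiv]
  simp

theorem contract_eq_sum_inner (A B : Tensor d) :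
    contract A B = ∑ j, inner ℝ (A (basisVec j)) (B (basisVec j)) := by
  rw [contract, Finset.sum_comm]
  refine Finset.sum_congr rfl fun j _ => ?_
  rw [inner_eq_sum]
  rfl

/-- Symmetry lets `S` act on `w` instead of on the gradient. This is how `S u` appears in the energy
equation and `S e_i` in the components of the momentum equation. -/
theorem contract_smulRight {S : Tensor d} (hS : ∀ i j, entry S i j = entry S j i)
    (L : Vec d →L[ℝ] ℝ) (w : Vec d) : contract S (L.smulRight w) = L (S w) := by
  rw [map_eq_sum_basisVec L, contract, Finset.sum_comm]
  refine Finset.sum_congr rfl fun j _ => ?_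
  rw [apply_coord, smul_eq_mul, Finset.sum_mul]
  refine Finset.sum_congr rfl fun i _ => ?_
  rw [hS i j]
  simp only [entry, ContinuousLinearMap.smulRight_apply, PiLp.smul_apply, smul_eq_mul]
  ring

theorem contract_add_right (A B C : Tensor d) :
    contract A (B + C) = contract A B + contract A C := by
  simp only [contract, entry_add, mul_add, Finset.sum_add_distrib]

theorem contract_smul_right (c : ℝ) (A B : Tensor d) : contract A (c • B) = c * contract A B := by
  simp only [contract, entry_smul, Finset.mul_sum]
  refine Finset.sum_congr rfl fun i _ => Finset.sum_congr rfl fun j _ => ?_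
  ring

theorem contDiff_tensorSq {v : Vec d → Vec d} (hv : ContDiff ℝ 1 v) :
    ContDiff ℝ 1 fun y => tensorSq (v y) := by
  have h1 : ContDiff ℝ 1 fun y => innerSL ℝ (v y) := (innerSL ℝ).contDiff.comp hv
  exact h1.smulRight hv

theorem tensorDiv_smul_tensorSq {r : Vec d → ℝ} {v : Vec d → Vec d} (hr : ContDiff ℝ 1 r)
    (hv : ContDiff ℝ 1 v) (x : Vec d) : tensorDiv (fun y => r y • tensorSq (v y)) x
      = (fderiv ℝ r x (v x) + r x * tensorTrace (fderiv ℝ v x)) • v x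
        + r x • fderiv ℝ v x (v x) := by
  have hrd := (hr.differentiable one_ne_zero x).hasFDerivAt
  have hvd := (hv.differentiable one_ne_zero x).hasFDerivAt
  have hT : DifferentiableAt ℝ (fun y => r y • tensorSq (v y)) x :=
    (hr.smul (contDiff_tensorSq hv)).differentiable one_ne_zero x
  rw [tensorDiv_eq hT]
  have h1 : ∀ j, fderiv ℝ (fun y => (r y • tensorSq (v y)) (basisVec j)) x (basisVec j)
      = (v x j * fderiv ℝ r x (basisVec j)) • v x + (r x * entry (fderiv ℝ v x) j j) • v x
        + r x • (v x j • fderiv ℝ v x (basisVec j)) := fun j => by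
    have h2 : (fun y => (r y • tensorSq (v y)) (basisVec j)) = fun y => (r y * v y j) • v y := by
      funext y
      change r y • (inner ℝ (v y) (basisVec j) • v y) = _
      rw [inner_basisVec, smul_smul]
    have h3 : HasFDerivAt (fun y => v y j) _ x :=
      ((contDiff_coord hv j).differentiable one_ne_zero x).hasFDerivAt
    have h4 : HasFDerivAt (fun y => (r y * v y j) • v y) _ x := (hrd.mul h3).smul hvd
    rw [h2, h4.fderiv]
    simp only [add_apply, smul_apply,
      ContinuousLinearMap.smulRight_apply, smul_eq_mul, Pi.mul_apply,
      fderiv_apply_coord (hv.differentiable one_ne_zero x), entry]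
    module
  simp only [h1, Finset.sum_add_distrib, ← Finset.sum_smul, ← Finset.smul_sum, ← Finset.mul_sum]
  rw [map_eq_sum_basisVec (fderiv ℝ r x) (v x), map_eq_sum_basisVec (fderiv ℝ v x) (v x)]
  simp only [smul_eq_mul, tensorTrace, add_smul]

theorem tensorDiv_smul_id {p : Vec d → ℝ} {x : Vec d} (hp : DifferentiableAt ℝ p x) :
    tensorDiv (fun y => p y • ContinuousLinearMap.id ℝ (Vec d)) x = gradient p x := by
  have h1 : HasFDerivAt (fun y => p y • ContinuousLinearMap.id ℝ (Vec d)) _ x :=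
    hp.hasFDerivAt.smul_const _
  rw [tensorDiv, h1.fderiv]
  ext i
  rw [← inner_basisVec (gradient p x), inner_gradient_left]
  simp [basisVec, Pi.single_apply]

theorem tensorDiv_add {S T : Vec d → Tensor d} {x : Vec d} (hS : DifferentiableAt ℝ S x)
    (hT : DifferentiableAt ℝ T x) :
    tensorDiv (fun y => S y + T y) x = tensorDiv S x + tensorDiv T x := by
  rw [tensorDiv, fderiv_fun_add hS hT]
  simp [tensorDiv, Finset.sum_add_distrib]

/-- Integration by parts for the divergence of a tensor field. -/
theorem IsBoundedLipschitzDomain.integral_contract_fderiv {Ω : Set (Vec d)}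
    (hΩ : IsBoundedLipschitzDomain Ω) {T : Vec d → Tensor d} (hT : ContDiff ℝ 1 T)
    {ψ : Vec d → Vec d} (hψ : ContDiff ℝ 1 ψ) (hc : HasCompactSupport ψ) (hs : tsupport ψ ⊆ Ω) :
    ∫ x in Ω, contract (T x) (fderiv ℝ ψ x) = - ∫ x in Ω, inner ℝ (tensorDiv T x) (ψ x) := by
  have hTj : ∀ j, ContDiff ℝ 1 fun y => T y (basisVec j) := fun j =>
    hT.clm_apply contDiff_const
  have hTd := hT.differentiable one_ne_zero
  let f : Fin d → Vec d → ℝ := fun j y => inner ℝ (T y (basisVec j)) (ψ y)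
  have hf : ∀ j, ContDiff ℝ 1 (f j) := fun j => (hTj j).inner ℝ hψ
  have hsub : ∀ j, Function.support (f j) ⊆ Function.support ψ := fun j x hx => by
    rw [Function.mem_support] at hx ⊢
    exact fun h0 => hx (by simp [f, h0])
  have h0 : ∀ j, ∫ x in Ω, fderiv ℝ (f j) x (basisVec j) = 0 := fun j =>
    setIntegral_fderiv_of_tsupport_subset (hf j) (hc.mono (hsub j))
      ((closure_mono (hsub j)).trans hs) _
  have h1 : ∀ x, contract (T x) (fderiv ℝ ψ x) + inner ℝ (tensorDiv T x) (ψ x)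
      = ∑ j, fderiv ℝ (f j) x (basisVec j) := fun x => by
    rw [contract_eq_sum_inner, tensorDiv_eq (hTd x), sum_inner, ← Finset.sum_add_distrib]
    refine Finset.sum_congr rfl fun j _ => ?_
    exact (fderiv_inner_apply ℝ ((hTj j).differentiable one_ne_zero x)
      (hψ.differentiable one_ne_zero x) (basisVec j)).symm
  have cD : Continuous (tensorDiv T) := by
    change Continuous fun x => ∑ j, (fderiv ℝ T x (basisVec j)) (basisVec j)
    exact continuous_finsetSum _ fun j _ => ((hT.continuous_fderiv one_ne_zero).clm_apply
      continuous_const).clm_apply continuous_const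
  have i1 : Integrable (fun x => contract (T x) (fderiv ℝ ψ x)) (volume.restrict Ω) :=
    hΩ.integrableOn (continuous_contract hT.continuous (hψ.continuous_fderiv one_ne_zero))
  have i2 : Integrable (fun x => inner ℝ (tensorDiv T x) (ψ x)) (volume.restrict Ω) :=
    hΩ.integrableOn (cD.inner hψ.continuous)
  have h2 : ∫ x in Ω, (contract (T x) (fderiv ℝ ψ x) + inner ℝ (tensorDiv T x) (ψ x)) = 0 := by
    simp only [h1]
    rw [integral_finsetSum _ fun j _ => hΩ.integrableOn
      (((hf j).continuous_fderiv one_ne_zero).clm_apply continuous_const)]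
    simp only [h0, Finset.sum_const_zero]
  rw [integral_add i1 i2] at h2
  linarith

end TensorDivergence

/-! ### The momentum equation without defect -/

namespace ProblemData

variable {d : ℕ} {D : ProblemData d}

namespace RegularSolution

variable {γ : ℝ} {R Z : ℝ → Vec d → ℝ} {u : ℝ → Vec d → Vec d} {Du : ℝ → Vec d → Tensor d}
  {m : ℝ → Vec d → Vec d} {M : ℝ → Fin d → Fin d → SignedMeasure (closure D.Ω)}
  {E : ℝ → SignedMeasure (closure D.Ω)} {gR gZ gP gq : ℝ × Vec d → ℝ} {gu : ℝ × Vec d → Vec d}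

/-- The acceleration and pressure terms `ρ (∂_t u + (u·∇) u) + ∇P`. -/
noncomputable def force (gR gZ gP : ℝ × Vec d → ℝ) (gu : ℝ × Vec d → Vec d) (p : ℝ × Vec d) :
    Vec d :=
  (gR p + gZ p) • (timeDeriv gu p + spaceDeriv gu p (gu p))
    + gradient (fun y => gP (p.1, y)) p.2

theorem continuous_force (h : RegularSolution D γ R Z u Du m M E gR gZ gu)
    (hp : PressureExtension D gR gZ gP gq) : Continuous (force gR gZ gP gu) := by
  have h1 : (fun p : ℝ × Vec d => gradient (fun y => gP (p.1, y)) p.2)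
      = fun p => (InnerProductSpace.toDual ℝ (Vec d)).symm (spaceDeriv gP p) := by
    funext p
    rw [gradient, fderiv_slice (hp.contDiff_P.differentiable one_ne_zero p)]
  have h2 : Continuous fun p : ℝ × Vec d => gradient (fun y => gP (p.1, y)) p.2 := by
    rw [h1]
    exact (LinearIsometryEquiv.continuous _).comp (continuous_spaceDeriv hp.contDiff_P)
  exact ((h.extR.contDiff.continuous.add h.extZ.contDiff.continuous).smul
    ((continuous_timeDeriv h.extu.contDiff).add
      ((continuous_spaceDeriv h.extu.contDiff).clm_apply h.extu.contDiff.continuous))).add h2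

/-- The density of the inviscid part of the momentum equation reduces to `force` by the
continuity equations. -/
theorem momentum_eq_force (h : RegularSolution D γ R Z u Du m M E gR gZ gu)
    {t : ℝ} (ht : t ∈ Icc 0 D.T) {x : Vec d} (hx : x ∈ closure D.Ω) :
    timeDeriv (fun p => (gR p + gZ p) • gu p) (t, x)
      + tensorDiv (fun y => (gR (t, y) + gZ (t, y)) • tensorSq (gu (t, y))) x
      + gradient (fun y => gP (t, y)) x = force gR gZ gP gu (t, x) := by
  have hRd := hasFDerivAt_slice (h.extR.contDiff.differentiable one_ne_zero (t, x))
  have hZd := hasFDerivAt_slice (h.extZ.contDiff.differentiable one_ne_zero (t, x))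
  have hud := hasFDerivAt_slice (h.extu.contDiff.differentiable one_ne_zero (t, x))
  have h1 := h.mass_R ht hx
  have h2 := h.mass_Z ht hx
  have h3 : fderiv ℝ (fun y => gR (t, y) + gZ (t, y)) x = _ := (hRd.add hZd).fderiv
  rw [h.timeDeriv_momentum, tensorDiv_smul_tensorSq (r := fun y => gR (t, y) + gZ (t, y))
    (v := fun y => gu (t, y))
    ((contDiff_slice h.extR.contDiff t).add (contDiff_slice h.extZ.contDiff t))
    (contDiff_slice h.extu.contDiff t), h3, hud.fderiv, force]
  have h4 : (timeDeriv gR (t, x) + timeDeriv gZ (t, x))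
      + (spaceDeriv gR (t, x) (gu (t, x)) + spaceDeriv gZ (t, x) (gu (t, x))
        + (gR (t, x) + gZ (t, x)) * tensorTrace (spaceDeriv gu (t, x))) = 0 := by linarith
  have h5 := congrArg (fun c : ℝ => c • gu (t, x)) h4
  simp only [zero_smul, add_smul] at h5
  simp only [add_apply]
  simp only [add_smul, smul_add]
  rw [← sub_eq_zero] at h5 ⊢
  rw [← h5]
  abel

/-- The momentum equation in the sense of distributions, at each time. -/
theorem integral_force (h : RegularSolution D γ R Z u Du m M E gR gZ gu)
    (hp : PressureExtension D gR gZ gP gq) {t : ℝ} (ht : t ∈ Icc 0 D.T) {ψ : Vec d → Vec d}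
    (hψ : ContDiff ℝ 1 ψ) (hc : HasCompactSupport ψ) (hs : tsupport ψ ⊆ D.Ω) :
    ∫ x, inner ℝ (force gR gZ gP gu (t, x)) (ψ x) ∂D.dx
      = - ∫ x, contract (D.S (spaceDeriv gu (t, x))) (fderiv ℝ ψ x) ∂D.dx := by
  have hφ : ContDiff ℝ 1 fun p : ℝ × Vec d => ψ p.2 := hψ.comp contDiff_snd
  have hcm := h.continuous_momentumDensity hp hφ
  -- The Reynolds defect vanishes at almost every time, so the tested equation has zero right-hand
  -- side on each `(0, τ)`. Continuity in time then gives the identity at every `t`.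
  have hz : ∀ τ ∈ Icc 0 D.T,
      D.slab τ (momentumDensity D gR gZ gP gu fun p : ℝ × Vec d => ψ p.2) = 0 := fun τ hτ => by
    rw [h.slab_momentumDensity hp hφ (fun _ _ x hx =>
      notMem_tsupport_of_mem_frontier h.adm.domain.isOpen hs hx) hτ]
    rw [intervalIntegral.integral_congr_ae (g := fun _ => 0) ?_, intervalIntegral.integral_zero]
    filter_upwards [ae_timeMeasure_imp (h.defects_eq_zero hp)] with s hs1 hs2
    rw [uIoc_of_le hτ.1] at hs2
    have h1 := (hs1 ⟨hs2.1, hs2.2.trans hτ.2⟩).2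
    simp only [tensorPairing, h1, VectorMeasure.integral_zero_vectorMeasure, Finset.sum_const_zero]
  have h1 : ∫ x, momentumDensity D gR gZ gP gu (fun p : ℝ × Vec d => ψ p.2) (t, x) ∂D.dx = 0 :=
    eqOn_zero_of_integral_eq_zero h.adm.T_pos (h.adm.continuous_integral hcm) hz t ht
  -- Convection and pressure are `C¹` and can be integrated by parts. The stress is merely
  -- continuous and stays in weak form.
  let T : Vec d → Tensor d := fun y => (gR (t, y) + gZ (t, y)) • tensorSq (gu (t, y))
    + gP (t, y) • ContinuousLinearMap.id ℝ (Vec d)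
  have hT1 : ContDiff ℝ 1 fun y => (gR (t, y) + gZ (t, y)) • tensorSq (gu (t, y)) :=
    ((contDiff_slice h.extR.contDiff t).add (contDiff_slice h.extZ.contDiff t)).smul
      (contDiff_tensorSq (contDiff_slice h.extu.contDiff t))
  have hPt := contDiff_slice hp.contDiff_P t
  have hT2 : ContDiff ℝ 1 fun y => gP (t, y) • ContinuousLinearMap.id ℝ (Vec d) :=
    hPt.smul contDiff_const
  have hT : ContDiff ℝ 1 T := hT1.add hT2
  have h2 := h.adm.domain.integral_contract_fderiv hT hψ hc hs
  have cdψ := hψ.continuous_fderiv one_ne_zero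
  have hslice : ∀ {F : Type} [TopologicalSpace F] {f : ℝ × Vec d → F}, Continuous f →
      Continuous fun x => f (t, x) := fun hf => hf.comp (Continuous.prodMk_right t)
  have i1 : Integrable (fun x => inner ℝ (timeDeriv (fun p => (gR p + gZ p) • gu p) (t, x)) (ψ x))
      D.dx := h.adm.integrable_dx
    ((hslice (continuous_timeDeriv h.contDiff_momentum)).inner hψ.continuous)
  have i2 : Integrable (fun x => contract (T x) (fderiv ℝ ψ x)) D.dx :=
    h.adm.integrable_dx (continuous_contract hT.continuous cdψ)
  have i3 : Integrable (fun x => contract (D.S (spaceDeriv gu (t, x))) (fderiv ℝ ψ x)) D.dx :=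
    h.adm.integrable_dx (continuous_contract (hslice h.continuous_S) cdψ)
  have i4 : Integrable (fun x => inner ℝ (force gR gZ gP gu (t, x)) (ψ x)) D.dx :=
    h.adm.integrable_dx ((hslice (h.continuous_force hp)).inner hψ.continuous)
  have e1 : ∫ x, momentumDensity D gR gZ gP gu (fun p : ℝ × Vec d => ψ p.2) (t, x) ∂D.dx
      = (∫ x, inner ℝ (timeDeriv (fun p => (gR p + gZ p) • gu p) (t, x)) (ψ x) ∂D.dx)
        - (∫ x, contract (T x) (fderiv ℝ ψ x) ∂D.dx)
        + ∫ x, contract (D.S (spaceDeriv gu (t, x))) (fderiv ℝ ψ x) ∂D.dx := by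
    have i5 : Integrable (fun x => inner ℝ (timeDeriv (fun p => (gR p + gZ p) • gu p) (t, x)) (ψ x)
      - contract (T x) (fderiv ℝ ψ x)) D.dx := i1.sub i2
    rw [← integral_sub i1 i2, ← integral_add i5 i3]
    refine integral_congr_ae (ae_of_all _ fun x => ?_)
    simp only [momentumDensity, spaceDeriv_comp_snd hψ, T, contract_add_left, contract_smul_left,
      contract_id]
    ring
  have e2 : ∫ x, inner ℝ (tensorDiv T x) (ψ x) ∂D.dx
      = (∫ x, inner ℝ (force gR gZ gP gu (t, x)) (ψ x) ∂D.dx)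
        - ∫ x, inner ℝ (timeDeriv (fun p => (gR p + gZ p) • gu p) (t, x)) (ψ x) ∂D.dx := by
    rw [← integral_sub i4 i1]
    refine integral_congr_ae (h.adm.ae_mem_closure.mono fun x hx => ?_)
    simp only
    rw [← h.momentum_eq_force ht hx, tensorDiv_add (hT1.differentiable one_ne_zero x)
      (hT2.differentiable one_ne_zero x), tensorDiv_smul_id (hPt.differentiable one_ne_zero x)]
    simp only [inner_add_left]
    ring
  change ∫ x, contract (T x) (fderiv ℝ ψ x) ∂D.dx = - ∫ x, inner ℝ (tensorDiv T x) (ψ x) ∂D.dx at h2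
  linarith

end RegularSolution

end ProblemData

end Bifluid

namespace Bifluid

open Module

/-! ### Local form of the distributional identities -/

section LocalEquations

variable {d : ℕ}

theorem eq_divergence_of_setIntegral {U : Set (Vec d)} (hU : IsOpen U) {f : Vec d → ℝ}
    {W : Vec d → Vec d} (hf : Continuous f) (hW : Continuous W)
    (h : ∀ ψ : Vec d → ℝ, ContDiff ℝ ∞ ψ → HasCompactSupport ψ → tsupport ψ ⊆ U →
      ∫ x in U, f x * ψ x = - ∫ x in U, fderiv ℝ ψ x (W x)) {x₀ : Vec d} (hx : x₀ ∈ U)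
    (hd : DifferentiableAt ℝ W x₀) : f x₀ = divergence W x₀ := by
  refine eq_divergence_of_distributional hU hf hW (fun ψ hψ hc hs => ?_) hx hd
  have h1 := h ψ hψ hc hs
  rwa [setIntegral_eq_integral_of_forall_compl_eq_zero fun x hx => ?_,
    setIntegral_eq_integral_of_forall_compl_eq_zero fun x hx => ?_] at h1
  · rw [image_eq_zero_of_notMem_tsupport fun h0 =>
      hx (hs (tsupport_fderiv_subset ℝ h0)), zero_apply]
  · rw [image_eq_zero_of_notMem_tsupport fun h0 => hx (hs h0), mul_zero]

/-- The left side is `∑ j, ∂_j S_ji` and the right side `∑ j, ∂_j S_ij`. They agree by symmetry. -/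
theorem divergence_apply_basisVec {S : Vec d → Tensor d}
    (hS : ∀ y i j, entry (S y) i j = entry (S y) j i) {x : Vec d} (hd : DifferentiableAt ℝ S x) (i : Fin d) :
    divergence (fun y => S y (basisVec i)) x = tensorDiv S x i := by
  have h1 : ∀ i, HasFDerivAt (fun y => S y (basisVec i)) _ x := fun i =>
    hd.hasFDerivAt.clm_apply (hasFDerivAt_const (basisVec i : Vec d) x)
  have h2 : ∀ i j, fderiv ℝ (fun y => entry (S y) i j) x
      = fderiv ℝ (fun y => entry (S y) j i) x := fun i j => by
    congr 1
    exact funext fun y => hS y i j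
  rw [divergence_eq_sum, tensorDiv_eq hd, WithLp.ofLp_sum, Finset.sum_apply]
  refine Finset.sum_congr rfl fun j _ => ?_
  rw [← fderiv_apply_coord (h1 i).differentiableAt, ← fderiv_apply_coord (h1 j).differentiableAt]
  exact congrArg (fun L : Vec d →L[ℝ] ℝ => L (basisVec j)) (h2 j i)

variable {F : Type*} [NormedAddCommGroup F] [NormedSpace ℝ F] {T : ℝ} {Ω : Set (Vec d)}
  {f : ℝ → Vec d → F} {g : ℝ × Vec d → F}

theorem IsC1Extension.eventuallyEq_space (h : IsC1Extension T Ω f g) (hΩ : IsOpen Ω) {t : ℝ}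
    (ht : t ∈ Icc 0 T) {x : Vec d} (hx : x ∈ Ω) : ∀ᶠ y in 𝓝 x, f t y = g (t, y) :=
  mem_of_superset (hΩ.mem_nhds hx) fun y hy => (h.eq t ht y (subset_closure hy)).symm

theorem IsC1Extension.eventuallyEq_time (h : IsC1Extension T Ω f g) {t : ℝ}
    (ht : t ∈ Ioo 0 T) {x : Vec d} (hx : x ∈ closure Ω) : ∀ᶠ s in 𝓝 t, f s x = g (s, x) :=
  mem_of_superset (Ioo_mem_nhds ht.1 ht.2) fun s hs => (h.eq s (Ioo_subset_Icc_self hs) x hx).symm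

end LocalEquations

/-! ### The classical equations -/

namespace ProblemData

variable {d : ℕ} {D : ProblemData d}

theorem WeakContinuity.deriv_add_divergence {r : ℝ → Vec d → ℝ} {rB : Vec d → ℝ}
    {u : ℝ → Vec d → Vec d} (h : D.WeakContinuity r rB u) (hD : D.Admissible)
    {g : ℝ × Vec d → ℝ} {gu : ℝ × Vec d → Vec d}
    (hg : IsC1Extension D.T D.Ω r g) (hgu : IsC1Extension D.T D.Ω u gu)
    {t : ℝ} (ht : t ∈ Ioo 0 D.T) {x : Vec d} (hx : x ∈ D.Ω) :
    deriv (fun s => r s x) t + divergence (fun y => r t y • u t y) x = 0 := by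
  have ht' := Ioo_subset_Icc_self ht
  have e1 : (fun s => r s x) =ᶠ[𝓝 t] fun s => g (s, x) :=
    hg.eventuallyEq_time ht (subset_closure hx)
  have e2 : (fun y => r t y • u t y) =ᶠ[𝓝 x] fun y => g (t, y) • gu (t, y) := by
    filter_upwards [hg.eventuallyEq_space hD.domain.isOpen ht' hx,
      hgu.eventuallyEq_space hD.domain.isOpen ht' hx] with y h1 h2
    rw [h1, h2]
  rw [e1.deriv_eq, (hasDerivAt_slice (hg.contDiff.differentiable one_ne_zero (t, x))).deriv,
    divergence, e2.fderiv_eq (𝕜 := ℝ)]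
  exact h.timeDeriv_add_divergence hD hg hgu ht' x (subset_closure hx)

namespace RegularSolution

variable {γ : ℝ} {R Z : ℝ → Vec d → ℝ} {u : ℝ → Vec d → Vec d} {Du : ℝ → Vec d → Tensor d}
  {m : ℝ → Vec d → Vec d} {M : ℝ → Fin d → Fin d → SignedMeasure (closure D.Ω)}
  {E : ℝ → SignedMeasure (closure D.Ω)} {gR gZ gP gq : ℝ × Vec d → ℝ} {gu : ℝ × Vec d → Vec d}

theorem fderiv_velocity (h : RegularSolution D γ R Z u Du m M E gR gZ gu) {t : ℝ}
    (ht : t ∈ Icc 0 D.T) {x : Vec d} (hx : x ∈ D.Ω) :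
    fderiv ℝ (u t) x = spaceDeriv gu (t, x) := by
  have e : u t =ᶠ[𝓝 x] fun y => gu (t, y) :=
    h.extu.eventuallyEq_space h.adm.domain.isOpen ht hx
  rw [e.fderiv_eq (𝕜 := ℝ)]
  exact (hasFDerivAt_slice (h.extu.contDiff.differentiable one_ne_zero (t, x))).fderiv

theorem viscousStress_eq (h : RegularSolution D γ R Z u Du m M E gR gZ gu) {t : ℝ}
    (ht : t ∈ Icc 0 D.T) {x : Vec d} (hx : x ∈ D.Ω) :
    D.viscousStress u t x = D.S (spaceDeriv gu (t, x)) := by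
  rw [viscousStress, h.fderiv_velocity ht hx]

theorem viscousStress_eventuallyEq (h : RegularSolution D γ R Z u Du m M E gR gZ gu) {t : ℝ}
    (ht : t ∈ Icc 0 D.T) {x : Vec d} (hx : x ∈ D.Ω) :
    D.viscousStress u t =ᶠ[𝓝 x] fun y => D.S (spaceDeriv gu (t, y)) :=
  mem_of_superset (h.adm.domain.isOpen.mem_nhds hx) fun _ hy => h.viscousStress_eq ht hy

theorem momentumLHS_eq (h : RegularSolution D γ R Z u Du m M E gR gZ gu)
    (hp : PressureExtension D gR gZ gP gq) {t : ℝ} (ht : t ∈ Ioo 0 D.T) {x : Vec d}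
    (hx : x ∈ D.Ω) : D.momentumLHS R Z u t x = force gR gZ gP gu (t, x) := by
  have ht' := Ioo_subset_Icc_self ht
  have hxc := subset_closure hx
  have hΩ := h.adm.domain.isOpen
  have e1 : (fun s => (R s x + Z s x) • u s x)
      =ᶠ[𝓝 t] fun s => (gR (s, x) + gZ (s, x)) • gu (s, x) := by
    filter_upwards [h.extR.eventuallyEq_time ht hxc, h.extZ.eventuallyEq_time ht hxc,
      h.extu.eventuallyEq_time ht hxc] with s h1 h2 h3
    rw [h1, h2, h3]
  have e2 : (fun y => (R t y + Z t y) • tensorSq (u t y))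
      =ᶠ[𝓝 x] fun y => (gR (t, y) + gZ (t, y)) • tensorSq (gu (t, y)) := by
    filter_upwards [h.extR.eventuallyEq_space hΩ ht' hx, h.extZ.eventuallyEq_space hΩ ht' hx,
      h.extu.eventuallyEq_space hΩ ht' hx] with y h1 h2 h3
    rw [h1, h2, h3]
  have e3 : (fun y => D.P (R t y, Z t y)) =ᶠ[𝓝 x] fun y => gP (t, y) := by
    filter_upwards [h.extR.eventuallyEq_space hΩ ht' hx, h.extZ.eventuallyEq_space hΩ ht' hx,
      hΩ.mem_nhds hx] with y h1 h2 hy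
    rw [h1, h2, hp.P_eq t ht' y (subset_closure hy)]
  rw [← h.momentum_eq_force ht' hxc, momentumLHS, e1.deriv_eq, tensorDiv,
    e2.fderiv_eq (𝕜 := ℝ), gradient, e3.fderiv_eq (𝕜 := ℝ),
    (hasDerivAt_slice (h.contDiff_momentum.differentiable one_ne_zero (t, x))).deriv]
  rfl

/-- The time derivative and the flux reduce to the power of the force after subtracting multiples of
three equations: the continuity equation for `R` times `½|u|² + q`, the one for `Z` times `½|u|²`,
and the transport equation for `q`. -/
theorem energyLHS_eq (h : RegularSolution D γ R Z u Du m M E gR gZ gu)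
    (hp : PressureExtension D gR gZ gP gq) {t : ℝ} (ht : t ∈ Ioo 0 D.T) {x : Vec d}
    (hx : x ∈ D.Ω) :
    D.energyLHS R Z u t x = inner ℝ (force gR gZ gP gu (t, x)) (gu (t, x)) := by
  have ht' := Ioo_subset_Icc_self ht
  have hxc := subset_closure hx
  have hΩ := h.adm.domain.isOpen
  have e1 : (fun s => D.totalEnergy (R s x) (Z s x) (u s x)) =ᶠ[𝓝 t] fun s =>
      1 / 2 * (gR (s, x) + gZ (s, x)) * ‖gu (s, x)‖ ^ 2 + gR (s, x) * gq (s, x) := by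
    filter_upwards [h.extR.eventuallyEq_time ht hxc, h.extZ.eventuallyEq_time ht hxc,
      h.extu.eventuallyEq_time ht hxc, Ioo_mem_nhds ht.1 ht.2] with s h1 h2 h3 hs
    rw [h1, h2, h3, totalEnergy, hp.H_eq s (Ioo_subset_Icc_self hs) x hxc]
  have e2 : (fun y => (D.totalEnergy (R t y) (Z t y) (u t y) + D.P (R t y, Z t y)) • u t y)
      =ᶠ[𝓝 x] fun y => (1 / 2 * (gR (t, y) + gZ (t, y)) * ‖gu (t, y)‖ ^ 2
        + gR (t, y) * gq (t, y) + gP (t, y)) • gu (t, y) := by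
    filter_upwards [h.extR.eventuallyEq_space hΩ ht' hx, h.extZ.eventuallyEq_space hΩ ht' hx,
      h.extu.eventuallyEq_space hΩ ht' hx, hΩ.mem_nhds hx] with y h1 h2 h3 hy
    rw [h1, h2, h3, totalEnergy, hp.H_eq t ht' y (subset_closure hy),
      hp.P_eq t ht' y (subset_closure hy)]
  have dR := h.extR.contDiff.differentiable one_ne_zero (t, x)
  have dZ := h.extZ.contDiff.differentiable one_ne_zero (t, x)
  have du := h.extu.contDiff.differentiable one_ne_zero (t, x)
  have dq := hp.contDiff_q.differentiable one_ne_zero (t, x)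
  have dP := hp.contDiff_P.differentiable one_ne_zero (t, x)
  have e3 : deriv (fun s => 1 / 2 * (gR (s, x) + gZ (s, x)) * ‖gu (s, x)‖ ^ 2
      + gR (s, x) * gq (s, x)) t = _ :=
    ((((hasDerivAt_slice dR).add (hasDerivAt_slice dZ)).const_mul (1 / 2)).mul
      (hasDerivAt_slice du).norm_sq |>.add ((hasDerivAt_slice dR).mul (hasDerivAt_slice dq))).deriv
  have e4 : HasFDerivAt (fun y => 1 / 2 * (gR (t, y) + gZ (t, y)) * ‖gu (t, y)‖ ^ 2
      + gR (t, y) * gq (t, y) + gP (t, y)) _ x :=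
    ((((hasFDerivAt_slice dR).add (hasFDerivAt_slice dZ)).const_mul (1 / 2)).mul
      (hasFDerivAt_slice du).norm_sq |>.add
      ((hasFDerivAt_slice dR).mul (hasFDerivAt_slice dq))).add (hasFDerivAt_slice dP)
  have hR := h.mass_R ht' hxc
  have hZ := h.mass_Z ht' hxc
  have hq := h.transport_q hp ht' hxc
  rw [energyLHS, e1.deriv_eq, divergence, e2.fderiv_eq (𝕜 := ℝ), ← divergence,
    divergence_smul e4.differentiableAt (hasFDerivAt_slice du).differentiableAt, e3, e4.fderiv,
    divergence, (hasFDerivAt_slice du).fderiv, force, inner_add_left, inner_gradient_left,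
    (hasFDerivAt_slice dP).fderiv]
  simp only [add_apply, smul_apply, smul_eq_mul, Pi.add_apply, ContinuousLinearMap.comp_apply,
    innerSL_apply_apply, real_inner_smul_left, inner_add_left]
  rw [real_inner_comm (gu (t, x)) (timeDeriv gu (t, x)),
    real_inner_comm (gu (t, x)) (spaceDeriv gu (t, x) (gu (t, x)))]
  linear_combination (1 / 2 * ‖gu (t, x)‖ ^ 2 + gq (t, x)) * hR + 1 / 2 * ‖gu (t, x)‖ ^ 2 * hZ + hq

/-- This is the momentum equation tested with `ψ u`, a field that is only `C¹`. The gradient of `ψ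
u` contributes the dissipation times `ψ` and, by symmetry of the stress, the term `∇ψ · (S u)`. -/
theorem integral_force_inner_velocity (h : RegularSolution D γ R Z u Du m M E gR gZ gu)
    (hp : PressureExtension D gR gZ gP gq) {t : ℝ} (ht : t ∈ Icc 0 D.T) {ψ : Vec d → ℝ}
    (hψ : ContDiff ℝ 1 ψ) (hc : HasCompactSupport ψ) (hs : tsupport ψ ⊆ D.Ω) :
    ∫ x, (inner ℝ (force gR gZ gP gu (t, x)) (gu (t, x))
        + contract (D.S (spaceDeriv gu (t, x))) (spaceDeriv gu (t, x))) * ψ x ∂D.dx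
      = - ∫ x, fderiv ℝ ψ x (D.S (spaceDeriv gu (t, x)) (gu (t, x))) ∂D.dx := by
  have hgu := contDiff_slice h.extu.contDiff t
  have hφ : ContDiff ℝ 1 fun x => ψ x • gu (t, x) := hψ.smul hgu
  have hsub : Function.support (fun x => ψ x • gu (t, x)) ⊆ Function.support ψ := fun x hx => by
    rw [Function.mem_support] at hx ⊢
    exact fun h0 => hx (by rw [h0, zero_smul])
  have h1 := h.integral_force hp ht hφ (hc.mono hsub) ((closure_mono hsub).trans hs)
  have hslice : ∀ {F : Type} [TopologicalSpace F] {f : ℝ × Vec d → F}, Continuous f →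
      Continuous fun x => f (t, x) := fun hf => hf.comp (Continuous.prodMk_right t)
  have cS := hslice h.continuous_S
  have cu := hgu.continuous
  have cD := hslice (continuous_spaceDeriv h.extu.contDiff)
  have i1 : Integrable (fun x => inner ℝ (force gR gZ gP gu (t, x)) (ψ x • gu (t, x))) D.dx :=
    h.adm.integrable_dx ((hslice (h.continuous_force hp)).inner hφ.continuous)
  have i2 : Integrable (fun x => contract (D.S (spaceDeriv gu (t, x))) (spaceDeriv gu (t, x)) * ψ x)
      D.dx := h.adm.integrable_dx ((continuous_contract cS cD).mul hψ.continuous)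
  have i3 : Integrable (fun x => fderiv ℝ ψ x (D.S (spaceDeriv gu (t, x)) (gu (t, x)))) D.dx :=
    h.adm.integrable_dx ((hψ.continuous_fderiv one_ne_zero).clm_apply (cS.clm_apply cu))
  have h2 : ∀ x, contract (D.S (spaceDeriv gu (t, x))) (fderiv ℝ (fun x => ψ x • gu (t, x)) x)
      = contract (D.S (spaceDeriv gu (t, x))) (spaceDeriv gu (t, x)) * ψ x
        + fderiv ℝ ψ x (D.S (spaceDeriv gu (t, x)) (gu (t, x))) := fun x => by
    have h3 : fderiv ℝ (fun x => ψ x • gu (t, x)) x = _ :=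
      ((hψ.differentiable one_ne_zero x).hasFDerivAt.smul (hasFDerivAt_slice
        (h.extu.contDiff.differentiable one_ne_zero (t, x)))).fderiv
    rw [h3, contract_add_right, contract_smul_right,
      contract_smulRight (S := D.S _) (entry_stress_symm _ _ _), mul_comm]
  simp only [h2] at h1
  rw [integral_add i2 i3] at h1
  have h4 : ∫ x, (inner ℝ (force gR gZ gP gu (t, x)) (gu (t, x))
        + contract (D.S (spaceDeriv gu (t, x))) (spaceDeriv gu (t, x))) * ψ x ∂D.dx
      = (∫ x, inner ℝ (force gR gZ gP gu (t, x)) (ψ x • gu (t, x)) ∂D.dx)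
        + ∫ x, contract (D.S (spaceDeriv gu (t, x))) (spaceDeriv gu (t, x)) * ψ x ∂D.dx := by
    rw [← integral_add i1 i2]
    refine integral_congr_ae (ae_of_all _ fun x => ?_)
    simp only [real_inner_smul_right]
    ring
  rw [h4]
  linarith

/-- Tests of the form `ψ e_i` reduce the `i`-th component to the scalar statement for the vector
field `S e_i`. -/
theorem force_eq_tensorDiv (h : RegularSolution D γ R Z u Du m M E gR gZ gu)
    (hp : PressureExtension D gR gZ gP gq) {t : ℝ} (ht : t ∈ Icc 0 D.T) {x : Vec d}
    (hx : x ∈ D.Ω) (hd : DifferentiableAt ℝ (fun y => D.S (spaceDeriv gu (t, y))) x) :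
    force gR gZ gP gu (t, x) = tensorDiv (fun y => D.S (spaceDeriv gu (t, y))) x := by
  have hsymm : ∀ y i j, entry (D.S (spaceDeriv gu (t, y))) i j
      = entry (D.S (spaceDeriv gu (t, y))) j i := fun y => entry_stress_symm _ _ _
  have cS : Continuous fun y => D.S (spaceDeriv gu (t, y)) :=
    h.continuous_S.comp (Continuous.prodMk_right t)
  have cF : Continuous fun y => force gR gZ gP gu (t, y) :=
    (h.continuous_force hp).comp (Continuous.prodMk_right t)
  ext i
  rw [← divergence_apply_basisVec hsymm hd i]
  refine eq_divergence_of_setIntegral h.adm.domain.isOpen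
    (f := fun y => force gR gZ gP gu (t, y) i)
    ((EuclideanSpace.proj i : Vec d →L[ℝ] ℝ).continuous.comp cF) (cS.clm_apply continuous_const)
    (fun ψ hψ hc hs => ?_) hx (hd.clm_apply (differentiableAt_const _))
  have hψ1 : ContDiff ℝ 1 ψ := hψ.of_le (by exact_mod_cast le_top)
  have hsub : Function.support (fun x => ψ x • (basisVec i : Vec d)) ⊆ Function.support ψ :=
    fun x hx => by
      rw [Function.mem_support] at hx ⊢
      exact fun h0 => hx (by rw [h0, zero_smul])
  have h1 := h.integral_force hp ht (ψ := fun x => ψ x • basisVec i) (hψ1.smul contDiff_const)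
    (hc.mono hsub) ((closure_mono hsub).trans hs)
  have h2 : ∀ y, contract (D.S (spaceDeriv gu (t, y)))
      (fderiv ℝ (fun x => ψ x • (basisVec i : Vec d)) y)
      = fderiv ℝ ψ y (D.S (spaceDeriv gu (t, y)) (basisVec i)) := fun y => by
    rw [((hψ1.differentiable one_ne_zero y).hasFDerivAt.smul_const (basisVec i : Vec d)).fderiv,
      contract_smulRight (hsymm y)]
  simp only [h2, real_inner_smul_right, inner_basisVec] at h1
  refine Eq.trans ?_ h1
  exact integral_congr_ae (ae_of_all _ fun y => mul_comm _ _)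

theorem force_inner_velocity_eq_divergence (h : RegularSolution D γ R Z u Du m M E gR gZ gu)
    (hp : PressureExtension D gR gZ gP gq) {t : ℝ} (ht : t ∈ Icc 0 D.T) {x : Vec d}
    (hx : x ∈ D.Ω) (hd : DifferentiableAt ℝ (fun y => D.S (spaceDeriv gu (t, y))) x) :
    inner ℝ (force gR gZ gP gu (t, x)) (gu (t, x))
        + contract (D.S (spaceDeriv gu (t, x))) (spaceDeriv gu (t, x))
      = divergence (fun y => D.S (spaceDeriv gu (t, y)) (gu (t, y))) x := by
  have cS : Continuous fun y => D.S (spaceDeriv gu (t, y)) :=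
    h.continuous_S.comp (Continuous.prodMk_right t)
  have cF : Continuous fun y => force gR gZ gP gu (t, y) :=
    (h.continuous_force hp).comp (Continuous.prodMk_right t)
  have cD : Continuous fun y => spaceDeriv gu (t, y) :=
    (continuous_spaceDeriv h.extu.contDiff).comp (Continuous.prodMk_right t)
  have hgu := contDiff_slice h.extu.contDiff t
  exact eq_divergence_of_setIntegral h.adm.domain.isOpen
    (f := fun y => inner ℝ (force gR gZ gP gu (t, y)) (gu (t, y))
        + contract (D.S (spaceDeriv gu (t, y))) (spaceDeriv gu (t, y)))
    ((cF.inner hgu.continuous).add (continuous_contract cS cD)) (cS.clm_apply hgu.continuous)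
    (fun ψ hψ hc hs => h.integral_force_inner_velocity hp ht
      (hψ.of_le (by exact_mod_cast le_top)) hc hs)
    hx (hd.clm_apply (hgu.differentiable one_ne_zero x))

theorem isClassicalSolution (h : RegularSolution D γ R Z u Du m M E gR gZ gu)
    (hp : PressureExtension D gR gZ gP gq) : D.IsClassicalSolution R Z u where
  mass_R t ht x hx := h.sol.continuity_R.deriv_add_divergence h.adm h.extR h.extu ht hx
  mass_Z t ht x hx := h.sol.continuity_Z.deriv_add_divergence h.adm h.extZ h.extu ht hx
  momentum t ht ψ hψ hc hs := by
    have ht' := Ioo_subset_Icc_self ht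
    have h1 := h.integral_force hp ht' (hψ.of_le (by exact_mod_cast le_top)) hc hs
    convert h1 using 1
    · exact integral_congr_ae (h.adm.ae_mem.mono fun x hx => by
        simp only [h.momentumLHS_eq hp ht hx])
    · exact congrArg _ (integral_congr_ae (h.adm.ae_mem.mono fun x hx => by
        simp only [h.viscousStress_eq ht' hx]))
  momentum_pointwise t ht x hx hd := by
    have ht' := Ioo_subset_Icc_self ht
    have e := h.viscousStress_eventuallyEq ht' hx
    rw [h.momentumLHS_eq hp ht hx, tensorDiv, e.fderiv_eq (𝕜 := ℝ)]
    exact h.force_eq_tensorDiv hp ht' hx (e.differentiableAt_iff.mp hd)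
  energy t ht ψ hψ hc hs := by
    have ht' := Ioo_subset_Icc_self ht
    have h1 := h.integral_force_inner_velocity hp ht' (hψ.of_le (by exact_mod_cast le_top)) hc hs
    convert h1 using 1
    · exact integral_congr_ae (h.adm.ae_mem.mono fun x hx => by
        simp only [h.energyLHS_eq hp ht hx, h.viscousStress_eq ht' hx, h.fderiv_velocity ht' hx])
    · exact congrArg _ (integral_congr_ae (h.adm.ae_mem.mono fun x hx => by
        simp only [h.viscousStress_eq ht' hx, h.extu.eq t ht' x (subset_closure hx)]))
  energy_pointwise t ht x hx hd := by
    have ht' := Ioo_subset_Icc_self ht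
    have e := h.viscousStress_eventuallyEq ht' hx
    have e1 : (fun y => D.viscousStress u t y (u t y))
        =ᶠ[𝓝 x] fun y => D.S (spaceDeriv gu (t, y)) (gu (t, y)) := by
      filter_upwards [e, h.extu.eventuallyEq_space h.adm.domain.isOpen ht' hx] with y h1 h2
      rw [h1, h2]
    rw [h.energyLHS_eq hp ht hx, divergence, e1.fderiv_eq (𝕜 := ℝ), h.viscousStress_eq ht' hx,
      h.fderiv_velocity ht' hx, eq_sub_iff_add_eq]
    exact h.force_inner_velocity_eq_divergence hp ht' hx (e.differentiableAt_iff.mp hd)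
  boundary_u t ht x hx := by
    rw [← h.extu.eq t ht x (frontier_subset_closure hx), h.velocity.2 t ht x hx]
  boundary_RZ := by
    filter_upwards [h.ae_inflow, ae_restrict_of_ae ae_dS_mem_frontier] with x h1 hx t ht
    have hxc := frontier_subset_closure hx
    rw [← h.extR.eq t ht x hxc, ← h.extZ.eq t ht x hxc]
    exact h1 t ht
  initial := by
    have h0 : (0 : ℝ) ∈ Icc 0 D.T := ⟨le_rfl, h.adm.T_pos.le⟩
    filter_upwards [h.initial_ae, h.adm.ae_mem_closure] with x h1 hx
    rw [← h.extR.eq 0 h0 x hx, ← h.extZ.eq 0 h0 x hx, ← h.extu.eq 0 h0 x hx]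
    exact ⟨h1.1, h1.2.1, h1.2.2.1⟩

end RegularSolution

end ProblemData

end Bifluid

theorem mainTheorem2 {d : ℕ} (D : Bifluid.ProblemData d) (hD : D.Admissible)
    (γ : ℝ) (R Z : ℝ → Bifluid.Vec d → ℝ) (u : ℝ → Bifluid.Vec d → Bifluid.Vec d)
    (Du : ℝ → Bifluid.Vec d → Bifluid.Tensor d) (m : ℝ → Bifluid.Vec d → Bifluid.Vec d)
    (M : ℝ → Fin d → Fin d → SignedMeasure (closure D.Ω))
    (E : ℝ → SignedMeasure (closure D.Ω))
    (hsol : D.IsDissipativeTurbulentSolution γ R Z u Du m M E)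
    (hu : Bifluid.IsC1UpToBoundary D.T D.Ω u)
    (hR : Bifluid.IsC1UpToBoundary D.T D.Ω R)
    (hZ : Bifluid.IsC1UpToBoundary D.T D.Ω Z)
    (hinf : ∃ c : ℝ, 0 < c ∧ ∀ t ∈ Ioo 0 D.T, ∀ x ∈ D.Ω, c ≤ Z t x) :
    (∀ᵐ t ∂D.timeMeasure, E t = 0 ∧ ∀ i j, M t i j = 0) ∧ D.IsClassicalSolution R Z u := by
  obtain ⟨gu, hgu, hgu'⟩ := hu
  obtain ⟨gR, hgR, hgR'⟩ := hR
  obtain ⟨gZ, hgZ, hgZ'⟩ := hZ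
  have h : Bifluid.ProblemData.RegularSolution D γ R Z u Du m M E gR gZ gu :=
    ⟨hD, hsol, ⟨hgR, hgR'⟩, ⟨hgZ, hgZ'⟩, ⟨hgu, hgu'⟩, hinf⟩
  obtain ⟨gP, gq, h1, h2, h3, h4, h5⟩ := h.exists_pressure
  have hp : Bifluid.ProblemData.PressureExtension D gR gZ gP gq := ⟨h1, h2, h3, h4, h5⟩
  exact ⟨h.defects_eq_zero hp, h.isClassicalSolution hp⟩
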